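/- Let $h_0=1.26$. Let $\mathcal V$ be the set of all $V\subset\mathbb R^3$ with exactly twelve points, all at distance $2$ from the origin, such that any two distinct points $u,v\in V$ satisfy $\|u-v\|=2$ or $\|u-v\|\ge 2h_0$. Let $E_2(V)=\{\{v,w\}\subset V : \|v-w\|=2\}$ and $E(v)=\{w : \{v,w\}\in E_2(V)\}$. A hypermap is a finite set $D$ of darts with permutations $e,n,f$ such that $e\,n\,f=\mathrm{id}_D$; the orbits of $e,n,f$ are its edges, nodes and faces. An isomorphism of hypermaps is a bijection of the dart sets that commutes with $e$, $n$ and $f$. The contact hypermap $\mathrm{hyp}(V,E_2(V))$ has as darts the pairs $(v,w)$ with $\{v,w\}\in E_2(V)$, together with a dart $(v,v)$, fixed by $e,n,f$, for each $v\in V$ with $E(v)=\varnothing$. On the other darts $e(v,w)=(w,v)$, $n(v,w)=(v,\sigma(v)w)$, $f(v,w)=(w,\sigma(w)^{-1}v)$, where $\sigma(v)$ is the cyclic permutation of $E(v)$ in counterclockwise order about $v$ as seen from outside the sphere. Let $\mathrm{tgt}=1.541$. Let $d_1(k)=0$ for $k\le 3$, $d_1(k)=0.206+0.27(k-4)$ for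 $4\le k\le 8$, and $d_1(k)=\mathrm{tgt}$ for $k>8$. Let $b(0,3)=b(1,3)=0.618$, $b(2,2)=0.412$, and $b(p,q)=\mathrm{tgt}$ for all other $(p,q)\in\mathbb N^2$. A hypermap has tame contact if 1. it is biconnected (connected, and remaining connected after the deletion of any one node), and each face meets each node in at most one dart; 2. it is plain ($e^2=\mathrm{id}$) and planar ($\#n+\#e+\#f=\mathrm{card}(D)+2$, where $\#$ counts orbits); 3. $e$ has no fixed points; 4. the two darts of each edge lie in different nodes; 5. at most one edge meets any two given (distinct) nodes; 6. it has at least two faces; 7. each face has at least $3$ and at most $8$ darts; 8. it has twelve nodes; 9. each node has at least $2$ and at most $4$ darts; 10. there is a function $\tau\ge 0$ on the set of faces with $\sum_F\tau(F)<\mathrm{tgt}$, with $\tau(F)\ge d_1(\mathrm{card}\,F)$ for every face $F$, and such that at every node that meets exactly $p$ triangular faces, $q$ quadrilateral faces and no other faces, the sum of $\tau(F)$ over the faces $F$ meeting the node is at least $b(p,q)$. The FCC pattern consists of the twelve vectors $\sqrt2\,x$, where $x$ runs over the permutations of $(\pm1,\pm1,0)$. The HCP pattern consists of the twelve vectors $(\pm2,0,0)$,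 $(\pm1,\pm\sqrt3,0)$, $(\pm1,1/\sqrt3,\pm\sqrt{8/3})$, $(0,-2/\sqrt3,\pm\sqrt{8/3})$, all signs being independent. Both belong to $\mathcal V$. **Lemma.** Let $V\in\mathcal V$, and suppose that $\mathrm{hyp}(V,E_2(V))$ has tame contact. Then $\mathrm{hyp}(V,E_2(V))$ is isomorphic to the contact hypermap of the FCC pattern or to the contact hypermap of the HCP pattern. -/

import Mathlib

namespace KissingTwelve

noncomputable section

open scoped RealInnerProductSpace

/-! ## Packings and the class of twelve-point configurations -/

/-- Euclidean three-space. -/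
abbrev Space : Type := EuclideanSpace ℝ (Fin 3)

/-- A packing of unit balls, identified with its set of centers. -/
def IsPacking (V : Set Space) : Prop :=
  ∀ v ∈ V, ∀ w ∈ V, dist v w < 2 → v = w

/-- The truncation parameter. -/
def h0 : ℝ := 1.26

/-- Packings of twelve points on the sphere of radius `2` about the origin, any two distinct points
of which are at distance `2` or at least `2 * h0`. -/
structure IsConfig (V : Set Space) : Prop where
  packing : IsPacking V
  card : V.ncard = 12
  sphere : V ⊆ Metric.sphere (0 : Space) 2
  gap : ∀ u ∈ V, ∀ v ∈ V, u = v ∨ dist u v = 2 ∨ 2 * h0 ≤ dist u v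

/-- The contact edges: unordered pairs of points of `V` at distance `2`. -/
def contactEdges (V : Set Space) : Set (Set Space) :=
  {ε | ∃ v ∈ V, ∃ w ∈ V, dist v w = 2 ∧ ε = {v, w}}

/-! ## Fans -/

/-- `C(S)`: all linear combinations of the finite set `S` with nonnegative coefficients (the
coefficient of the origin in the affine combination is free). -/
def coneOf (S : Set Space) : Set Space := (PointedCone.hull ℝ S : PointedCone ℝ Space)

/-- `(V, E)` is a fan. -/
structure IsFan (V : Set Space) (E : Set (Set Space)) : Prop where
  edges : ∀ ε ∈ E, ∃ v ∈ V, ∃ w ∈ V, v ≠ w ∧ ε = {v, w}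
  finite : V.Finite
  nonempty : V.Nonempty
  origin : (0 : Space) ∉ V
  nonparallel : ∀ v w : Space, {v, w} ∈ E → ¬ Collinear ℝ {0, v, w}
  intersection : ∀ ε ∈ E ∪ {δ | ∃ v ∈ V, δ = {v}}, ∀ ε' ∈ E ∪ {δ | ∃ v ∈ V, δ = {v}},
    coneOf ε ∩ coneOf ε' = coneOf (ε ∩ ε')

/-- `E(v)`: the points adjacent to `v`. -/
def nbrs (E : Set (Set Space)) (v : Space) : Set Space := {w | {v, w} ∈ E}

/-! ## Azimuth angles -/

/-- The determinant with rows `u`, `v`, `w`. -/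
def det3 (u v w : Space) : ℝ := Matrix.det (Matrix.of ![u.ofLp, v.ofLp, w.ofLp])

/-- The argument of a complex number, taken in `[0, 2π)`. -/
def arg02pi (z : ℂ) : ℝ := toIcoMod Real.two_pi_pos 0 z.arg

/-- A positive multiple of `π_v(w) / π_v(u)`, where `π_v` is the orientation-preserving orthogonal
projection along `v` onto the complex plane (see `azim_eq`). -/
def azimNum (v u w : Space) : ℂ :=
  ⟨⟪v, v⟫ * ⟪u, w⟫ - ⟪v, u⟫ * ⟪v, w⟫, ‖v‖ * det3 v u w⟩

/-- The azimuth angle `azim(0, v, u, w)`. -/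
def azim (v u w : Space) : ℝ := arg02pi (azimNum v u w)

/-- `π` is a real-linear map to `ℂ` with `v` in its kernel, for which the preimages `e₁`, `e₂` of
`1`, `i` form together with `v / ‖v‖` a positively oriented orthonormal basis. -/
def IsAzimProjection (v : Space) (π : Space →ₗ[ℝ] ℂ) : Prop :=
  π v = 0 ∧ ∃ e₁ e₂ : Space, π e₁ = 1 ∧ π e₂ = Complex.I ∧
    Orthonormal ℝ ![e₁, e₂, ‖v‖⁻¹ • v] ∧ 0 < det3 e₁ e₂ (‖v‖⁻¹ • v)

lemma inner_coord (u w : Space) : ⟪u, w⟫ = u 0 * w 0 + u 1 * w 1 + u 2 * w 2 := by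
  simp [PiLp.inner_apply, Fin.sum_univ_three, mul_comm]

lemma det3_coord (u v w : Space) : det3 u v w =
    u 0 * v 1 * w 2 - u 0 * v 2 * w 1 - u 1 * v 0 * w 2 + u 1 * v 2 * w 0
      + u 2 * v 0 * w 1 - u 2 * v 1 * w 0 := by
  simp [det3, Matrix.det_fin_three]

lemma azimNum_mul (v u w x : Space) :
    azimNum v u w * azimNum v w x = azimNum v w w * azimNum v u x := by
  have hs : ‖v‖ * ‖v‖ = v 0 * v 0 + v 1 * v 1 + v 2 * v 2 := by
    rw [← real_inner_self_eq_norm_mul_norm, inner_coord]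
  apply Complex.ext
  · simp only [azimNum, Complex.mul_re, inner_coord, det3_coord]
    linear_combination (-(v 0 * u 1 * w 2 - v 0 * u 2 * w 1 - v 1 * u 0 * w 2 + v 1 * u 2 * w 0
      + v 2 * u 0 * w 1 - v 2 * u 1 * w 0) * (v 0 * w 1 * x 2 - v 0 * w 2 * x 1 - v 1 * w 0 * x 2
      + v 1 * w 2 * x 0 + v 2 * w 0 * x 1 - v 2 * w 1 * x 0)) * hs
  · simp only [azimNum, Complex.mul_im, inner_coord, det3_coord]
    ring

lemma azim_eq {v : Space} {π : Space →ₗ[ℝ] ℂ} (h : IsAzimProjection v π) (u w : Space) :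
    azim v u w = arg02pi (π w / π u) := by
  obtain ⟨hv, e₁, e₂, h1, h2, hon, hdet⟩ := h
  have hv0 : v ≠ 0 := by
    rintro rfl
    simpa using hon.1 2
  have hn : 0 < ‖v‖ := norm_pos_iff.mpr hv0
  set e₃ : Space := ‖v‖⁻¹ • v with he₃
  have hve : v = ‖v‖ • e₃ := by rw [he₃, smul_smul, mul_inv_cancel₀ hn.ne', one_smul]
  have hπ3 : π e₃ = 0 := by rw [he₃, map_smul, hv, smul_zero]
  have hspan : ⊤ ≤ Submodule.span ℝ (Set.range ![e₁, e₂, e₃]) := by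
    have := hon.linearIndependent.span_eq_top_of_card_eq_finrank (by simp)
    rw [this]
  have key : ∀ x : Space, ∃ a b c : ℝ, x = a • e₁ + b • e₂ + c • e₃ := by
    intro x
    have hx : x ∈ Submodule.span ℝ (Set.range ![e₁, e₂, e₃]) := hspan trivial
    rw [Submodule.mem_span_range_iff_exists_fun] at hx
    obtain ⟨c, hc⟩ := hx
    refine ⟨c 0, c 1, c 2, ?_⟩
    rw [← hc, Fin.sum_univ_three]
    rfl
  have g11 : ⟪e₁, e₁⟫ = 1 := by
    have := hon.1 0
    simp at this
    simp [this]
  have g22 : ⟪e₂, e₂⟫ = 1 := by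
    have := hon.1 1
    simp at this
    simp [this]
  have g33 : ⟪e₃, e₃⟫ = 1 := by
    have : ‖e₃‖ = 1 := hon.1 2
    rw [real_inner_self_eq_norm_mul_norm, this, one_mul]
  have g12 : ⟪e₁, e₂⟫ = 0 := hon.2 (show (0 : Fin 3) ≠ 1 by decide)
  have g13 : ⟪e₁, e₃⟫ = 0 := hon.2 (show (0 : Fin 3) ≠ 2 by decide)
  have g23 : ⟪e₂, e₃⟫ = 0 := hon.2 (show (1 : Fin 3) ≠ 2 by decide)
  have hd1 : det3 e₁ e₂ e₃ = 1 := by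
    have hsq : det3 e₁ e₂ e₃ * det3 e₁ e₂ e₃ =
        ⟪e₁, e₁⟫ * ⟪e₂, e₂⟫ * ⟪e₃, e₃⟫ + 2 * ⟪e₁, e₂⟫ * ⟪e₂, e₃⟫ * ⟪e₁, e₃⟫
        - ⟪e₁, e₁⟫ * ⟪e₂, e₃⟫ ^ 2 - ⟪e₂, e₂⟫ * ⟪e₁, e₃⟫ ^ 2 - ⟪e₃, e₃⟫ * ⟪e₁, e₂⟫ ^ 2 := by
      simp only [inner_coord, det3_coord]
      ring
    rw [g11, g22, g33, g12, g13, g23] at hsq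
    nlinarith
  obtain ⟨a, b, c, rfl⟩ := key u
  obtain ⟨a', b', c', rfl⟩ := key w
  have hdet' : det3 v (a • e₁ + b • e₂ + c • e₃) (a' • e₁ + b' • e₂ + c' • e₃)
      = ‖v‖ * (a * b' - b * a') := by
    have : det3 (‖v‖ • e₃) (a • e₁ + b • e₂ + c • e₃) (a' • e₁ + b' • e₂ + c' • e₃)
        = ‖v‖ * (a * b' - b * a') * det3 e₁ e₂ e₃ := by
      simp only [det3_coord, PiLp.add_apply, PiLp.smul_apply, smul_eq_mul]
      ring
    rw [← hve, hd1, mul_one] at this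
    exact this
  have hvv : ⟪v, v⟫ = ‖v‖ * ‖v‖ := real_inner_self_eq_norm_mul_norm v
  have hvx : ∀ a b c : ℝ, ⟪v, a • e₁ + b • e₂ + c • e₃⟫ = ‖v‖ * c := by
    intro a b c
    rw [hve]
    simp only [inner_add_right, inner_smul_right, inner_smul_left, real_inner_comm e₁ e₃,
      real_inner_comm e₂ e₃, g13, g23, g33]
    rw [← hve]
    simp [mul_comm]
  have huw : ⟪a • e₁ + b • e₂ + c • e₃, a' • e₁ + b' • e₂ + c' • e₃⟫
      = a * a' + b * b' + c * c' := by
    simp only [inner_add_right, inner_add_left, inner_smul_right, inner_smul_left,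
      real_inner_comm e₁ e₃, real_inner_comm e₂ e₃, real_inner_comm e₁ e₂, g11, g22, g12, g13, g23,
      g33]
    simp
    ring
  have hπ : ∀ a b c : ℝ, π (a • e₁ + b • e₂ + c • e₃) = ⟨a, b⟩ := by
    intro a b c
    rw [map_add, map_add, map_smul, map_smul, map_smul, h1, h2, hπ3]
    apply Complex.ext <;> simp
  unfold azim arg02pi
  congr 1
  rw [hπ, hπ]
  have hnum : azimNum v (a • e₁ + b • e₂ + c • e₃) (a' • e₁ + b' • e₂ + c' • e₃)
      = ((‖v‖ * ‖v‖ : ℝ) : ℂ) * (⟨a', b'⟩ * (starRingEnd ℂ) ⟨a, b⟩) := by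
    rw [azimNum, hdet', hvv, hvx, hvx, huw]
    apply Complex.ext <;> simp <;> ring
  rw [hnum, Complex.arg_real_mul _ (by positivity)]
  rcases eq_or_ne (⟨a, b⟩ : ℂ) 0 with h0 | h0
  · rw [h0]; simp
  · have hp : 0 < Complex.normSq ⟨a, b⟩ := Complex.normSq_pos.mpr h0
    rw [div_eq_mul_inv, Complex.inv_def, ← mul_assoc, mul_comm _ (((_ : ℝ) : ℂ)),
      Complex.arg_real_mul _ (by positivity)]

/-! ## The cyclic permutation at a point of a fan -/

lemma mem_coneOf_pair {v w p : Space} :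
    p ∈ coneOf {v, w} ↔ ∃ a b : ℝ, 0 ≤ a ∧ 0 ≤ b ∧ a • v + b • w = p := by
  unfold coneOf
  rw [SetLike.mem_coe, PointedCone.hull, Submodule.mem_span_pair]
  constructor
  · rintro ⟨a, b, h⟩
    exact ⟨a, b, a.2, b.2, h⟩
  · rintro ⟨a, b, ha, hb, h⟩
    exact ⟨⟨a, ha⟩, ⟨b, hb⟩, h⟩

lemma mem_coneOf_singleton {v p : Space} :
    p ∈ coneOf {v} ↔ ∃ a : ℝ, 0 ≤ a ∧ a • v = p := by
  unfold coneOf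
  rw [SetLike.mem_coe, PointedCone.hull, Submodule.mem_span_singleton]
  constructor
  · rintro ⟨a, h⟩
    exact ⟨a, a.2, h⟩
  · rintro ⟨a, ha, h⟩
    exact ⟨⟨a, ha⟩, h⟩

lemma mem_coneOf_empty {p : Space} : p ∈ coneOf ∅ ↔ p = 0 := by
  simp [coneOf, PointedCone.hull]

lemma azim_mem (v u w : Space) : azim v u w ∈ Set.Ico 0 (2 * Real.pi) := by
  simpa [azim, arg02pi] using toIcoMod_mem_Ico Real.two_pi_pos 0 (azimNum v u w).arg

lemma azim_coe (v u w : Space) :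
    (azim v u w : Real.Angle) = ((azimNum v u w).arg : Real.Angle) := by
  rw [Real.Angle.angle_eq_iff_two_pi_dvd_sub]
  refine ⟨-toIcoDiv Real.two_pi_pos 0 (azimNum v u w).arg, ?_⟩
  have := toIcoMod_add_toIcoDiv_zsmul Real.two_pi_pos 0 (azimNum v u w).arg
  simp only [zsmul_eq_mul] at this
  unfold azim arg02pi
  push_cast
  linarith

lemma azim_eq_of_coe {v u w : Space} {θ : ℝ} (h0 : 0 ≤ θ) (h1 : θ < 2 * Real.pi)
    (h : (θ : Real.Angle) = ((azimNum v u w).arg : Real.Angle)) : azim v u w = θ := by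
  unfold azim arg02pi
  rw [toIcoMod_eq_iff]
  refine ⟨⟨h0, by simpa using h1⟩, ?_⟩
  obtain ⟨k, hk⟩ := Real.Angle.angle_eq_iff_two_pi_dvd_sub.mp h.symm
  exact ⟨k, by simp only [zsmul_eq_mul]; linarith⟩

lemma IsFan.azimNum_self {V : Set Space} {E : Set (Set Space)} (h : IsFan V E) {v w : Space}
    (hw : w ∈ nbrs E v) : 0 < (azimNum v w w).re := by
  by_contra hc
  apply h.nonparallel v w hw
  simp only [azimNum, not_lt] at hc
  rw [collinear_iff_of_mem (p₀ := (0 : Space)) (by simp)]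
  by_cases hv : v = 0
  · refine ⟨w, ?_⟩
    subst hv
    intro p hp
    simp only [Set.mem_insert_iff, Set.mem_singleton_iff] at hp
    rcases hp with rfl | rfl | rfl
    · exact ⟨0, by simp⟩
    · exact ⟨0, by simp⟩
    · exact ⟨1, by simp⟩
  · have hvv : 0 < ⟪v, v⟫ := real_inner_self_pos.mpr hv
    have hz : ⟪v, v⟫ • w - ⟪v, w⟫ • v = 0 := by
      rw [← inner_self_eq_zero (𝕜 := ℝ)]
      refine le_antisymm ?_ real_inner_self_nonneg
      have : ⟪⟪v, v⟫ • w - ⟪v, w⟫ • v, ⟪v, v⟫ • w - ⟪v, w⟫ • v⟫ =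
          ⟪v, v⟫ * (⟪v, v⟫ * ⟪w, w⟫ - ⟪v, w⟫ * ⟪v, w⟫) := by
        simp only [inner_sub_left, inner_sub_right, inner_smul_left, inner_smul_right,
          real_inner_comm v w, conj_trivial]
        ring
      rw [this]
      exact mul_nonpos_of_nonneg_of_nonpos hvv.le hc
    refine ⟨v, ?_⟩
    intro p hp
    simp only [Set.mem_insert_iff, Set.mem_singleton_iff] at hp
    rcases hp with rfl | rfl | rfl
    · exact ⟨0, by simp⟩
    · exact ⟨1, by simp⟩
    · refine ⟨⟪v, v⟫⁻¹ * ⟪v, p⟫, ?_⟩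
      rw [sub_eq_zero] at hz
      rw [mul_smul, ← hz, smul_smul, inv_mul_cancel₀ hvv.ne', one_smul]
      simp

lemma IsFan.ne_smul {V : Set Space} {E : Set (Set Space)} (h : IsFan V E) {v w : Space}
    (hw : w ∈ nbrs E v) (a : ℝ) : a • v ≠ w := by
  rintro rfl
  have := h.azimNum_self hw
  simp only [azimNum, inner_smul_left, inner_smul_right] at this
  simp at this
  nlinarith

lemma decomp {v u w : Space} (h : det3 v w u = 0) :
    (azimNum v w w).re • u =
      (azimNum v w u).re • w + (⟪w, w⟫ * ⟪v, u⟫ - ⟪v, w⟫ * ⟪w, u⟫) • v := by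
  rw [det3_coord] at h
  ext i
  simp only [azimNum, inner_coord, PiLp.add_apply, PiLp.smul_apply, smul_eq_mul]
  fin_cases i
  · simp only [Fin.zero_eta]
    linear_combination (v 1 * w 2 - v 2 * w 1) * h
  · simp only [Fin.mk_one]
    linear_combination (v 2 * w 0 - v 0 * w 2) * h
  · simp only [Fin.reduceFinMk]
    linear_combination (v 0 * w 1 - v 1 * w 0) * h

lemma IsFan.azim_pos {V : Set Space} {E : Set (Set Space)} (h : IsFan V E) {v w u : Space}
    (hw : w ∈ nbrs E v) (hu : u ∈ nbrs E v) (hne : u ≠ w) : 0 < azim v w u := by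
  refine lt_of_le_of_ne (azim_mem v w u).1 ?_
  intro h0
  have hc := azim_coe v w u
  rw [← h0] at hc
  have harg : (azimNum v w u).arg = 0 := by
    rw [← Complex.arg_coe_angle_toReal_eq_arg, ← hc]
    simp
  rw [Complex.arg_eq_zero_iff] at harg
  obtain ⟨hre, him⟩ := harg
  have hG := h.azimNum_self hw
  have hn : 0 < ‖v‖ := by
    rw [norm_pos_iff]
    rintro rfl
    simp [azimNum] at hG
  have hdet : det3 v w u = 0 := by
    have : ‖v‖ * det3 v w u = 0 := him
    exact (mul_eq_zero.mp this).resolve_left hn.ne'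
  have hd := decomp hdet
  set G := (azimNum v w w).re
  set A := (azimNum v w u).re
  set B := ⟪w, w⟫ * ⟪v, u⟫ - ⟪v, w⟫ * ⟪w, u⟫
  have hu' : u = (A / G) • w + (B / G) • v := by
    rw [div_eq_inv_mul, div_eq_inv_mul, mul_smul, mul_smul, ← smul_add, ← hd, smul_smul,
      inv_mul_cancel₀ hG.ne', one_smul]
  set a := A / G
  set b := B / G
  have ha : 0 ≤ a := div_nonneg hre hG.le
  have hint := h.intersection {v, w} (Or.inl hw) {v, u} (Or.inl hu)
  have hset : ({v, w} ∩ {v, u} : Set Space) = {v} := by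
    ext x
    simp only [Set.mem_inter_iff, Set.mem_insert_iff, Set.mem_singleton_iff]
    constructor
    · rintro ⟨h1 | h1, h2 | h2⟩
      · exact h1
      · exact h1
      · exact h2
      · exact absurd (h2.symm.trans h1) hne
    · intro h1
      exact ⟨Or.inl h1, Or.inl h1⟩
  rw [hset] at hint
  rcases le_or_gt 0 b with hb | hb
  · have : u ∈ coneOf {v, w} ∩ coneOf {v, u} := by
      refine ⟨mem_coneOf_pair.mpr ⟨b, a, hb, ha, ?_⟩, mem_coneOf_pair.mpr ⟨0, 1, le_rfl, zero_le_one, ?_⟩⟩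
      · rw [add_comm]; exact hu'.symm
      · simp
    rw [hint, mem_coneOf_singleton] at this
    obtain ⟨t, -, ht⟩ := this
    exact h.ne_smul hu t ht
  · have ha0 : a ≠ 0 := by
      intro ha0
      rw [ha0, zero_smul, zero_add] at hu'
      exact h.ne_smul hu b hu'.symm
    have hapos : 0 < a := lt_of_le_of_ne ha ha0.symm
    have : w ∈ coneOf {v, w} ∩ coneOf {v, u} := by
      refine ⟨mem_coneOf_pair.mpr ⟨0, 1, le_rfl, zero_le_one, by simp⟩,
        mem_coneOf_pair.mpr ⟨-b / a, 1 / a, ?_, by positivity, ?_⟩⟩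
      · exact div_nonneg (by linarith) ha
      · have h2 : (-b / a) • v + (1 / a) • (a • w + b • v) = w := by
          rw [smul_add, smul_smul, smul_smul, div_mul_cancel₀ _ ha0, one_smul, add_comm, add_assoc,
            ← add_smul, show 1 / a * b + -b / a = 0 by ring, zero_smul, add_zero]
        rwa [← hu'] at h2
    rw [hint, mem_coneOf_singleton] at this
    obtain ⟨t, -, ht⟩ := this
    exact h.ne_smul hw t ht

lemma IsFan.azimNum_ne_zero {V : Set Space} {E : Set (Set Space)} (h : IsFan V E) {v w u : Space}
    (hw : w ∈ nbrs E v) (hu : u ∈ nbrs E v) : azimNum v w u ≠ 0 := by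
  intro h0
  have h1 := azimNum_mul v u w u
  have h2 := h.azimNum_self hw
  have h3 := h.azimNum_self hu
  rw [h0, mul_zero] at h1
  rcases mul_eq_zero.mp h1.symm with h4 | h4
  · rw [h4] at h2; simp at h2
  · rw [h4] at h3; simp at h3

lemma IsFan.azim_sub {V : Set Space} {E : Set (Set Space)} (h : IsFan V E) {v x w u : Space}
    (hx : x ∈ nbrs E v) (hw : w ∈ nbrs E v) (hu : u ∈ nbrs E v) (hle : azim v w u ≤ azim v x u) :
    azim v x w = azim v x u - azim v w u := by
  refine azim_eq_of_coe (by linarith) ?_ ?_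
  · have := (azim_mem v w u).1
    have := (azim_mem v x u).2
    linarith
  · rw [Real.Angle.coe_sub, azim_coe, azim_coe, sub_eq_iff_eq_add,
      ← Complex.arg_mul_coe_angle (h.azimNum_ne_zero hx hw) (h.azimNum_ne_zero hw hu),
      azimNum_mul]
    have hr : azimNum v w w = (((azimNum v w w).re : ℝ) : ℂ) := by
      apply Complex.ext
      · simp
      · simp only [azimNum, det3_coord, Complex.ofReal_im]
        ring
    rw [hr, Complex.arg_real_mul _ (h.azimNum_self hw)]

lemma IsFan.finite_nbrs {V : Set Space} {E : Set (Set Space)} (h : IsFan V E) (v : Space) :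
    (nbrs E v).Finite := by
  refine h.finite.subset ?_
  intro w hw
  obtain ⟨a, ha, b, hb, -, hab⟩ := h.edges _ hw
  have : w ∈ ({a, b} : Set Space) := by rw [← hab]; simp
  rcases this with rfl | h2
  · exact ha
  · rw [Set.mem_singleton_iff] at h2
    rwa [h2]

lemma exists_succ {E : Set (Set Space)} {v w : Space} (hf : (nbrs E v).Finite)
    (h : ∃ u ∈ nbrs E v, u ≠ w) :
    ∃ u ∈ nbrs E v, u ≠ w ∧ ∀ x ∈ nbrs E v, x ≠ w → azim v w u ≤ azim v w x := by
  obtain ⟨u₀, hu₀, hne⟩ := h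
  obtain ⟨u, hu, hmin⟩ := Set.exists_min_image (nbrs E v \ {w}) (azim v w) hf.sdiff ⟨u₀, hu₀, hne⟩
  exact ⟨u, hu.1, hu.2, fun x hx hxw => hmin x ⟨hx, hxw⟩⟩

open Classical in
/-- The point of `E(v)` that follows `w` in counterclockwise order about `v` (as seen from outside):
among the other points of `E(v)` it has the smallest azimuth angle from `w`. If `w` is the only
point of `E(v)`, it is `w` itself. -/
def succPt (E : Set (Set Space)) (v w : Space) : Space :=
  if h : ∃ u ∈ nbrs E v, u ≠ w ∧ ∀ x ∈ nbrs E v, x ≠ w → azim v w u ≤ azim v w x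
  then h.choose else w

lemma succPt_mem {E : Set (Set Space)} {v w : Space} (hw : w ∈ nbrs E v) :
    succPt E v w ∈ nbrs E v := by
  unfold succPt
  split_ifs with h
  · exact h.choose_spec.1
  · exact hw

lemma succPt_spec {E : Set (Set Space)} {v w : Space} (hf : (nbrs E v).Finite)
    (h : ∃ u ∈ nbrs E v, u ≠ w) :
    succPt E v w ≠ w ∧ ∀ x ∈ nbrs E v, x ≠ w → azim v w (succPt E v w) ≤ azim v w x := by
  have h' := exists_succ hf h
  unfold succPt
  rw [dif_pos h']
  exact h'.choose_spec.2

lemma IsFan.succPt_injOn {V : Set Space} {E : Set (Set Space)} (h : IsFan V E) (v : Space) :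
    Set.InjOn (succPt E v) (nbrs E v) := by
  have main : ∀ w ∈ nbrs E v, ∀ x ∈ nbrs E v, succPt E v w = succPt E v x →
      azim v w (succPt E v w) ≤ azim v x (succPt E v x) → w = x := by
    intro w hw x hx he hle
    by_contra hne
    have hs1 := succPt_spec (h.finite_nbrs v) ⟨x, hx, fun h => hne h.symm⟩
    have hs2 := succPt_spec (h.finite_nbrs v) ⟨w, hw, hne⟩
    have hmem := succPt_mem hw
    rw [← he] at hle hs2
    have h1 := h.azim_sub hx hw hmem hle
    have h2 := h.azim_pos hw hmem hs1.1
    have h3 := hs2.2 w hw hne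
    linarith
  intro w hw x hx he
  rcases le_total (azim v w (succPt E v w)) (azim v x (succPt E v x)) with hle | hle
  · exact main w hw x hx he hle
  · exact (main x hx w hw he.symm hle).symm

open Classical in
/-- The cyclic permutation `σ(v)` of `E(v)`, extended to all of space by the identity. -/
def sigma {V : Set Space} {E : Set (Set Space)} (h : IsFan V E) (v : Space) : Equiv.Perm Space :=
  haveI : Finite (nbrs E v) := h.finite_nbrs v
  Equiv.Perm.ofSubtype (Equiv.ofBijective
    (fun w : nbrs E v => (⟨succPt E v w, succPt_mem w.2⟩ : nbrs E v))
    (Finite.injective_iff_bijective.mp fun w x hwx =>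
      Subtype.ext (h.succPt_injOn v w.2 x.2 (congrArg Subtype.val hwx))))

open Classical in
lemma sigma_of_mem {V : Set Space} {E : Set (Set Space)} (h : IsFan V E) {v w : Space}
    (hw : w ∈ nbrs E v) : sigma h v w = succPt E v w := by
  unfold sigma
  rw [Equiv.Perm.ofSubtype_apply_of_mem _ hw]
  rfl

open Classical in
lemma sigma_of_notMem {V : Set Space} {E : Set (Set Space)} (h : IsFan V E) {v w : Space}
    (hw : w ∉ nbrs E v) : sigma h v w = w := by
  unfold sigma
  rw [Equiv.Perm.ofSubtype_apply_of_not_mem _ hw]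

lemma sigma_mem_iff {V : Set Space} {E : Set (Set Space)} (h : IsFan V E) {v w : Space} :
    sigma h v w ∈ nbrs E v ↔ w ∈ nbrs E v := by
  constructor
  · intro hw
    by_contra hc
    rw [sigma_of_notMem h hc] at hw
    exact hc hw
  · intro hw
    rw [sigma_of_mem h hw]
    exact succPt_mem hw

lemma sigma_symm_mem_iff {V : Set Space} {E : Set (Set Space)} (h : IsFan V E) {v w : Space} :
    (sigma h v).symm w ∈ nbrs E v ↔ w ∈ nbrs E v := by
  rw [← sigma_mem_iff h, Equiv.apply_symm_apply]

/-! ## Hypermaps -/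

/-- A hypermap: a finite set of darts with three permutations that compose to the identity. -/
structure Hypermap where
  Dart : Type
  finite_dart : Finite Dart
  e : Equiv.Perm Dart
  n : Equiv.Perm Dart
  f : Equiv.Perm Dart
  enf : ∀ x, e (n (f x)) = x

attribute [instance] Hypermap.finite_dart

namespace Hypermap

/-- An isomorphism of hypermaps. -/
structure Iso (H K : Hypermap) where
  toEquiv : H.Dart ≃ K.Dart
  map_e : ∀ x, toEquiv (H.e x) = K.e (toEquiv x)
  map_n : ∀ x, toEquiv (H.n x) = K.n (toEquiv x)
  map_f : ∀ x, toEquiv (H.f x) = K.f (toEquiv x)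

/-- The set of orbits of a permutation. -/
def orbits {D : Type} (p : Equiv.Perm D) : Set (Set D) :=
  Set.range fun x => {y | p.SameCycle x y}

variable (H : Hypermap)

/-- The edges of a hypermap. -/
def edges : Set (Set H.Dart) := orbits H.e

/-- The nodes of a hypermap. -/
def nodes : Set (Set H.Dart) := orbits H.n

/-- The faces of a hypermap. -/
def faces : Set (Set H.Dart) := orbits H.f

/-- There is exactly one combinatorial component: the darts form a single orbit of the group
generated by `e`, `n`, `f`. -/
def Connected : Prop :=
  Nonempty H.Dart ∧
    ∀ x y : H.Dart, ∃ g ∈ Subgroup.closure ({H.e, H.n, H.f} : Set (Equiv.Perm H.Dart)), g x = y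

/-- The graph on the nodes of a hypermap in which two nodes are adjacent when an edge meets both. -/
def nodeGraph : SimpleGraph H.nodes where
  Adj N N' := N ≠ N' ∧ ∃ ε ∈ H.edges, (ε ∩ N.1).Nonempty ∧ (ε ∩ N'.1).Nonempty
  symm := ⟨fun _ _ h => ⟨h.1.symm, h.2.imp fun _ hε => ⟨hε.1, hε.2.2, hε.2.1⟩⟩⟩
  loopless := ⟨fun _ h => h.1 rfl⟩

/-- Connected, without articulation nodes: deleting a node never disconnects the hypermap. -/
def Biconnected : Prop :=
  H.Connected ∧ ∀ N : H.nodes, (H.nodeGraph.induce {N}ᶜ).Preconnected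

/-- The number of faces of cardinality `k` at a node `N`. -/
def facesAt (N : Set H.Dart) (k : ℕ) : ℕ :=
  {F ∈ H.faces | (N ∩ F).Nonempty ∧ F.ncard = k}.ncard

/-- The node `N` has type `(p, q, r)`: there are `p + q + r` faces at `N`, of which `p` are triangles
and `q` are quadrilaterals. -/
def HasType (N : Set H.Dart) (p q r : ℕ) : Prop :=
  {F ∈ H.faces | (N ∩ F).Nonempty}.ncard = p + q + r ∧ H.facesAt N 3 = p ∧ H.facesAt N 4 = q

end Hypermap

/-- The constant `tgt`. -/
def tgt : ℝ := 1.541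

/-- The table of lower bounds for the weights at a node of type `(p, q, 0)`. -/
def bTable (p q : ℕ) : ℝ :=
  if (p, q) = (0, 3) ∨ (p, q) = (1, 3) then 0.618
  else if (p, q) = (2, 2) then 0.412
  else tgt

/-- The lower bound for the weight of a face of cardinality `k`. -/
def d1 (k : ℕ) : ℝ :=
  if k ≤ 3 then 0 else if k ≤ 8 then 0.206 + 0.27 * ((k : ℝ) - 4) else tgt

namespace Hypermap

variable (H : Hypermap)

/-- A contact weight assignment; only the values of `τ` on faces matter. -/
structure IsContactWeight (τ : Set H.Dart → ℝ) : Prop where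
  nonneg : ∀ F ∈ H.faces, 0 ≤ τ F
  face : ∀ F ∈ H.faces, d1 F.ncard ≤ τ F
  node : ∀ N ∈ H.nodes, ∀ p q : ℕ, H.HasType N p q 0 →
    bTable p q ≤ ∑ᶠ F ∈ {F ∈ H.faces | (N ∩ F).Nonempty}, τ F

/-- Hypermaps with tame contact. -/
structure HasTameContact : Prop where
  biconnected : H.Biconnected
  simple : ∀ F ∈ H.faces, ∀ N ∈ H.nodes, (F ∩ N).Subsingleton
  plain : ∀ x, H.e (H.e x) = x
  planar : H.nodes.ncard + H.edges.ncard + H.faces.ncard = Nat.card H.Dart + 2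
  nondegenerate : ∀ x, H.e x ≠ x
  no_loops : ∀ ε ∈ H.edges, ∀ x ∈ ε, ∀ y ∈ ε, x ≠ y → ∀ N ∈ H.nodes, ¬ (x ∈ N ∧ y ∈ N)
  no_double_join : ∀ N ∈ H.nodes, ∀ N' ∈ H.nodes, N ≠ N' → ∀ ε ∈ H.edges, ∀ ε' ∈ H.edges,
    (ε ∩ N).Nonempty → (ε ∩ N').Nonempty → (ε' ∩ N).Nonempty → (ε' ∩ N').Nonempty → ε = ε'
  face_count : 2 ≤ H.faces.ncard
  face_size : ∀ F ∈ H.faces, 3 ≤ F.ncard ∧ F.ncard ≤ 8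
  node_count : H.nodes.ncard = 12
  node_size : ∀ N ∈ H.nodes, 2 ≤ N.ncard ∧ N.ncard ≤ 4
  weights : ∃ τ : Set H.Dart → ℝ, H.IsContactWeight τ ∧ ∑ᶠ F ∈ H.faces, τ F < tgt

end Hypermap

/-! ## The hypermap of a fan -/

/-- The darts: ordered pairs of adjacent points, and pairs `(v, v)` for the isolated points `v`. -/
def IsDart (V : Set Space) (E : Set (Set Space)) (p : Space × Space) : Prop :=
  {p.1, p.2} ∈ E ∨ (p.1 ∈ V ∧ nbrs E p.1 = ∅ ∧ p.2 = p.1)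

lemma mem_nbrs_comm {E : Set (Set Space)} {v w : Space} : w ∈ nbrs E v ↔ v ∈ nbrs E w := by
  simp only [nbrs, Set.mem_ofPred_eq, Set.pair_comm]

lemma isDart_swap {V : Set Space} {E : Set (Set Space)} {v w : Space} (h : IsDart V E (v, w)) :
    IsDart V E (w, v) := by
  rcases h with h | ⟨h1, h2, h3⟩
  · left
    rw [Set.pair_comm]
    exact h
  · simp only at h1 h2 h3
    subst h3
    exact Or.inr ⟨h1, h2, rfl⟩

lemma isDart_sigma {V : Set Space} {E : Set (Set Space)} (hF : IsFan V E) {v w : Space}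
    (h : IsDart V E (v, w)) : IsDart V E (v, sigma hF v w) := by
  rcases h with h | ⟨h1, h2, h3⟩
  · exact Or.inl ((sigma_mem_iff hF).mpr h)
  · refine Or.inr ⟨h1, h2, ?_⟩
    simp only at h1 h2 h3 ⊢
    rw [sigma_of_notMem hF (by rw [h2]; simp), h3]

lemma isDart_sigma_symm {V : Set Space} {E : Set (Set Space)} (hF : IsFan V E) {v w : Space}
    (h : IsDart V E (v, w)) : IsDart V E (v, (sigma hF v).symm w) := by
  rcases h with h | ⟨h1, h2, h3⟩
  · exact Or.inl ((sigma_symm_mem_iff hF).mpr h)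
  · refine Or.inr ⟨h1, h2, ?_⟩
    simp only at h1 h2 h3 ⊢
    rw [Equiv.symm_apply_eq, h3, sigma_of_notMem hF (by rw [h2]; simp)]

lemma isDart_finite {V : Set Space} {E : Set (Set Space)} (hF : IsFan V E) :
    Finite {p // IsDart V E p} := by
  refine Set.Finite.to_subtype ((hF.finite.prod hF.finite).subset ?_)
  have key : ∀ v w : Space, {v, w} ∈ E → v ∈ V := by
    intro v w h
    obtain ⟨a, ha, b, hb, -, hab⟩ := hF.edges _ h
    have : v ∈ ({a, b} : Set Space) := by rw [← hab]; simp
    rcases this with rfl | h2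
    · exact ha
    · rw [Set.mem_singleton_iff] at h2
      rwa [h2]
  rintro ⟨v, w⟩ h
  rcases h with h | ⟨h1, h2, h3⟩
  · exact ⟨key v w h, key w v (by rw [Set.pair_comm]; exact h)⟩
  · simp only at h1 h2 h3
    subst h3
    exact ⟨h1, h1⟩

/-- The hypermap `hyp(V, E)` of a fan, with
`n (v, w) = (v, σ(v) w)`, `f (v, w) = (w, σ(w)⁻¹ v)` and `e (v, w) = (w, v)`.
All three fix the isolated darts `(v, v)`, since `σ(v)` is then the identity. -/
def hyp {V : Set Space} {E : Set (Set Space)} (hF : IsFan V E) : Hypermap where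
  Dart := {p // IsDart V E p}
  finite_dart := isDart_finite hF
  e :=
    { toFun := fun p => ⟨(p.1.2, p.1.1), isDart_swap p.2⟩
      invFun := fun p => ⟨(p.1.2, p.1.1), isDart_swap p.2⟩
      left_inv := fun _ => rfl
      right_inv := fun _ => rfl }
  n :=
    { toFun := fun p => ⟨(p.1.1, sigma hF p.1.1 p.1.2), isDart_sigma hF p.2⟩
      invFun := fun p => ⟨(p.1.1, (sigma hF p.1.1).symm p.1.2), isDart_sigma_symm hF p.2⟩
      left_inv := fun p => by simp
      right_inv := fun p => by simp }
  f :=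
    { toFun := fun p => ⟨(p.1.2, (sigma hF p.1.2).symm p.1.1), isDart_sigma_symm hF (isDart_swap p.2)⟩
      invFun := fun p => ⟨(sigma hF p.1.1 p.1.2, p.1.1), isDart_swap (isDart_sigma hF p.2)⟩
      left_inv := fun p => by simp
      right_inv := fun p => by simp }
  enf := fun p => by simp

/-! ## The contact fan -/

/-- For a finite nonempty packing on the sphere of radius `2`, the contact edges form a fan. -/
lemma isFan_contactEdges {V : Set Space} (hp : IsPacking V) (hfin : V.Finite) (hne : V.Nonempty)
    (hs : V ⊆ Metric.sphere (0 : Space) 2) : IsFan V (contactEdges V) := by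
  have hself : ∀ v ∈ V, ⟪v, v⟫ = 4 := by
    intro v hv
    have : ‖v‖ = 2 := by simpa using hs hv
    rw [real_inner_self_eq_norm_mul_norm, this]
    norm_num
  have hdist : ∀ v ∈ V, ∀ w ∈ V, dist v w * dist v w = 8 - 2 * ⟪v, w⟫ := by
    intro v hv w hw
    rw [dist_eq_norm, ← real_inner_self_eq_norm_mul_norm, inner_sub_left, inner_sub_right,
      inner_sub_right, hself v hv, hself w hw, real_inner_comm v w]
    ring
  have hle : ∀ v ∈ V, ∀ w ∈ V, v ≠ w → ⟪v, w⟫ ≤ 2 := by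
    intro v hv w hw hvw
    have h1 : 2 ≤ dist v w := by
      by_contra hc
      exact hvw (hp v hv w hw (by linarith))
    have := hdist v hv w hw
    nlinarith
  have hedge : ∀ v w : Space, {v, w} ∈ contactEdges V → v ∈ V ∧ w ∈ V ∧ v ≠ w ∧ ⟪v, w⟫ = 2 := by
    rintro v w ⟨a, ha, b, hb, hab, heq⟩
    have hne' : a ≠ b := by
      rintro rfl
      simp at hab
    have h2 : ⟪a, b⟫ = 2 := by
      have := hdist a ha b hb
      rw [hab] at this
      linarith
    rw [Set.pair_eq_pair_iff] at heq
    rcases heq with ⟨rfl, rfl⟩ | ⟨rfl, rfl⟩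
    · exact ⟨ha, hb, hne', h2⟩
    · exact ⟨hb, ha, hne'.symm, by rw [real_inner_comm]; exact h2⟩
  have hcross : ∀ u ∈ V, ∀ w ∈ V, ∀ x ∈ V, ∀ y ∈ V, 2 ≤ ⟪u, w⟫ → 2 ≤ ⟪x, y⟫ →
      u ≠ x → u ≠ y → w ≠ x → w ≠ y → ∀ a b c d : ℝ, 0 ≤ a → 0 ≤ b → 0 ≤ c → 0 ≤ d →
      a • u + b • w = c • x + d • y → a • u + b • w = 0 := by
    intro u hu w hw x hx y hy huw hxy hux huy hwx hwy a b c d ha hb hc hd heq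
    set p := a • u + b • w with hpdef
    have h1 : ⟪p, p⟫ = 4 * a ^ 2 + 4 * b ^ 2 + 2 * (a * b) * ⟪u, w⟫ := by
      simp only [hpdef, inner_add_left, inner_add_right, inner_smul_left, inner_smul_right,
        conj_trivial, hself u hu, hself w hw, real_inner_comm u w]
      ring
    have h2 : ⟪p, p⟫ = 4 * c ^ 2 + 4 * d ^ 2 + 2 * (c * d) * ⟪x, y⟫ := by
      rw [heq]
      simp only [inner_add_left, inner_add_right, inner_smul_left, inner_smul_right,
        conj_trivial, hself x hx, hself y hy, real_inner_comm x y]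
      ring
    have h3 : ⟪p, p⟫ = a * c * ⟪u, x⟫ + a * d * ⟪u, y⟫ + b * c * ⟪w, x⟫ + b * d * ⟪w, y⟫ := by
      nth_rewrite 2 [heq]
      simp only [hpdef, inner_add_left, inner_add_right, inner_smul_left, inner_smul_right,
        conj_trivial]
      ring
    have h4 := mul_le_mul_of_nonneg_left huw (mul_nonneg ha hb)
    have h5 := mul_le_mul_of_nonneg_left hxy (mul_nonneg hc hd)
    have h6 := mul_le_mul_of_nonneg_left (hle u hu x hx hux) (mul_nonneg ha hc)
    have h7 := mul_le_mul_of_nonneg_left (hle u hu y hy huy) (mul_nonneg ha hd)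
    have h8 := mul_le_mul_of_nonneg_left (hle w hw x hx hwx) (mul_nonneg hb hc)
    have h9 := mul_le_mul_of_nonneg_left (hle w hw y hy hwy) (mul_nonneg hb hd)
    have h10 : ⟪p, p⟫ ≤ 0 := by
      nlinarith [sq_nonneg (a - b), sq_nonneg (c - d), sq_nonneg (a + b - c - d)]
    exact inner_self_eq_zero.mp (le_antisymm h10 real_inner_self_nonneg)
  have hmono : ∀ S T : Set Space, S ⊆ T → coneOf S ⊆ coneOf T := fun S T hST =>
    Submodule.span_mono hST
  have hself' : ∀ S : Set Space, ∀ u ∈ S, ∀ a : ℝ, 0 ≤ a → a • u ∈ coneOf S := by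
    intro S u hu a ha
    exact hmono {u} S (by simpa using hu) (mem_coneOf_singleton.mpr ⟨a, ha, rfl⟩)
  have hzero : ∀ S : Set Space, (0 : Space) ∈ coneOf S := fun S => Submodule.zero_mem _
  have hshare : ∀ u ∈ V, ∀ w ∈ V, ∀ y ∈ V, 2 ≤ ⟪u, w⟫ → 2 ≤ ⟪u, y⟫ →
      coneOf {u, w} ∩ coneOf {u, y} ⊆ coneOf ({u, w} ∩ {u, y}) := by
    intro u hu w hw y hy huw huy p hpp
    obtain ⟨hp1, hp2⟩ := hpp
    have hu' : u ∈ ({u, w} ∩ {u, y} : Set Space) := ⟨by simp, by simp⟩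
    by_cases hwy : w = y
    · subst hwy
      rwa [Set.inter_self]
    obtain ⟨a, b, ha, hb, hab⟩ := mem_coneOf_pair.mp hp1
    obtain ⟨c, d, hc, hd, hcd⟩ := mem_coneOf_pair.mp hp2
    by_cases hwu : w = u
    · subst hwu
      rw [← hab, ← add_smul]
      exact hself' _ _ hu' _ (by linarith)
    by_cases hyu : y = u
    · subst hyu
      rw [← hcd, ← add_smul]
      exact hself' _ _ hu' _ (by linarith)
    have h4 : ∀ z ∈ V, 2 ≤ ⟪z, z⟫ := fun z hz => by rw [hself z hz]; norm_num
    have heq : a • u + b • w = c • u + d • y := by rw [hab, hcd]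
    rcases le_total c a with hca | hac
    · have h5 : (a - c) • u + b • w = d • y + (0 : ℝ) • y := by
        rw [sub_smul, zero_smul, add_zero]
        have : d • y = a • u + b • w - c • u := by rw [heq]; abel
        rw [this]; abel
      have h6 := hcross u hu w hw y hy y hy huw (h4 y hy) (Ne.symm hyu) (Ne.symm hyu) hwy hwy
        _ _ _ _ (by linarith) hb hd le_rfl h5
      rw [h6, zero_smul, add_zero] at h5
      rw [← hcd, ← h5, add_zero]
      exact hself' _ _ hu' _ hc
    · have h5 : (c - a) • u + d • y = b • w + (0 : ℝ) • w := by
        rw [sub_smul, zero_smul, add_zero]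
        have : b • w = c • u + d • y - a • u := by rw [← heq]; abel
        rw [this]; abel
      have h6 := hcross u hu y hy w hw w hw huy (h4 w hw) (Ne.symm hwu) (Ne.symm hwu)
        (Ne.symm hwy) (Ne.symm hwy) _ _ _ _ (by linarith) hd hb le_rfl h5
      rw [h6, zero_smul, add_zero] at h5
      rw [← hab, ← h5, add_zero]
      exact hself' _ _ hu' _ ha
  have hrep : ∀ ε ∈ contactEdges V ∪ {δ | ∃ v ∈ V, δ = {v}},
      ∃ u ∈ V, ∃ w ∈ V, ε = {u, w} ∧ 2 ≤ ⟪u, w⟫ := by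
    rintro ε (hε | ⟨v, hv, rfl⟩)
    · obtain ⟨v, hv, w, hw, -, rfl⟩ := id hε
      exact ⟨v, hv, w, hw, rfl, (hedge v w hε).2.2.2.ge⟩
    · exact ⟨v, hv, v, hv, by simp, by rw [hself v hv]; norm_num⟩
  refine ⟨?_, hfin, hne, ?_, ?_, ?_⟩
  · rintro ε hε
    obtain ⟨v, hv, w, hw, -, rfl⟩ := id hε
    exact ⟨v, hv, w, hw, (hedge v w hε).2.2.1, rfl⟩
  · intro h0
    have := hself 0 h0
    simp at this
  · intro v w hvw hcol
    obtain ⟨hv, hw, -, h2⟩ := hedge v w hvw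
    rw [collinear_iff_of_mem (p₀ := (0 : Space)) (by simp)] at hcol
    obtain ⟨d, hd⟩ := hcol
    obtain ⟨r, hr⟩ := hd v (by simp)
    obtain ⟨s, hs'⟩ := hd w (by simp)
    have h3 := hself v hv
    have h4 := hself w hw
    rw [hr, hs'] at h2
    rw [hr] at h3
    rw [hs'] at h4
    simp only [vadd_eq_add, add_zero, inner_smul_left, inner_smul_right, conj_trivial] at h2 h3 h4
    have h5 : (r * (r * ⟪d, d⟫)) * (s * (s * ⟪d, d⟫))
        = (r * (s * ⟪d, d⟫)) * (r * (s * ⟪d, d⟫)) := by ring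
    have h6 : r * (s * ⟪d, d⟫) = 2 := by linarith
    rw [h3, h4, h6] at h5
    norm_num at h5
  · intro ε hε ε' hε'
    refine Set.Subset.antisymm ?_ (Set.subset_inter (hmono _ _ Set.inter_subset_left)
      (hmono _ _ Set.inter_subset_right))
    obtain ⟨u, hu, w, hw, rfl, huw⟩ := hrep ε hε
    obtain ⟨x, hx, y, hy, rfl, hxy⟩ := hrep ε' hε'
    by_cases hux : u = x
    · subst hux
      exact hshare u hu w hw y hy huw hxy
    by_cases huy : u = y
    · subst huy
      rw [Set.pair_comm x u]
      exact hshare u hu w hw x hx huw (by rwa [real_inner_comm])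
    by_cases hwx : w = x
    · subst hwx
      rw [Set.pair_comm u w]
      exact hshare w hw u hu y hy (by rwa [real_inner_comm]) hxy
    by_cases hwy : w = y
    · subst hwy
      rw [Set.pair_comm u w, Set.pair_comm x w]
      exact hshare w hw u hu x hx (by rwa [real_inner_comm]) (by rwa [real_inner_comm])
    rintro p ⟨hp1, hp2⟩
    obtain ⟨a, b, ha, hb, hab⟩ := mem_coneOf_pair.mp hp1
    obtain ⟨c, d, hc, hd, hcd⟩ := mem_coneOf_pair.mp hp2
    have := hcross u hu w hw x hx y hy huw hxy hux huy hwx hwy a b c d ha hb hc hd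
      (by rw [hab, hcd])
    rw [← hab, this]
    exact hzero _

lemma IsConfig.isFan {V : Set Space} (hV : IsConfig V) : IsFan V (contactEdges V) :=
  isFan_contactEdges hV.packing (Set.finite_of_ncard_ne_zero (by rw [hV.card]; norm_num))
    (Set.nonempty_of_ncard_ne_zero (by rw [hV.card]; norm_num)) hV.sphere

/-- The contact hypermap `hyp(V, E₂(V))`. -/
def contactHypermap {V : Set Space} (hV : IsConfig V) : Hypermap := hyp hV.isFan

/-! ## The two kissing patterns -/

lemma isConfig_range (p : Fin 12 → Space) (h1 : ∀ i, ‖p i‖ ^ 2 = 4)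
    (h2 : ∀ i j, i = j ∨ dist (p i) (p j) ^ 2 = 4 ∨ 8 ≤ dist (p i) (p j) ^ 2) :
    IsConfig (Set.range p) := by
  have hc : ∀ i j, i = j ∨ dist (p i) (p j) = 2 ∨ 2 * h0 ≤ dist (p i) (p j) := by
    intro i j
    rcases h2 i j with h | h | h
    · exact Or.inl h
    · right; left
      have := dist_nonneg (x := p i) (y := p j)
      nlinarith
    · right; right
      have := dist_nonneg (x := p i) (y := p j)
      unfold h0
      nlinarith
  have hinj : Function.Injective p := by
    intro i j hij
    rcases hc i j with h | h | h
    · exact h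
    · rw [hij] at h; simp at h
    · rw [hij] at h; simp [h0] at h; norm_num at h
  refine ⟨?_, ?_, ?_, ?_⟩
  · rintro _ ⟨i, rfl⟩ _ ⟨j, rfl⟩ hd
    rcases hc i j with h | h | h
    · rw [h]
    · linarith
    · unfold h0 at h
      linarith
  · rw [← Set.image_univ, Set.ncard_image_of_injective _ hinj, Set.ncard_univ, Nat.card_eq_fintype_card,
      Fintype.card_fin]
  · rintro _ ⟨i, rfl⟩
    have := h1 i
    have h3 := norm_nonneg (p i)
    simp only [mem_sphere_iff_norm, sub_zero]
    nlinarith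
  · rintro _ ⟨i, rfl⟩ _ ⟨j, rfl⟩
    rcases hc i j with h | h
    · exact Or.inl (by rw [h])
    · exact Or.inr h

/-- The minimal vectors of the face-centered cubic lattice, in integer coordinates. -/
def fccTable : Fin 12 → Fin 3 → ℤ :=
  ![![1, 1, 0], ![1, -1, 0], ![-1, 1, 0], ![-1, -1, 0],
    ![1, 0, 1], ![1, 0, -1], ![-1, 0, 1], ![-1, 0, -1],
    ![0, 1, 1], ![0, 1, -1], ![0, -1, 1], ![0, -1, -1]]

/-- The twelve points of the FCC pattern: the vectors `√2 • x`, with `x` running over the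
permutations of `(±1, ±1, 0)`. -/
def fccPoint (i : Fin 12) : Space :=
  !₂[√2 * fccTable i 0, √2 * fccTable i 1, √2 * fccTable i 2]

/-- Integer coordinates `(a, b, c)` of the points `(a, b / √3, c * √(8/3))` of the HCP pattern: six
points of a hexagonal layer, three in the layer above it, and the mirror images of these three in
the layer below it. -/
def hcpTable : Fin 12 → Fin 3 → ℤ :=
  ![![2, 0, 0], ![-2, 0, 0], ![1, 3, 0], ![-1, 3, 0], ![1, -3, 0], ![-1, -3, 0],
    ![1, 1, 1], ![-1, 1, 1], ![0, -2, 1],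
    ![1, 1, -1], ![-1, 1, -1], ![0, -2, -1]]

/-- The twelve points of the HCP pattern. -/
def hcpPoint (i : Fin 12) : Space :=
  !₂[(hcpTable i 0 : ℝ), hcpTable i 1 / √3, hcpTable i 2 * √(8 / 3)]

/-- The FCC pattern, as a configuration on the sphere of radius `2`. -/
def fccPattern : Set Space := Set.range fccPoint

/-- The HCP pattern, as a configuration on the sphere of radius `2`. -/
def hcpPattern : Set Space := Set.range hcpPoint

lemma isConfig_fcc : IsConfig fccPattern := by
  have hs : √2 ^ 2 = (2 : ℝ) := Real.sq_sqrt (by norm_num)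
  apply isConfig_range
  · intro i
    have : ∀ i, (fccTable i 0) ^ 2 + (fccTable i 1) ^ 2 + (fccTable i 2) ^ 2 = 2 := by decide
    have h := congrArg (Int.cast : ℤ → ℝ) (this i)
    push_cast at h
    rw [EuclideanSpace.real_norm_sq_eq, Fin.sum_univ_three]
    simp only [fccPoint, PiLp.toLp_apply, Matrix.cons_val_zero, Matrix.cons_val_one,
      Matrix.cons_val]
    simp only [mul_pow, hs]
    linarith
  · intro i j
    have hd : dist (fccPoint i) (fccPoint j) ^ 2 = 2 * ((((fccTable i 0 - fccTable j 0) ^ 2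
        + (fccTable i 1 - fccTable j 1) ^ 2 + (fccTable i 2 - fccTable j 2) ^ 2 : ℤ)) : ℝ) := by
      rw [dist_eq_norm, EuclideanSpace.real_norm_sq_eq, Fin.sum_univ_three]
      simp only [fccPoint, PiLp.sub_apply, Matrix.cons_val_zero,
        Matrix.cons_val_one, Matrix.cons_val]
      push_cast
      simp only [← mul_sub, mul_pow, hs]
      ring
    have : ∀ i j, i = j ∨ (fccTable i 0 - fccTable j 0) ^ 2 + (fccTable i 1 - fccTable j 1) ^ 2
        + (fccTable i 2 - fccTable j 2) ^ 2 = 2 ∨ 4 ≤ (fccTable i 0 - fccTable j 0) ^ 2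
        + (fccTable i 1 - fccTable j 1) ^ 2 + (fccTable i 2 - fccTable j 2) ^ 2 := by decide
    rcases this i j with h | h | h
    · exact Or.inl h
    · right; left
      rw [hd, h]; norm_num
    · right; right
      rw [hd]
      have := (Int.cast_le (R := ℝ)).mpr h
      norm_num at this ⊢
      linarith

lemma isConfig_hcp : IsConfig hcpPattern := by
  have hs : √3 ^ 2 = (3 : ℝ) := Real.sq_sqrt (by norm_num)
  have hs' : √(8 / 3) ^ 2 = (8 / 3 : ℝ) := Real.sq_sqrt (by norm_num)
  apply isConfig_range
  · intro i
    have : ∀ i, 3 * (hcpTable i 0) ^ 2 + (hcpTable i 1) ^ 2 + 8 * (hcpTable i 2) ^ 2 = 12 := by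
      decide
    have h := congrArg (Int.cast : ℤ → ℝ) (this i)
    push_cast at h
    rw [EuclideanSpace.real_norm_sq_eq, Fin.sum_univ_three]
    simp only [hcpPoint, PiLp.toLp_apply, Matrix.cons_val_zero, Matrix.cons_val_one,
      Matrix.cons_val]
    simp only [mul_pow, div_pow, hs, hs']
    linarith
  · intro i j
    have hd : dist (hcpPoint i) (hcpPoint j) ^ 2 = (((3 * (hcpTable i 0 - hcpTable j 0) ^ 2
        + (hcpTable i 1 - hcpTable j 1) ^ 2 + 8 * (hcpTable i 2 - hcpTable j 2) ^ 2 : ℤ)) : ℝ)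
        / 3 := by
      rw [dist_eq_norm, EuclideanSpace.real_norm_sq_eq, Fin.sum_univ_three]
      simp only [hcpPoint, PiLp.sub_apply, Matrix.cons_val_zero,
        Matrix.cons_val_one, Matrix.cons_val]
      push_cast
      simp only [← sub_mul, ← sub_div, mul_pow, div_pow, hs, hs']
      ring
    have : ∀ i j, i = j ∨ 3 * (hcpTable i 0 - hcpTable j 0) ^ 2
        + (hcpTable i 1 - hcpTable j 1) ^ 2 + 8 * (hcpTable i 2 - hcpTable j 2) ^ 2 = 12 ∨
        24 ≤ 3 * (hcpTable i 0 - hcpTable j 0) ^ 2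
        + (hcpTable i 1 - hcpTable j 1) ^ 2 + 8 * (hcpTable i 2 - hcpTable j 2) ^ 2 := by decide
    rcases this i j with h | h | h
    · exact Or.inl h
    · right; left
      rw [hd, h]; norm_num
    · right; right
      rw [hd]
      have := (Int.cast_le (R := ℝ)).mpr h
      norm_num at this ⊢
      linarith

/-- The contact hypermap of the FCC pattern. -/
def fccHypermap : Hypermap := contactHypermap isConfig_fcc

/-- The contact hypermap of the HCP pattern. -/
def hcpHypermap : Hypermap := contactHypermap isConfig_hcp

end

end KissingTwelve

/-!
The hypermap is turned into a `ContactMap`: a combinatorial map whose darts know their initial point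
in space. Euler's relation, the weight bound and the bound of four contacts per point leave only
contact graphs with 24 or 23 edges, that is 48 or 46 darts (`IsTame.cases`).

*48 darts.* Every point has four contacts. A count around the points (`four_contacts_count`) shows
that large faces would need too many points at which three triangles accompany a large face. Two
consecutive vertices of a pentagon are not of this kind, nor are all vertices of a hexagon, since
three triangles around a point determine the fourth contact and the angle left over. So there are
eight triangles and six quadrilaterals, and every point has two of each. Starting from one point, the
map can then be explored step by step, and is the cuboctahedron or the triangular orthobicupola,
according to whether triangles and quadrilaterals alternate at all points (`iso_of_card_eq`). The
contact maps of the two patterns are computed from coordinates (`exists_equiv_of_points`).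

*46 darts.* There are six triangles and seven quadrilaterals, or seven triangles, five quadrilaterals
and one pentagon. Both cases are impossible for metric reasons. The angle at a corner is measured by
the inner product `dot` of the two contacts that bound it; angles around a point multiply to `1` as
unit complex numbers, and at adjacent corners of a quadrilateral, which is a spherical rhombus, the
quantities `4 + dot` have the product `16` (`quad_mul`). At a point with two triangles and two
quadrilaterals the product of these quantities is at most `16`, with equality only for squares. It
follows that two such points which are joined by an edge between two quadrilaterals force these to be
squares (`squares_of_QQ`), and that such a point is not joined to a point whose faces are just three
quadrilaterals by an edge between two quadrilaterals (`not_QQ_of_three_quads`). The latter excludes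
the case without a pentagon (`IsTame.not_six_seven`).

With a pentagon, the faces at each of its vertices bound its angle there, and the angle at a vertex is
related to the angles at the ends of the opposite edge by a singular Gram determinant (`chainDet`,
`pent_chain`). A finite search through the possible faces around the pentagon
(`Pentagon.classification`) leaves five patterns up to rotation and reflection. In each of them, the
points beyond the neighbours of the pentagon force a quadrilateral at the pentagon to be a square
(`IsPentagonal.square_or`), which contradicts the relation between the angles, or they have more
contacts and quadrilaterals than there are (`not_isPentagonal`).
-/

namespace KissingTwelve

open scoped RealInnerProductSpace

/-! ### Gram determinants of short contact chains -/

/-- Four vectors of three-space have a singular Gram matrix. -/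
lemma gram_det_eq_zero (v : Fin 4 → Space) :
    (Matrix.of fun i j => ⟪v i, v j⟫).det = 0 := by
  set M : Matrix (Fin 4) (Fin 4) ℝ := Matrix.of fun i => ![v i 0, v i 1, v i 2, 0] with hM
  have h : (Matrix.of fun i j => ⟪v i, v j⟫) = M * M.transpose := by
    ext i j
    simp [hM, Matrix.mul_apply, Fin.sum_univ_four, inner_coord]
  have h0 : M.det = 0 := by
    apply Matrix.det_eq_zero_of_column_eq_zero 3
    intro i
    simp [hM]
  rw [h, Matrix.det_mul, h0, zero_mul]

/-- The Gram determinant of a chain `a, b, c, d` of contacts on the sphere of radius `2`, up to a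
positive factor: `y = ⟪a, c⟫`, `z = ⟪b, d⟫` and `x = ⟪a, d⟫`. -/
noncomputable def chainDet (x y z : ℝ) : ℝ :=
  (9 - (y - 1) ^ 2) * (9 - (z - 1) ^ 2) - (3 * x - 2 * (y + z) + 2 + y * z / 2) ^ 2

lemma chainDet_eq_zero {a b c d : Space} (ha : ⟪a, a⟫ = 4) (hb : ⟪b, b⟫ = 4) (hc : ⟪c, c⟫ = 4)
    (hd : ⟪d, d⟫ = 4) (hab : ⟪a, b⟫ = 2) (hbc : ⟪b, c⟫ = 2) (hcd : ⟪c, d⟫ = 2) :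
    chainDet ⟪a, d⟫ ⟪a, c⟫ ⟪b, d⟫ = 0 := by
  have h := gram_det_eq_zero ![a, b, c, d]
  rw [Matrix.det_succ_row_zero, Fin.sum_univ_four] at h
  simp only [Matrix.det_fin_three, Matrix.submatrix_apply, Matrix.of_apply] at h
  have s00 : (0 : Fin 4).succAbove (0 : Fin 3) = 1 := rfl
  have s01 : (0 : Fin 4).succAbove (1 : Fin 3) = 2 := rfl
  have s02 : (0 : Fin 4).succAbove (2 : Fin 3) = 3 := rfl
  have s10 : (1 : Fin 4).succAbove (0 : Fin 3) = 0 := rfl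
  have s11 : (1 : Fin 4).succAbove (1 : Fin 3) = 2 := rfl
  have s12 : (1 : Fin 4).succAbove (2 : Fin 3) = 3 := rfl
  have s20 : (2 : Fin 4).succAbove (0 : Fin 3) = 0 := rfl
  have s21 : (2 : Fin 4).succAbove (1 : Fin 3) = 1 := rfl
  have s22 : (2 : Fin 4).succAbove (2 : Fin 3) = 3 := rfl
  have s30 : (3 : Fin 4).succAbove (0 : Fin 3) = 0 := rfl
  have s31 : (3 : Fin 4).succAbove (1 : Fin 3) = 1 := rfl
  have s32 : (3 : Fin 4).succAbove (2 : Fin 3) = 2 := rfl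
  have t0 : Fin.succ (0 : Fin 3) = 1 := rfl
  have t1 : Fin.succ (1 : Fin 3) = 2 := rfl
  have t2 : Fin.succ (2 : Fin 3) = 3 := rfl
  simp only [s00, s01, s02, s10, s11, s12, s20, s21, s22, s30, s31, s32, t0, t1, t2,
    Matrix.cons_val] at h
  rw [real_inner_comm a b, real_inner_comm a c, real_inner_comm a d, real_inner_comm b c,
    real_inner_comm b d, real_inner_comm c d, ha, hb, hc, hd, hab, hbc, hcd] at h
  norm_num at h
  unfold chainDet
  linear_combination (3/4) * h

lemma inner_lt_four {a b : Space} (ha : ⟪a, a⟫ = 4) (hb : ⟪b, b⟫ = 4) (h : a ≠ b) :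
    ⟪a, b⟫ < 4 := by
  have h1 : 0 < ⟪a - b, a - b⟫ := real_inner_self_pos.mpr (sub_ne_zero.mpr h)
  rw [inner_sub_left, inner_sub_right, inner_sub_right, real_inner_comm a b] at h1
  linarith

lemma neg_four_le_inner {a b : Space} (ha : ⟪a, a⟫ = 4) (hb : ⟪b, b⟫ = 4) :
    -4 ≤ ⟪a, b⟫ := by
  have h1 : 0 ≤ ⟪a + b, a + b⟫ := real_inner_self_nonneg
  rw [inner_add_left, inner_add_right, inner_add_right, real_inner_comm a b] at h1
  linarith

/-- The product relation between the two diagonals of a contact rhombus. -/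
lemma rhombus {a b c d : Space} (ha : ⟪a, a⟫ = 4) (hb : ⟪b, b⟫ = 4) (hc : ⟪c, c⟫ = 4)
    (hd : ⟪d, d⟫ = 4) (hab : ⟪a, b⟫ = 2) (hbc : ⟪b, c⟫ = 2) (hcd : ⟪c, d⟫ = 2)
    (had : ⟪a, d⟫ = 2) (hac : a ≠ c) (hbd : b ≠ d) : (4 + ⟪a, c⟫) * (4 + ⟪b, d⟫) = 16 := by
  have h := chainDet_eq_zero ha hb hc hd hab hbc hcd
  have h1 := inner_lt_four ha hc hac
  have h2 := inner_lt_four hb hd hbd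
  rw [had] at h
  unfold chainDet at h
  have h3 : (4 - ⟪a, c⟫) * (4 - ⟪b, d⟫) * (((4 + ⟪a, c⟫) * (4 + ⟪b, d⟫)) - 16) = 0 := by
    linear_combination (4/3) * h
  have h4 : (4 - ⟪a, c⟫) * (4 - ⟪b, d⟫) ≠ 0 := by
    apply mul_ne_zero <;> linarith
  have := (mul_eq_zero.mp h3).resolve_left h4
  linarith

/-- The two diagonals of a contact rhombus have parallel midpoints. -/
lemma rhombus_add {a b c d : Space} (ha : ⟪a, a⟫ = 4) (hb : ⟪b, b⟫ = 4) (hc : ⟪c, c⟫ = 4)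
    (hd : ⟪d, d⟫ = 4) (hab : ⟪a, b⟫ = 2) (hbc : ⟪b, c⟫ = 2) (hcd : ⟪c, d⟫ = 2)
    (had : ⟪a, d⟫ = 2) (hac : a ≠ c) (hbd : b ≠ d) :
    b + d = (4 / (4 + ⟪a, c⟫)) • (a + c) := by
  have h := rhombus ha hb hc hd hab hbc hcd had hac hbd
  have h0 : 4 + ⟪a, c⟫ ≠ 0 := by
    intro h0
    rw [h0, zero_mul] at h
    norm_num at h
  rw [← sub_eq_zero, ← inner_self_eq_zero (𝕜 := ℝ)]
  simp only [inner_sub_left, inner_sub_right, inner_add_left, inner_add_right, inner_smul_left,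
    inner_smul_right, conj_trivial, real_inner_comm a b, real_inner_comm a c, real_inner_comm a d,
    real_inner_comm b c, real_inner_comm b d, real_inner_comm c d, ha, hb, hc, hd, hab, hbc, hcd,
    had]
  have h5 : ⟪b, d⟫ = 16 / (4 + ⟪a, c⟫) - 4 := by
    field_simp
    linarith
  rw [h5]
  field_simp
  ring

/-- Two distinct points have at most two common contacts. -/
lemma common_contacts {u v x y z : Space} (hu : ⟪u, u⟫ = 4) (hv : ⟪v, v⟫ = 4) (hx : ⟪x, x⟫ = 4)
    (hy : ⟪y, y⟫ = 4) (hz : ⟪z, z⟫ = 4) (hux : ⟪u, x⟫ = 2) (huy : ⟪u, y⟫ = 2) (huz : ⟪u, z⟫ = 2)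
    (hvx : ⟪v, x⟫ = 2) (hvy : ⟪v, y⟫ = 2) (hvz : ⟪v, z⟫ = 2) (huv : u ≠ v) (hxy : x ≠ y)
    (hxz : x ≠ z) : y = z := by
  have h1 := rhombus_add hu hx hv hy hux (by rwa [real_inner_comm]) hvy huy huv hxy
  have h2 := rhombus_add hu hx hv hz hux (by rwa [real_inner_comm]) hvz huz huv hxz
  exact add_left_cancel (h1.trans h2.symm)

/-- The two points touching both ends of a contact are mirror images of one another. -/
lemma apex_eq {v b a c : Space} (hv : ⟪v, v⟫ = 4) (hb : ⟪b, b⟫ = 4) (ha : ⟪a, a⟫ = 4)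
    (hc : ⟪c, c⟫ = 4) (hvb : ⟪v, b⟫ = 2) (hva : ⟪v, a⟫ = 2) (hba : ⟪b, a⟫ = 2) (hvc : ⟪v, c⟫ = 2)
    (hbc : ⟪b, c⟫ = 2) (hac : a ≠ c) : c = (2 / 3 : ℝ) • (v + b) - a := by
  have hne : v ≠ b := by
    rintro rfl
    linarith
  have h := rhombus_add hv ha hb hc hva (by rwa [real_inner_comm]) hbc hvc hne hac
  rw [hvb] at h
  rw [eq_sub_iff_add_eq, add_comm, h]
  norm_num

/-! ### Inequalities for contact chains -/

lemma concave_pos {p q r s t x : ℝ} (hp : p ≤ 0) (hs : 0 < p * s ^ 2 + q * s + r)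
    (ht : 0 < p * t ^ 2 + q * t + r) (h1 : s ≤ x) (h2 : x ≤ t) : 0 < p * x ^ 2 + q * x + r := by
  rcases eq_or_lt_of_le h1 with rfl | h1'
  · exact hs
  have hst : 0 < t - s := by linarith
  have key : (t - s) * (p * x ^ 2 + q * x + r) = (t - x) * (p * s ^ 2 + q * s + r)
      + (x - s) * (p * t ^ 2 + q * t + r) + (-p) * ((x - s) * (t - x) * (t - s)) := by ring
  have h3 : 0 < (t - s) * (p * x ^ 2 + q * x + r) := by
    rw [key]
    have a1 : 0 ≤ (t - x) * (p * s ^ 2 + q * s + r) := mul_nonneg (by linarith) hs.le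
    have a2 : 0 < (x - s) * (p * t ^ 2 + q * t + r) := mul_pos (by linarith) ht
    have a3 : 0 ≤ (-p) * ((x - s) * (t - x) * (t - s)) :=
      mul_nonneg (by linarith) (mul_nonneg (mul_nonneg (by linarith) (by linarith)) hst.le)
    linarith
  exact (mul_pos_iff_of_pos_left hst).mp h3

lemma chainDet_pos_x {x₁ x₂ x y z : ℝ} (h1 : x₁ ≤ x) (h2 : x ≤ x₂) (h3 : 0 < chainDet x₁ y z)
    (h4 : 0 < chainDet x₂ y z) : 0 < chainDet x y z := by
  have e : ∀ x, chainDet x y z = (-9) * x ^ 2 + (6 * (2 * (y + z) - 2 - y * z / 2)) * x +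
      ((9 - (y - 1) ^ 2) * (9 - (z - 1) ^ 2) - (- 2 * (y + z) + 2 + y * z / 2) ^ 2) := by
    intro x
    unfold chainDet
    ring
  rw [e] at h3 h4 ⊢
  exact concave_pos (by norm_num) h3 h4 h1 h2

lemma chainDet_pos_y {y₁ y₂ x y z : ℝ} (hz : -4 ≤ z) (hz' : z ≤ 4) (h1 : y₁ ≤ y) (h2 : y ≤ y₂)
    (h3 : 0 < chainDet x y₁ z) (h4 : 0 < chainDet x y₂ z) : 0 < chainDet x y z := by
  have e : ∀ y, chainDet x y z = (-12 + 3 * z ^ 2 / 4) * y ^ 2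
      + (2 * (9 - (z - 1) ^ 2) + 2 * (2 - z / 2) * (3 * x - 2 * z + 2)) * y +
      (8 * (9 - (z - 1) ^ 2) - (3 * x - 2 * z + 2) ^ 2) := by
    intro y
    unfold chainDet
    ring
  rw [e] at h3 h4 ⊢
  exact concave_pos (by nlinarith) h3 h4 h1 h2

lemma chainDet_comm (x y z : ℝ) : chainDet x y z = chainDet x z y := by
  unfold chainDet
  ring

/-- The Gram determinant of a contact chain is concave in each variable, so that its positivity on
a box follows from its positivity at the corners. -/
lemma chainDet_pos {x₁ x₂ y₁ y₂ z₁ z₂ x y z : ℝ} (hy : -4 ≤ y₁) (hy' : y₂ ≤ 4)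
    (hz : -4 ≤ z₁) (hz' : z₂ ≤ 4)
    (hx1 : x₁ ≤ x) (hx2 : x ≤ x₂) (hy1 : y₁ ≤ y) (hy2 : y ≤ y₂) (hz1 : z₁ ≤ z) (hz2 : z ≤ z₂)
    (h : ∀ x ∈ [x₁, x₂], ∀ y ∈ [y₁, y₂], ∀ z ∈ [z₁, z₂], 0 < chainDet x y z) :
    0 < chainDet x y z := by
  have hz0 : ∀ x ∈ [x₁, x₂], ∀ y ∈ [y₁, y₂], 0 < chainDet x y z := by
    intro x hx y hy
    have h1 := h x hx y hy z₁ (by simp)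
    have h2 := h x hx y hy z₂ (by simp)
    rw [chainDet_comm] at h1 h2 ⊢
    refine chainDet_pos_y ?_ ?_ hz1 hz2 h1 h2
    · simp at hy
      rcases hy with rfl | rfl <;> linarith
    · simp at hy
      rcases hy with rfl | rfl <;> linarith
  have hy0 : ∀ x ∈ [x₁, x₂], 0 < chainDet x y z := fun x hx =>
    chainDet_pos_y (by linarith) (by linarith) hy1 hy2 (hz0 x hx y₁ (by simp))
      (hz0 x hx y₂ (by simp))
  exact chainDet_pos_x hx1 hx2 (hy0 x₁ (by simp)) (hy0 x₂ (by simp))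

/-- Lower bounds for the inner products at the ends of an edge of a pentagon give a lower bound for
the inner product `x` at the opposite vertex, here and in the next two lemmas. The upper bound
`0.8248` is the inner product at distance `2.52`. -/
lemma chain_opposite_lower {x y z : ℝ} (h : chainDet x y z = 0) (hx : -2 ≤ x) (hy : -14 / 9 ≤ y)
    (hy' : y ≤ 0.8248) (hz : -0.75 ≤ z) (hz' : z ≤ 0.8248) : -1.2 < x := by
  by_contra hc
  have := chainDet_pos (x₁ := -2) (x₂ := -1.2) (y₁ := -14 / 9) (y₂ := 0.8248) (z₁ := -0.75)
    (z₂ := 0.8248) (by norm_num) (by norm_num) (by norm_num) (by norm_num) hx (not_lt.mp hc) hy hy'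
    hz hz' (by simp only [List.forall_mem_cons, List.not_mem_nil, IsEmpty.forall_iff,
      implies_true, and_true]; unfold chainDet; norm_num)
  linarith

lemma chain_opposite_pos {x y z : ℝ} (h : chainDet x y z = 0) (hx : -2 ≤ x) (hy : -0.75 ≤ y)
    (hy' : y ≤ 0.8248) (hz : -0.75 ≤ z) (hz' : z ≤ 0.8248) : 0 < x := by
  by_contra hc
  have := chainDet_pos (x₁ := -2) (x₂ := 0) (y₁ := -0.75) (y₂ := 0.8248) (z₁ := -0.75)
    (z₂ := 0.8248) (by norm_num) (by norm_num) (by norm_num) (by norm_num) hx (not_lt.mp hc) hy hy'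
    hz hz' (by simp only [List.forall_mem_cons, List.not_mem_nil, IsEmpty.forall_iff,
      implies_true, and_true]; unfold chainDet; norm_num)
  linarith

lemma chain_opposite_gt {x y z : ℝ} (h : chainDet x y z = 0) (hx : -2 ≤ x) (hy : 0 ≤ y)
    (hy' : y ≤ 0.8248) (hz : 0 ≤ z) (hz' : z ≤ 0.8248) : 0.8248 < x := by
  by_contra hc
  have := chainDet_pos (x₁ := -2) (x₂ := 0.8248) (y₁ := 0) (y₂ := 0.8248) (z₁ := 0)
    (z₂ := 0.8248) (by norm_num) (by norm_num) (by norm_num) (by norm_num) hx (not_lt.mp hc) hy hy'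
    hz hz' (by simp only [List.forall_mem_cons, List.not_mem_nil, IsEmpty.forall_iff,
      implies_true, and_true]; unfold chainDet; norm_num)
  linarith

/-- Two neighbouring angles of a pentagon are not both wide: the square in `chainDet` exceeds the
product. -/
lemma chain_adjacent_false {x y z : ℝ} (h : chainDet x y z = 0) (hx : -2 ≤ x) (hy : -2 ≤ y)
    (hy' : y ≤ -1.88) (hz : -2 ≤ z) (hz' : z ≤ -4 / 3) : False := by
  unfold chainDet at h
  have h1 : 3 ≤ 3 * x - 2 * (y + z) + 2 + y * z / 2 := by nlinarith
  have h2 : 9 - (y - 1) ^ 2 ≤ 0.7056 := by nlinarith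
  have h2' : 0 ≤ 9 - (y - 1) ^ 2 := by nlinarith
  have h3 : 9 - (z - 1) ^ 2 ≤ 4 := by nlinarith
  have h3' : 0 ≤ 9 - (z - 1) ^ 2 := by nlinarith
  nlinarith [mul_le_mul h2 h3 h3' (by norm_num)]

/-- An almost straight angle `y` of a pentagon forces a negative inner product at the vertex
opposite to an edge that ends in `y`. -/
lemma chain_adjacent_neg {x y z : ℝ} (h : chainDet x y z = 0) (hy : -2 ≤ y)
    (hy' : y ≤ -1.88) (hz : -2 ≤ z) (hz' : z ≤ 0.8248) : x < 0 := by
  by_contra hc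
  unfold chainDet at h
  have h1 : 3.2 ≤ 3 * x - 2 * (y + z) + 2 + y * z / 2 := by nlinarith
  have h2 : 9 - (y - 1) ^ 2 ≤ 0.7056 := by nlinarith
  have h2' : 0 ≤ 9 - (y - 1) ^ 2 := by nlinarith
  have h3 : 9 - (z - 1) ^ 2 ≤ 9 := by nlinarith
  have h3' : 0 ≤ 9 - (z - 1) ^ 2 := by nlinarith
  nlinarith [mul_le_mul h2 h3 h3' (by norm_num)]

lemma chain_three_triangles_false {x : ℝ} (h : chainDet x (-14 / 9) (-14 / 9) = 0)
    (hx : -2 ≤ x) : False := by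
  unfold chainDet at h
  nlinarith

lemma chain_two_triangles_square {x : ℝ} (h : chainDet x (-4 / 3) 0 = 0) (hx : -2 ≤ x) :
    0 < x := by
  unfold chainDet at h
  nlinarith

/-! ### Complex numbers attached to corners -/

/-- Two angles, each at least `arccos (1 / 3)`, with a sum of at most `π`, add up to at least
`2 * arccos (1 / 3)`. -/
lemma re_add_angles_le {c₁ c₂ s₁ s₂ : ℝ} (h1 : c₁ ^ 2 + s₁ ^ 2 = 1) (h2 : c₂ ^ 2 + s₂ ^ 2 = 1)
    (hc1 : c₁ ≤ 1 / 3) (hc2 : c₂ ≤ 1 / 3) (hs1 : 0 ≤ s₁) (hs2 : 0 ≤ s₂)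
    (him : 0 ≤ c₁ * s₂ + s₁ * c₂) (hlt : c₁ * c₂ - s₁ * s₂ < 1) :
    c₁ * c₂ - s₁ * s₂ ≤ -7 / 9 := by
  by_contra hc
  push Not at hc
  -- `c₁ + c₂ ≥ 0`, since the angles add up to at most `π`
  have hsum : 0 ≤ c₁ + c₂ := by
    by_contra hneg
    push Not at hneg
    rcases le_or_gt 0 c₁ with h | h
    · have h5 : c₁ ^ 2 < c₂ ^ 2 := by nlinarith
      have h6 : s₂ < s₁ := by nlinarith
      have h7 : c₂ < 0 := by linarith
      nlinarith
    · rcases le_or_gt 0 c₂ with h' | h'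
      · have h5 : c₂ ^ 2 < c₁ ^ 2 := by nlinarith
        have h6 : s₁ < s₂ := by nlinarith
        nlinarith
      · have h8 : c₁ * s₂ ≤ 0 := mul_nonpos_of_nonpos_of_nonneg h.le hs2
        have h9 : s₁ * c₂ ≤ 0 := mul_nonpos_of_nonneg_of_nonpos hs1 h'.le
        have h10 : c₁ * s₂ = 0 := by linarith
        have h11 : s₁ * c₂ = 0 := by linarith
        have h12 : s₂ = 0 := (mul_eq_zero.mp h10).resolve_left h.ne
        have h13 : s₁ = 0 := (mul_eq_zero.mp h11).resolve_right h'.ne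
        have h14 : c₁ = -1 := by rw [h13] at h1; nlinarith
        have h15 : c₂ = -1 := by rw [h12] at h2; nlinarith
        rw [h12, h14, h15] at hlt
        norm_num at hlt
  have hprod : s₁ * s₂ < c₁ * c₂ + 7 / 9 := by linarith
  have hsq : (s₁ * s₂) ^ 2 = (1 - c₁ ^ 2) * (1 - c₂ ^ 2) := by
    rw [mul_pow]
    rw [show s₁ ^ 2 = 1 - c₁ ^ 2 by linarith, show s₂ ^ 2 = 1 - c₂ ^ 2 by linarith]
  have hlt' : (s₁ * s₂) ^ 2 < (c₁ * c₂ + 7 / 9) ^ 2 := by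
    have := mul_nonneg hs1 hs2
    nlinarith
  nlinarith

/-! ### Corners of the contact fan -/

lemma IsConfig.inner_self {V : Set Space} (hV : IsConfig V) {v : Space} (hv : v ∈ V) :
    ⟪v, v⟫ = 4 := by
  have : ‖v‖ = 2 := by simpa using hV.sphere hv
  rw [real_inner_self_eq_norm_mul_norm, this]
  norm_num

lemma IsConfig.dist_mul_dist {V : Set Space} (hV : IsConfig V) {v w : Space} (hv : v ∈ V)
    (hw : w ∈ V) : dist v w * dist v w = 8 - 2 * ⟪v, w⟫ := by
  rw [dist_eq_norm, ← real_inner_self_eq_norm_mul_norm, inner_sub_left, inner_sub_right,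
    inner_sub_right, hV.inner_self hv, hV.inner_self hw, real_inner_comm v w]
  ring

lemma IsConfig.mem_nbrs {V : Set Space} (hV : IsConfig V) {v w : Space} :
    w ∈ nbrs (contactEdges V) v ↔ v ∈ V ∧ w ∈ V ∧ ⟪v, w⟫ = 2 := by
  constructor
  · rintro ⟨a, ha, b, hb, hab, heq⟩
    have h2 := hV.dist_mul_dist ha hb
    rw [hab] at h2
    rw [Set.pair_eq_pair_iff] at heq
    rcases heq with ⟨rfl, rfl⟩ | ⟨rfl, rfl⟩
    · exact ⟨ha, hb, by linarith⟩
    · exact ⟨hb, ha, by rw [real_inner_comm]; linarith⟩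
  · rintro ⟨hv, hw, h⟩
    refine ⟨v, hv, w, hw, ?_, rfl⟩
    have h2 := hV.dist_mul_dist hv hw
    have h3 := dist_nonneg (x := v) (y := w)
    rw [h] at h2
    nlinarith

/-- Distinct points touch, with inner product `2`, or are separated by the gap, with inner product
at most `4 - 2.52 ^ 2 / 2 = 0.8248`. -/
lemma IsConfig.inner_cases {V : Set Space} (hV : IsConfig V) {v w : Space} (hv : v ∈ V)
    (hw : w ∈ V) (hne : v ≠ w) : ⟪v, w⟫ = 2 ∨ ⟪v, w⟫ ≤ 0.8248 := by
  have h2 := hV.dist_mul_dist hv hw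
  rcases hV.gap v hv w hw with h | h | h
  · exact absurd h hne
  · left
    rw [h] at h2
    linarith
  · right
    unfold h0 at h
    nlinarith

lemma IsConfig.inner_le_two {V : Set Space} (hV : IsConfig V) {v w : Space} (hv : v ∈ V)
    (hw : w ∈ V) (hne : v ≠ w) : ⟪v, w⟫ ≤ 2 := by
  rcases hV.inner_cases hv hw hne with h | h <;> linarith

/-- The unit complex number whose argument is the angle from `u` to `w` at `v`, for contacts `u`
and `w` of `v`. -/
noncomputable def corner (v u w : Space) : ℂ := ⟨(⟪u, w⟫ - 1) / 3, det3 v u w / 6⟩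

lemma azimNum_eq_corner {v u w : Space} (hv : ⟪v, v⟫ = 4) (hu : ⟪v, u⟫ = 2) (hw : ⟪v, w⟫ = 2) :
    azimNum v u w = (12 : ℝ) * corner v u w := by
  have hn : ‖v‖ = 2 := by
    rw [real_inner_self_eq_norm_sq] at hv
    nlinarith [norm_nonneg v]
  apply Complex.ext
  · simp only [azimNum, corner, Complex.re_ofReal_mul, hv, hu, hw]
    ring
  · simp only [azimNum, corner, Complex.im_ofReal_mul, hn]
    ring

lemma corner_self {v u : Space} (hu : ⟪u, u⟫ = 4) : corner v u u = 1 := by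
  apply Complex.ext
  · simp only [corner, hu, Complex.one_re]
    norm_num
  · simp only [corner, det3_coord, Complex.one_im]
    ring

/-- Consecutive angles at a point add up. -/
lemma corner_mul {v u w x : Space} (hv : ⟪v, v⟫ = 4) (hw' : ⟪w, w⟫ = 4) (hu : ⟪v, u⟫ = 2)
    (hw : ⟪v, w⟫ = 2) (hx : ⟪v, x⟫ = 2) : corner v u w * corner v w x = corner v u x := by
  have h := azimNum_mul v u w x
  rw [azimNum_eq_corner hv hu hw, azimNum_eq_corner hv hw hx, azimNum_eq_corner hv hw hw,
    azimNum_eq_corner hv hu hx, corner_self hw'] at h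
  have h12 : ((12 : ℝ) : ℂ) ≠ 0 := by norm_num
  apply mul_left_cancel₀ (mul_ne_zero h12 h12)
  linear_combination h

lemma IsConfig.azimNum_eq {V : Set Space} (hV : IsConfig V) {v u w : Space}
    (hu : u ∈ nbrs (contactEdges V) v) (hw : w ∈ nbrs (contactEdges V) v) :
    azimNum v u w = (12 : ℝ) * corner v u w := by
  rw [hV.mem_nbrs] at hu hw
  exact azimNum_eq_corner (hV.inner_self hu.1) hu.2.2 hw.2.2

lemma det3_swap (v u w : Space) : det3 v w u = -det3 v u w := by
  simp only [det3_coord]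
  ring

lemma det3_rotate (v u w : Space) : det3 u w v = det3 v u w := by
  simp only [det3_coord]
  ring

lemma IsConfig.corner_mul {V : Set Space} (hV : IsConfig V) {v u w x : Space}
    (hu : u ∈ nbrs (contactEdges V) v) (hw : w ∈ nbrs (contactEdges V) v)
    (hx : x ∈ nbrs (contactEdges V) v) :
    corner v u w * corner v w x = corner v u x := by
  rw [hV.mem_nbrs] at hu hw hx
  exact KissingTwelve.corner_mul (hV.inner_self hu.1) (hV.inner_self hw.2.1) hu.2.2 hw.2.2 hx.2.2

lemma corner_swap_re (v u w : Space) : (corner v w u).re = (corner v u w).re := by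
  simp [corner, real_inner_comm]

lemma corner_swap_im (v u w : Space) : (corner v w u).im = -(corner v u w).im := by
  simp only [corner, det3_swap v u w]
  ring

lemma normSq_corner {v u w : Space} (hv : ⟪v, v⟫ = 4) (hu' : ⟪u, u⟫ = 4) (hw' : ⟪w, w⟫ = 4)
    (hu : ⟪v, u⟫ = 2) (hw : ⟪v, w⟫ = 2) :
    (corner v u w).re ^ 2 + (corner v u w).im ^ 2 = 1 := by
  have h := corner_mul hv hw' hu hw hu
  rw [corner_self hu'] at h
  have h3 := congrArg Complex.re h
  rw [Complex.mul_re, corner_swap_re v u w, corner_swap_im v u w, Complex.one_re] at h3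
  linarith

lemma IsConfig.normSq_corner {V : Set Space} (hV : IsConfig V) {v u w : Space}
    (hu : u ∈ nbrs (contactEdges V) v) (hw : w ∈ nbrs (contactEdges V) v) :
    (corner v u w).re ^ 2 + (corner v u w).im ^ 2 = 1 := by
  rw [hV.mem_nbrs] at hu hw
  exact KissingTwelve.normSq_corner (hV.inner_self hu.1) (hV.inner_self hu.2.1)
    (hV.inner_self hw.2.1) hu.2.2 hw.2.2

lemma IsConfig.sin_azim {V : Set Space} (hV : IsConfig V) {v u w : Space}
    (hu : u ∈ nbrs (contactEdges V) v) (hw : w ∈ nbrs (contactEdges V) v) :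
    Real.sin (azim v u w) = det3 v u w / 6 := by
  have h := azim_coe v u w
  rw [← Real.Angle.sin_coe, h, hV.azimNum_eq hu hw, Complex.arg_real_mul _ (by norm_num),
    Real.Angle.sin_coe, Complex.sin_arg]
  have h1 : ‖corner v u w‖ = 1 := by
    have h2 := hV.normSq_corner hu hw
    rw [Complex.norm_eq_sqrt_sq_add_sq, h2, Real.sqrt_one]
  rw [h1, div_one]
  rfl

lemma IsConfig.azim_lt_pi {V : Set Space} (hV : IsConfig V) {v u w : Space}
    (hu : u ∈ nbrs (contactEdges V) v) (hw : w ∈ nbrs (contactEdges V) v)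
    (h : 0 < det3 v u w) : azim v u w < Real.pi := by
  by_contra hc
  have h1 := hV.sin_azim hu hw
  have h2 := (azim_mem v u w).2
  have h3 : Real.sin (azim v u w) ≤ 0 := by
    rw [← Real.sin_sub_two_pi]
    exact Real.sin_nonpos_of_nonpos_of_neg_pi_le (by linarith) (by linarith)
  linarith

lemma IsConfig.det3_pos {V : Set Space} (hV : IsConfig V) {v u w : Space}
    (hu : u ∈ nbrs (contactEdges V) v) (hw : w ∈ nbrs (contactEdges V) v)
    (h0 : 0 < azim v u w) (h : azim v u w < Real.pi) : 0 < det3 v u w := by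
  have h1 := hV.sin_azim hu hw
  have h2 := Real.sin_pos_of_pos_of_lt_pi h0 h
  linarith

lemma IsConfig.det3_nonneg {V : Set Space} (hV : IsConfig V) {v u w : Space}
    (hu : u ∈ nbrs (contactEdges V) v) (hw : w ∈ nbrs (contactEdges V) v)
    (h : azim v u w ≤ Real.pi) : 0 ≤ det3 v u w := by
  have h1 := hV.sin_azim hu hw
  have h2 := Real.sin_nonneg_of_nonneg_of_le_pi (azim_mem v u w).1 h
  linarith

/-- Azimuth angles from a common starting point subtract. -/
lemma IsConfig.azim_sub_left {V : Set Space} (hV : IsConfig V) {v w s u : Space}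
    (hw : w ∈ nbrs (contactEdges V) v) (hs : s ∈ nbrs (contactEdges V) v)
    (hu : u ∈ nbrs (contactEdges V) v) (hle : azim v w s ≤ azim v w u) :
    azim v s u = azim v w u - azim v w s := by
  have hF := hV.isFan
  refine azim_eq_of_coe (by linarith) ?_ ?_
  · have := (azim_mem v w s).1
    have := (azim_mem v w u).2
    linarith
  · have h1 := hV.corner_mul hw hs hu
    have h12 : (0 : ℝ) < 12 := by norm_num
    have n1 := hF.azimNum_ne_zero hw hs
    have n2 := hF.azimNum_ne_zero hs hu
    rw [hV.azimNum_eq hw hs] at n1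
    rw [hV.azimNum_eq hs hu] at n2
    rw [Real.Angle.coe_sub, azim_coe, azim_coe, sub_eq_iff_eq_add, hV.azimNum_eq hw hs,
      hV.azimNum_eq hs hu, hV.azimNum_eq hw hu, Complex.arg_real_mul _ h12,
      Complex.arg_real_mul _ h12, Complex.arg_real_mul _ h12, ← h1,
      Complex.arg_mul_coe_angle (right_ne_zero_of_mul n1) (right_ne_zero_of_mul n2), add_comm]

/-- The successor of `w` is recognized by the signs of determinants. -/
lemma IsConfig.succPt_eq {V : Set Space} (hV : IsConfig V) {v w u : Space}
    (hw : w ∈ nbrs (contactEdges V) v) (hu : u ∈ nbrs (contactEdges V) v)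
    (hdet : 0 < det3 v w u)
    (h : ∀ x ∈ nbrs (contactEdges V) v, x ≠ w → x ≠ u → det3 v w x ≤ 0 ∨ det3 v x u ≤ 0) :
    succPt (contactEdges V) v w = u := by
  have hF := hV.isFan
  have hne : u ≠ w := by
    rintro rfl
    simp only [det3_coord] at hdet
    ring_nf at hdet
    exact lt_irrefl _ hdet
  obtain ⟨h1, h2⟩ := succPt_spec (hF.finite_nbrs v) ⟨u, hu, hne⟩
  have hs := succPt_mem hw
  set s := succPt (contactEdges V) v w
  by_contra hsu
  have h3 := h2 u hu hne
  have h4 := hV.azim_sub_left hw hs hu h3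
  have h5 := hV.azim_lt_pi hw hu hdet
  have h6 := hF.azim_pos hw hs h1
  have h7 := hF.azim_pos hs hu (fun h => hsu h.symm)
  rcases h s hs h1 hsu with h8 | h8
  · have := hV.det3_pos hw hs h6 (by linarith)
    linarith
  · have := hV.det3_pos hs hu h7 (by linarith)
    linarith

/-- Two contacts `x`, `y` of `v` in counterclockwise position leave no room for a point between
them unless the angle is at least `2 arccos (1 / 3)`. -/
lemma IsConfig.inner_le_of_between {V : Set Space} (hV : IsConfig V) {v w x u : Space}
    (hw : w ∈ nbrs (contactEdges V) v) (hx : x ∈ nbrs (contactEdges V) v)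
    (hu : u ∈ nbrs (contactEdges V) v) (hwx : w ≠ x) (hxu : x ≠ u) (hwu : w ≠ u)
    (h1 : 0 ≤ det3 v w x) (h2 : 0 ≤ det3 v x u) (h3 : 0 ≤ det3 v w u) : ⟪w, u⟫ ≤ -4 / 3 := by
  have hm := hV.corner_mul hw hx hu
  have hre := congrArg Complex.re hm
  have him := congrArg Complex.im hm
  rw [Complex.mul_re] at hre
  rw [Complex.mul_im] at him
  have hw' := hV.mem_nbrs.mp hw
  have hx' := hV.mem_nbrs.mp hx
  have hu' := hV.mem_nbrs.mp hu
  have a1 := hV.inner_le_two hw'.2.1 hx'.2.1 hwx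
  have a2 := hV.inner_le_two hx'.2.1 hu'.2.1 hxu
  have a3 := hV.inner_le_two hw'.2.1 hu'.2.1 hwu
  have key := re_add_angles_le (hV.normSq_corner hw hx) (hV.normSq_corner hx hu)
    (by simp only [corner]; linarith) (by simp only [corner]; linarith)
    (by simp only [corner]; linarith) (by simp only [corner]; linarith)
    (by rw [him]; simp only [corner]; linarith) (by rw [hre]; simp only [corner]; linarith)
  rw [hre] at key
  simp only [corner] at key
  linarith

/-- Two contacts of `v` that touch one another are consecutive. -/
lemma IsConfig.succPt_of_contact {V : Set Space} (hV : IsConfig V) {v w u : Space}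
    (hw : w ∈ nbrs (contactEdges V) v) (hu : u ∈ nbrs (contactEdges V) v)
    (hwu : ⟪w, u⟫ = 2) (hdet : 0 < det3 v w u) : succPt (contactEdges V) v w = u := by
  apply hV.succPt_eq hw hu hdet
  intro x hx hxw hxu
  by_contra! hc
  have hne : w ≠ u := by
    rintro rfl
    rw [hV.inner_self (hV.mem_nbrs.mp hw).2.1] at hwu
    norm_num at hwu
  have := hV.inner_le_of_between hw hx hu hxw.symm hxu hne hc.1.le hc.2.le hdet.le
  linarith

/-- At a point with at least three contacts, a corner with a wide angle is at most
`2 π - 2 arccos (1 / 3)`, so that corners with smaller cosine are convex. -/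
lemma IsConfig.det3_succPt_pos {V : Set Space} (hV : IsConfig V) {v w x : Space}
    (hw : w ∈ nbrs (contactEdges V) v) (hx : x ∈ nbrs (contactEdges V) v)
    (hxw : x ≠ w) (hxu : x ≠ succPt (contactEdges V) v w)
    (hin : -4 / 3 < ⟪w, succPt (contactEdges V) v w⟫) :
    0 < det3 v w (succPt (contactEdges V) v w) := by
  have hF := hV.isFan
  have hu := succPt_mem hw
  obtain ⟨h1, h2⟩ := succPt_spec (hF.finite_nbrs v) ⟨x, hx, hxw⟩
  set u := succPt (contactEdges V) v w
  by_contra hc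
  have h3 := h2 x hx hxw
  have h4 := hV.azim_sub_left hw hu hx h3
  have hpi : Real.pi ≤ azim v w u := by
    by_contra hlt
    exact hc (hV.det3_pos hw hu (hF.azim_pos hw hu h1) (not_le.mp hlt))
  have hlt := (azim_mem v w x).2
  have d1 : 0 ≤ det3 v u x := hV.det3_nonneg hu hx (by linarith)
  have d2 : 0 ≤ det3 v x w := by
    rw [det3_swap]
    by_contra hneg
    have := hV.azim_lt_pi hw hx (by linarith)
    linarith
  have d3 : 0 ≤ det3 v u w := by
    rw [det3_swap]
    linarith
  have := hV.inner_le_of_between hu hx hw (Ne.symm hxu) hxw h1 d1 d2 d3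
  rw [real_inner_comm] at this
  linarith

lemma IsConfig.det3_ne_zero {V : Set Space} (hV : IsConfig V) {v w u : Space}
    (hw : w ∈ nbrs (contactEdges V) v) (hu : u ∈ nbrs (contactEdges V) v)
    (hwu : ⟪w, u⟫ = 2) : det3 v w u ≠ 0 := by
  intro h
  have := hV.normSq_corner hw hu
  simp only [corner, h, hwu] at this
  norm_num at this

/-! ### Cyclic sequences of faces around a pentagon -/

namespace Pentagon

/-- The possible sequences of the faces, other than the pentagon, around a vertex of the pentagon:
`true` is a triangle, `false` is a quadrilateral. Three quadrilaterals do not leave enough room for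
the pentagon.

The lists below record what a sequence says about the angle of the pentagon at that vertex, in terms
of the inner product of the two neighbours of the vertex on the pentagon. -/
def strings : List (List Bool) :=
  [[true], [false],
   [true, true], [true, false], [false, true], [false, false],
   [true, true, true], [true, true, false], [true, false, true], [false, true, true],
   [true, false, false], [false, true, false], [false, false, true]]

/-- The angle is nearly straight: the inner product is at most `-1.88`. -/
def wide : List (List Bool) := [[true, false], [false, true]]

/-- The inner product is at most `-4 / 3`. -/
def low : List (List Bool) := [[true, false], [false, true], [true, true], [true, true, true]]

/-- The inner product is at least `-14 / 9`. -/
def notWide : List (List Bool) := [[false], [true, true], [true, true, true],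
  [true, true, false], [true, false, true], [false, true, true],
  [true, false, false], [false, true, false], [false, false, true]]

/-- The inner product is at least `-0.75`. -/
def medium : List (List Bool) := [[false],
  [true, true, false], [true, false, true], [false, true, true],
  [true, false, false], [false, true, false], [false, false, true]]

/-- The inner product is nonnegative. -/
def nonneg : List (List Bool) := [[true, false, false], [false, true, false], [false, false, true]]

/-- The inner product is negative. -/
def negative : List (List Bool) :=
  [[true, false], [false, true], [false, false], [true, true], [true, true, true]]

/-- The conditions on consecutive vertices: the face across the common edge is the same; if this is a
triangle, its apex does not have three consecutive triangles; and a vertex with a single triangle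
leaves only one possibility for its neighbours. -/
def adjacent (s t : List Bool) : Bool :=
  s.getLast? == t.head? &&
  !(s.getLast? == some true && s.reverse[1]? == some true && t[1]? == some true) &&
  (!(s == [true]) || t == [true, false, false]) &&
  (!(t == [true]) || s == [false, false, true])

/-- The conditions on a vertex with sequence `s` and the ends of the opposite edge, with sequences `t`
and `u`, as provided by the relation between the three angles. -/
def opposite (s t u : List Bool) : Bool :=
  !(wide.contains t && low.contains u) && !(low.contains t && wide.contains u) &&
  !(low.contains s && (notWide.contains t && medium.contains u ||
    medium.contains t && notWide.contains u)) &&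
  !((nonneg.contains s || s == [true]) && (wide.contains t && !(u == [true]) ||
    wide.contains u && !(t == [true]))) &&
  !(negative.contains s && medium.contains t && medium.contains u)

/-- The inner product at a vertex is nonnegative, by its own sequence or by the opposite ones. -/
def isNonneg (s t u : List Bool) : Bool :=
  nonneg.contains s || medium.contains t && medium.contains u

/-- The inner products at the ends of the edge opposite to the vertex of `s₀` are not both
nonnegative, since they would bring the neighbours of that vertex too close together. Vertices with a
single triangle, whose neighbours touch, are exempt. -/
def fits (s₀ s₁ s₂ s₃ s₄ : List Bool) : Bool :=
  s₀ == [true] || s₂ == [true] || s₃ == [true] ||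
    !(isNonneg s₂ s₄ s₀ && isNonneg s₃ s₀ s₁)

/-- The cycles of sequences that satisfy all these conditions, up to rotation and reflection. -/
def survivors : List (List (List Bool)) :=
  [[[false, true], [true, true, false], [false, true, true], [true, false], [false, true, false]],
   [[false, true, true], [true, false], [false, true, true], [true, false, true], [true, false]],
   [[false, false, true], [true, false], [false, true, true], [true, false, true], [true, false]],
   [[false, true], [true, false, true], [true, false, true], [true, false], [false, true, false]],
   [[false, false], [false, false, true], [true, true], [true, false, true], [true, true, false]]]

/-- The conditions that involve the whole cycle of sequences. The number of the faces is bounded below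
since the seven other points have at most four contacts each, and the combined number of faces and
quadrilaterals is bounded above since these points have contacts and quadrilaterals of their own. -/
def consistent (s₀ s₁ s₂ s₃ s₄ : List Bool) : Bool :=
  decide (13 ≤ s₀.length + s₁.length + s₂.length + s₃.length + s₄.length) &&
  decide (s₀.length + s₁.length + s₂.length + s₃.length + s₄.length +
    (s₀.count false + s₁.count false + s₂.count false + s₃.count false + s₄.count false) ≤ 19) &&
  opposite s₁ s₃ s₄ && opposite s₂ s₄ s₀ && opposite s₃ s₀ s₁ && opposite s₄ s₁ s₂ &&
  fits s₀ s₁ s₂ s₃ s₄ && fits s₁ s₂ s₃ s₄ s₀ && fits s₂ s₃ s₄ s₀ s₁ && fits s₃ s₄ s₀ s₁ s₂ &&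
  fits s₄ s₀ s₁ s₂ s₃

/-- Up to rotation and reflection, the cycle of sequences is one of the survivors. -/
def isSurvivor (t : List (List Bool)) : Bool :=
  (List.range 5).any fun i => survivors.contains (t.rotate i) ||
    survivors.contains ((t.reverse.map List.reverse).rotate i)

/-- A search through all cycles of five sequences, by evaluation in the kernel. The conditions are
interleaved with the quantifiers, so that most branches are cut early. -/
theorem classification : ∀ s₀ ∈ strings, ∀ s₁ ∈ strings, adjacent s₀ s₁ → ∀ s₂ ∈ strings,
    adjacent s₁ s₂ → ∀ s₃ ∈ strings, adjacent s₂ s₃ → opposite s₀ s₂ s₃ → ∀ s₄ ∈ strings,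
    adjacent s₃ s₄ → adjacent s₄ s₀ → consistent s₀ s₁ s₂ s₃ s₄ →
    isSurvivor [s₀, s₁, s₂, s₃, s₄] := by
  decide +kernel

end Pentagon

open scoped Classical

/-! ### Orbits of a permutation -/

section Orbits

variable {D : Type} [Fintype D]

lemma minimalPeriod_perm_pos (p : Equiv.Perm D) (x : D) : 0 < Function.minimalPeriod p x := by
  apply Function.minimalPeriod_pos_of_mem_periodicPts
  refine ⟨orderOf p, orderOf_pos p, ?_⟩
  rw [Function.IsPeriodicPt, Function.IsFixedPt, ← Equiv.Perm.coe_pow, pow_orderOf_eq_one]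
  rfl

lemma sameCycle_iff_iterate (p : Equiv.Perm D) (x y : D) :
    p.SameCycle x y ↔ ∃ i < Function.minimalPeriod p x, p^[i] x = y := by
  constructor
  · intro h
    obtain ⟨i, hi⟩ := h.exists_nat_pow_eq
    refine ⟨i % Function.minimalPeriod p x, Nat.mod_lt _ (minimalPeriod_perm_pos p x), ?_⟩
    rw [Function.iterate_mod_minimalPeriod_eq, ← hi, Equiv.Perm.coe_pow]
  · rintro ⟨i, -, rfl⟩
    rw [← Equiv.Perm.coe_pow]
    exact ⟨i, by simp⟩

lemma ncard_sameCycle (p : Equiv.Perm D) (x : D) :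
    {y | p.SameCycle x y}.ncard = Function.minimalPeriod p x := by
  have h : {y | p.SameCycle x y} =
      (fun i => p^[i] x) '' (Finset.range (Function.minimalPeriod p x) : Set ℕ) := by
    ext y
    simp [sameCycle_iff_iterate]
  rw [h, Set.InjOn.ncard_image, Set.ncard_coe_finset, Finset.card_range]
  intro i hi j hj hij
  simp only [Finset.coe_range, Set.mem_Iio] at hi hj
  exact Function.iterate_injOn_Iio_minimalPeriod hi hj hij

lemma minimalPeriod_sameCycle {p : Equiv.Perm D} {x y : D} (h : p.SameCycle x y) :
    Function.minimalPeriod p x = Function.minimalPeriod p y := by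
  rw [← ncard_sameCycle, ← ncard_sameCycle]
  congr 1
  ext z
  exact ⟨fun hz => h.symm.trans hz, fun hz => h.trans hz⟩

omit [Fintype D] in
lemma orbit_eq_iff {p : Equiv.Perm D} {x y : D} :
    {z | p.SameCycle x z} = {z | p.SameCycle y z} ↔ p.SameCycle x y := by
  constructor
  · intro h
    have : y ∈ {z | p.SameCycle x z} := by
      rw [h]
      exact Equiv.Perm.SameCycle.refl p y
    exact this
  · intro h
    ext z
    exact ⟨fun hz => h.symm.trans hz, fun hz => h.trans hz⟩

/-- The points on orbits of length `m`, counted orbit by orbit. -/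
lemma card_minimalPeriod_eq (p : Equiv.Perm D) (m : ℕ) :
    (Finset.univ.filter fun d => Function.minimalPeriod p d = m).card =
      m * {O ∈ Hypermap.orbits p | O.ncard = m}.ncard := by
  set T : Finset (Set D) := (Set.toFinite {O ∈ Hypermap.orbits p | O.ncard = m}).toFinset with hT
  have hTc : {O ∈ Hypermap.orbits p | O.ncard = m}.ncard = T.card := by
    rw [hT, Set.ncard_eq_toFinset_card _ (Set.toFinite _)]
  rw [hTc, mul_comm]
  have hmap : ∀ d ∈ (Finset.univ.filter fun d => Function.minimalPeriod p d = m),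
      {y | p.SameCycle d y} ∈ T := by
    intro d hd
    simp only [Finset.mem_filter, Finset.mem_univ, true_and] at hd
    simp only [hT, Set.Finite.mem_toFinset]
    exact ⟨⟨d, rfl⟩, by rw [ncard_sameCycle, hd]⟩
  rw [Finset.card_eq_sum_card_fiberwise hmap]
  apply Finset.sum_const_nat
  intro O hO
  simp only [hT, Set.Finite.mem_toFinset] at hO
  obtain ⟨⟨x, rfl⟩, hx⟩ := hO
  rw [← hx, Set.ncard_eq_toFinset_card' {y | p.SameCycle x y}]
  congr 1
  ext y
  simp only [Finset.mem_filter, Finset.mem_univ, true_and, Set.mem_toFinset]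
  constructor
  · rintro ⟨-, h⟩
    exact (orbit_eq_iff.mp h).symm
  · intro h
    have h' : p.SameCycle x y := h
    refine ⟨?_, (orbit_eq_iff.mpr h').symm⟩
    rw [← minimalPeriod_sameCycle h', ← ncard_sameCycle, Set.ncard_eq_toFinset_card']

end Orbits

/-! ### Contact maps -/

/-- The combinatorial map of a contact graph on the sphere of radius `2`: darts with the involution
`e` and the rotation `n` about their initial point `pos`. The faces are the orbits of `n⁻¹ * e`; a
face lies on the left of its darts, and the corner of `d` is the one between `d` and `n d`. Only
the properties that the classification uses are recorded. -/
structure ContactMap (D : Type) [Fintype D] where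
  e : Equiv.Perm D
  n : Equiv.Perm D
  pos : D → Space
  e_e : ∀ d, e (e d) = d
  pos_n : ∀ d, pos (n d) = pos d
  same_node : ∀ d d', pos d = pos d' → n.SameCycle d d'
  /-- A face meets a point at most once. -/
  simple : ∀ d d', (n⁻¹ * e).SameCycle d d' → pos d = pos d' → d = d'
  inj : ∀ d d', pos d = pos d' → pos (e d) = pos (e d') → d = d'
  norm : ∀ d, ⟪pos d, pos d⟫ = 4
  contact : ∀ d, ⟪pos d, pos (e d)⟫ = 2
  /-- Points that do not touch have a distance of at least `2.52`. -/
  gap : ∀ d d', pos d ≠ pos d' →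
    (∃ x, pos x = pos d ∧ pos (e x) = pos d') ∨ ⟪pos d, pos d'⟫ ≤ 0.8248
  two_le_deg : ∀ d, 2 ≤ Function.minimalPeriod n d
  deg_le_four : ∀ d, Function.minimalPeriod n d ≤ 4
  three_le_face : ∀ d, 3 ≤ Function.minimalPeriod (n⁻¹ * e) d
  /-- Mutually touching points form a triangular face. -/
  tri : ∀ d, ⟪pos (e d), pos (e (n d))⟫ = 2 → Function.minimalPeriod (n⁻¹ * e) d = 3 ∨
    (n (n d) = d ∧ Function.minimalPeriod (n⁻¹ * e) (n d) = 3)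
  /-- Corners of small faces are convex at points with at least three contacts. -/
  convex : ∀ d, n (n d) ≠ d → Function.minimalPeriod (n⁻¹ * e) d ≤ 4 →
    0 < det3 (pos d) (pos (e d)) (pos (e (n d)))
  /-- A point without large faces has three quadrilaterals and at most one triangle, or two
  quadrilaterals and two triangles. -/
  type : ∀ d, (∀ d', pos d' = pos d → Function.minimalPeriod (n⁻¹ * e) d' ≤ 4) →
    ((Finset.univ.filter fun d' => pos d' = pos d ∧ Function.minimalPeriod (n⁻¹ * e) d' = 3).card,
      (Finset.univ.filter fun d' => pos d' = pos d ∧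
        Function.minimalPeriod (n⁻¹ * e) d' = 4).card) ∈ [(0, 3), (1, 3), (2, 2)]

namespace ContactMap

variable {D : Type} [Fintype D] (M : ContactMap D)

/-- The face permutation. -/
def f : Equiv.Perm D := M.n⁻¹ * M.e

/-- The number of darts of the face of a dart. -/
noncomputable def k (d : D) : ℕ := Function.minimalPeriod M.f d

/-- The number of darts at the initial point of a dart. -/
noncomputable def deg (d : D) : ℕ := Function.minimalPeriod M.n d

lemma n_f (d : D) : M.n (M.f d) = M.e d := by simp [f]

lemma f_e_n (d : D) : M.f (M.e (M.n d)) = d := by simp [f, M.e_e]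

lemma f_e (d : D) : M.n (M.f (M.e d)) = d := by rw [n_f, M.e_e]

lemma k_f (d : D) : M.k (M.f d) = M.k d :=
  Function.minimalPeriod_apply (Function.minimalPeriod_pos_iff_mem_periodicPts.mp
    (minimalPeriod_perm_pos M.f d))

lemma k_e_n (d : D) : M.k (M.e (M.n d)) = M.k d := by
  rw [← M.k_f (M.e (M.n d)), f_e_n]

lemma deg_n (d : D) : M.deg (M.n d) = M.deg d :=
  Function.minimalPeriod_apply (Function.minimalPeriod_pos_iff_mem_periodicPts.mp
    (minimalPeriod_perm_pos M.n d))

end ContactMap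

/-! ### The contact map of a configuration with tame contact -/

noncomputable instance (H : Hypermap) : Fintype H.Dart := Fintype.ofFinite H.Dart

section Extraction

variable {V : Set Space} (hV : IsConfig V)

lemma contactHypermap_f (x : (contactHypermap hV).Dart) :
    (contactHypermap hV).f x = (contactHypermap hV).n⁻¹ ((contactHypermap hV).e x) := rfl

lemma contactHypermap_f_eq :
    (contactHypermap hV).f = (contactHypermap hV).n⁻¹ * (contactHypermap hV).e :=
  Equiv.ext fun x => contactHypermap_f hV x

/-- The initial point of a dart. -/
def dartPos (x : (contactHypermap hV).Dart) : Space := x.1.1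

/-- The terminal point of a dart. -/
def dartHead (x : (contactHypermap hV).Dart) : Space := x.1.2

lemma dartPos_n (x : (contactHypermap hV).Dart) :
    dartPos hV ((contactHypermap hV).n x) = dartPos hV x := rfl

lemma dart_ext {x y : (contactHypermap hV).Dart} (h1 : dartPos hV x = dartPos hV y)
    (h2 : dartHead hV x = dartHead hV y) : x = y :=
  Subtype.ext (Prod.ext h1 h2)

lemma dartHead_n (x : (contactHypermap hV).Dart) :
    dartHead hV ((contactHypermap hV).n x) = sigma hV.isFan (dartPos hV x) (dartHead hV x) := rfl

variable {hV}
variable (hT : (contactHypermap hV).HasTameContact)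

include hT

lemma dartHead_mem (x : (contactHypermap hV).Dart) :
    dartHead hV x ∈ nbrs (contactEdges V) (dartPos hV x) := by
  rcases x.2 with h | ⟨_, _, h3⟩
  · exact h
  · exfalso
    refine hT.nondegenerate x (dart_ext hV ?_ ?_)
    · exact h3
    · exact h3.symm

lemma dartHead_n_eq (x : (contactHypermap hV).Dart) :
    dartHead hV ((contactHypermap hV).n x) =
      succPt (contactEdges V) (dartPos hV x) (dartHead hV x) := by
  rw [dartHead_n, sigma_of_mem hV.isFan (dartHead_mem hT x)]

lemma dartPos_mem (x : (contactHypermap hV).Dart) : dartPos hV x ∈ V :=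
  (hV.mem_nbrs.mp (dartHead_mem hT x)).1

omit hT in
lemma exists_dart {v w : Space} (h : w ∈ nbrs (contactEdges V) v) :
    ∃ x : (contactHypermap hV).Dart, dartPos hV x = v ∧ dartHead hV x = w :=
  ⟨⟨(v, w), Or.inl h⟩, rfl, rfl⟩

omit hT in
lemma exists_dart_at {v : Space} (hv : v ∈ V) :
    ∃ x : (contactHypermap hV).Dart, dartPos hV x = v := by
  by_cases h : nbrs (contactEdges V) v = ∅
  · exact ⟨⟨(v, v), Or.inr ⟨hv, h, rfl⟩⟩, rfl⟩
  · obtain ⟨w, hw⟩ := Set.nonempty_iff_ne_empty.mpr h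
    obtain ⟨x, hx, -⟩ := exists_dart (hV := hV) hw
    exact ⟨x, hx⟩

omit hT in
lemma dartPos_sameCycle {x y : (contactHypermap hV).Dart}
    (h : (contactHypermap hV).n.SameCycle x y) : dartPos hV x = dartPos hV y := by
  obtain ⟨i, -, rfl⟩ := (sameCycle_iff_iterate _ _ _).mp h
  induction i with
  | zero => rfl
  | succ i ih =>
    rw [Function.iterate_succ_apply', dartPos_n]
    exact ih ⟨i, by rw [zpow_natCast, Equiv.Perm.coe_pow]⟩

/-- The twelve nodes are the twelve points. -/
lemma dart_same_node (x y : (contactHypermap hV).Dart) (h : dartPos hV x = dartPos hV y) :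
    (contactHypermap hV).n.SameCycle x y := by
  let g : Set (contactHypermap hV).Dart → Space := fun N => if h : N.Nonempty then dartPos hV h.some else 0
  have hg : ∀ x, g {y | (contactHypermap hV).n.SameCycle x y} = dartPos hV x := by
    intro x
    have hne : {y | (contactHypermap hV).n.SameCycle x y}.Nonempty := ⟨x, Equiv.Perm.SameCycle.refl _ _⟩
    simp only [g, dif_pos hne]
    exact (dartPos_sameCycle hne.some_mem).symm
  have himg : g '' (contactHypermap hV).nodes = V := by
    ext v
    constructor
    · rintro ⟨_, ⟨x, rfl⟩, rfl⟩
      simp only [hg]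
      exact dartPos_mem hT x
    · intro hv
      obtain ⟨x, hx⟩ := exists_dart_at (hV := hV) hv
      exact ⟨_, ⟨x, rfl⟩, by simp only [hg, hx]⟩
  have hinj : Set.InjOn g (contactHypermap hV).nodes := by
    refine Set.injOn_of_ncard_image_eq ?_ (Set.toFinite _)
    rw [himg, hV.card, hT.node_count]
  rw [← orbit_eq_iff]
  exact hinj ⟨x, rfl⟩ ⟨y, rfl⟩ (by simp only [hg, h])

lemma node_eq (x : (contactHypermap hV).Dart) :
    {y | (contactHypermap hV).n.SameCycle x y} = {y | dartPos hV y = dartPos hV x} := by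
  ext y
  exact ⟨fun h => (dartPos_sameCycle h).symm, fun h => dart_same_node hT x y h.symm⟩

lemma node_period (x : (contactHypermap hV).Dart) :
    2 ≤ Function.minimalPeriod (contactHypermap hV).n x ∧
      Function.minimalPeriod (contactHypermap hV).n x ≤ 4 := by
  rw [← ncard_sameCycle]
  exact hT.node_size _ ⟨x, rfl⟩

lemma face_period (x : (contactHypermap hV).Dart) :
    3 ≤ Function.minimalPeriod (contactHypermap hV).f x ∧
      Function.minimalPeriod (contactHypermap hV).f x ≤ 8 := by
  rw [← ncard_sameCycle]
  exact hT.face_size _ ⟨x, rfl⟩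

lemma face_simple (x y : (contactHypermap hV).Dart)
    (h : (contactHypermap hV).f.SameCycle x y) (hp : dartPos hV x = dartPos hV y) : x = y :=
  hT.simple _ ⟨x, rfl⟩ _ ⟨x, rfl⟩ ⟨Equiv.Perm.SameCycle.refl _ _, Equiv.Perm.SameCycle.refl _ _⟩
    ⟨h, dart_same_node hT x y hp⟩

/-- At a node, the faces of a given kind correspond to the darts. -/
lemma ncard_faces_at (x : (contactHypermap hV).Dart) (P : ℕ → Prop) :
    {F ∈ (contactHypermap hV).faces |
      ({y | (contactHypermap hV).n.SameCycle x y} ∩ F).Nonempty ∧ P F.ncard}.ncard =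
    (Finset.univ.filter fun y => dartPos hV y = dartPos hV x ∧
      P (Function.minimalPeriod (contactHypermap hV).f y)).card := by
  have h : {F ∈ (contactHypermap hV).faces | ({y | (contactHypermap hV).n.SameCycle x y} ∩ F).Nonempty ∧ P F.ncard} =
      (fun y => {z | (contactHypermap hV).f.SameCycle y z}) '' ((Finset.univ.filter fun y => dartPos hV y =
        dartPos hV x ∧ P (Function.minimalPeriod (contactHypermap hV).f y) : Finset (contactHypermap hV).Dart) : Set (contactHypermap hV).Dart) := by
    rw [node_eq hT]
    ext F
    constructor
    · rintro ⟨⟨z, rfl⟩, ⟨y, hy1, hy2⟩, hP⟩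
      have hy3 : (contactHypermap hV).f.SameCycle z y := hy2
      refine ⟨y, ?_, (orbit_eq_iff.mpr hy3).symm⟩
      simp only [Finset.coe_filter, Finset.mem_univ, true_and]
      refine ⟨hy1, ?_⟩
      rw [← minimalPeriod_sameCycle hy3, ← ncard_sameCycle]
      exact hP
    · rintro ⟨y, hy, rfl⟩
      simp only [Finset.coe_filter, Finset.mem_univ, true_and] at hy
      refine ⟨⟨y, rfl⟩, ⟨y, hy.1, Equiv.Perm.SameCycle.refl _ _⟩, ?_⟩
      simp only [ncard_sameCycle]
      exact hy.2
  rw [h, Set.InjOn.ncard_image, Set.ncard_coe_finset]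
  intro y hy z hz hyz
  simp only [Finset.coe_filter, Finset.mem_univ, true_and] at hy hz
  exact face_simple hT y z (orbit_eq_iff.mp hyz) (hy.1.trans hz.1.symm)

omit hT in
lemma card_filter_and_split {D : Type} [Fintype D] (pos : D → Space) (v : Space) (k : D → ℕ)
    (h3 : ∀ d, 3 ≤ k d) (h4 : ∀ d, pos d = v → k d ≤ 4) :
    (Finset.univ.filter fun d => pos d = v).card =
      (Finset.univ.filter fun d => pos d = v ∧ k d = 3).card +
        (Finset.univ.filter fun d => pos d = v ∧ k d = 4).card := by
  rw [← Finset.card_union_of_disjoint]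
  · congr 1
    ext d
    simp only [Finset.mem_filter, Finset.mem_univ, true_and, Finset.mem_union]
    constructor
    · intro h
      have := h3 d
      have := h4 d h
      have h5 : k d = 3 ∨ k d = 4 := by omega
      rcases h5 with h5 | h5
      · exact Or.inl ⟨h, h5⟩
      · exact Or.inr ⟨h, h5⟩
    · rintro (h | h) <;> exact h.1
  · rw [Finset.disjoint_left]
    intro d h1 h2
    simp only [Finset.mem_filter, Finset.mem_univ, true_and] at h1 h2
    omega

lemma node_type (x : (contactHypermap hV).Dart)
    (hx : ∀ y, dartPos hV y = dartPos hV x →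
      Function.minimalPeriod (contactHypermap hV).f y ≤ 4) :
    ((Finset.univ.filter fun y => dartPos hV y = dartPos hV x ∧
        Function.minimalPeriod (contactHypermap hV).f y = 3).card,
      (Finset.univ.filter fun y => dartPos hV y = dartPos hV x ∧
        Function.minimalPeriod (contactHypermap hV).f y = 4).card) ∈
      [(0, 3), (1, 3), (2, 2)] := by
  set p := (Finset.univ.filter fun y => dartPos hV y = dartPos hV x ∧
        Function.minimalPeriod (contactHypermap hV).f y = 3).card with hp
  set q := (Finset.univ.filter fun y => dartPos hV y = dartPos hV x ∧
        Function.minimalPeriod (contactHypermap hV).f y = 4).card with hq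
  obtain ⟨τ, hτ, hsum⟩ := hT.weights
  have htype : (contactHypermap hV).HasType {y | (contactHypermap hV).n.SameCycle x y} p q 0 := by
    refine ⟨?_, ?_, ?_⟩
    · have h1 := ncard_faces_at hT x (fun _ => True)
      simp only [and_true] at h1
      rw [h1, add_zero, hp, hq]
      convert card_filter_and_split (dartPos hV) (dartPos hV x) _
        (fun y => (face_period hT y).1) hx
    · rw [Hypermap.facesAt, ncard_faces_at hT x (fun m => m = 3), hp]
      congr
    · rw [Hypermap.facesAt, ncard_faces_at hT x (fun m => m = 4), hq]
      congr
  have h1 := hτ.node _ ⟨x, rfl⟩ p q htype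
  have h2 : ∑ᶠ F ∈ {F ∈ (contactHypermap hV).faces | ({y | (contactHypermap hV).n.SameCycle x y} ∩ F).Nonempty}, τ F ≤
      ∑ᶠ F ∈ (contactHypermap hV).faces, τ F := by
    rw [finsum_mem_eq_finite_toFinset_sum _ (Set.toFinite _),
      finsum_mem_eq_finite_toFinset_sum _ (Set.toFinite (contactHypermap hV).faces)]
    apply Finset.sum_le_sum_of_subset_of_nonneg
    · intro F hF
      simp only [Set.Finite.mem_toFinset] at hF ⊢
      exact hF.1
    · intro F hF _
      simp only [Set.Finite.mem_toFinset] at hF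
      exact hτ.nonneg F hF
  have h3 : bTable p q < tgt := by linarith
  unfold bTable at h3
  simp only [List.mem_cons, List.not_mem_nil, or_false]
  split_ifs at h3 with h4 h5
  · tauto
  · tauto
  · exact absurd h3 (lt_irrefl _)

omit hT in
lemma dart_inner (hT : (contactHypermap hV).HasTameContact) (x : (contactHypermap hV).Dart) :
    ⟪dartPos hV x, dartHead hV x⟫ = 2 := (hV.mem_nbrs.mp (dartHead_mem hT x)).2.2

lemma dart_gap (x y : (contactHypermap hV).Dart) (h : dartPos hV x ≠ dartPos hV y) :
    (∃ z, dartPos hV z = dartPos hV x ∧ dartHead hV z = dartPos hV y) ∨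
      ⟪dartPos hV x, dartPos hV y⟫ ≤ 0.8248 := by
  have hx := dartPos_mem hT x
  have hy := dartPos_mem hT y
  rcases hV.inner_cases hx hy h with h1 | h1
  · exact Or.inl (exists_dart (hV.mem_nbrs.mpr ⟨hx, hy, h1⟩))
  · exact Or.inr h1

lemma face_triangle {x : (contactHypermap hV).Dart}
    (hin : ⟪dartHead hV x, dartHead hV ((contactHypermap hV).n x)⟫ = 2)
    (hdet : 0 < det3 (dartPos hV x) (dartHead hV x) (dartHead hV ((contactHypermap hV).n x))) :
    Function.minimalPeriod (contactHypermap hV).f x = 3 := by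
  have hw := dartHead_mem hT x
  have hu := dartHead_mem hT ((contactHypermap hV).n x)
  rw [dartPos_n] at hu
  set v := dartPos hV x with hv
  set w := dartHead hV x with hw'
  set u := dartHead hV ((contactHypermap hV).n x) with hu'
  have hwv := hV.mem_nbrs.mp hw
  have huv := hV.mem_nbrs.mp hu
  -- the inverse face permutation runs through `(v, w)`, `(u, v)`, `(w, u)`
  have hinv : ∀ y, (contactHypermap hV).f ((contactHypermap hV).e ((contactHypermap hV).n y)) = y := by
    intro y
    rw [contactHypermap_f, hT.plain]
    simp
  obtain ⟨y, hy1, hy2⟩ := exists_dart (hV := hV)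
    (hV.mem_nbrs.mpr ⟨huv.2.1, huv.1, by rw [real_inner_comm]; exact huv.2.2⟩)
  obtain ⟨z, hz1, hz2⟩ := exists_dart (hV := hV) (hV.mem_nbrs.mpr ⟨hwv.2.1, huv.2.1, hin⟩)
  have e1 : (contactHypermap hV).e ((contactHypermap hV).n x) = y := dart_ext hV hy1.symm (by rw [hy2]; rfl)
  have e2 : (contactHypermap hV).e ((contactHypermap hV).n y) = z := by
    apply dart_ext hV
    · change dartHead hV ((contactHypermap hV).n y) = _
      rw [dartHead_n_eq hT, hy1, hy2, hz1]
      apply hV.succPt_of_contact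
      · rw [← hy1, ← hy2]
        exact dartHead_mem hT y
      · rw [hV.mem_nbrs, real_inner_comm]
        exact ⟨huv.2.1, hwv.2.1, hin⟩
      · exact hwv.2.2
      · rwa [← det3_rotate]
    · rw [hz2, ← hy1]; rfl
  have e3 : (contactHypermap hV).e ((contactHypermap hV).n z) = x := by
    apply dart_ext hV
    · change dartHead hV ((contactHypermap hV).n z) = _
      rw [dartHead_n_eq hT, hz1, hz2]
      apply hV.succPt_of_contact
      · rw [hV.mem_nbrs]
        exact ⟨hwv.2.1, huv.2.1, hin⟩
      · rw [hV.mem_nbrs, real_inner_comm]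
        exact ⟨hwv.2.1, hwv.1, hwv.2.2⟩
      · rw [real_inner_comm]
        exact huv.2.2
      · rwa [det3_rotate]
    · change dartPos hV z = w
      exact hz1
  have f1 : (contactHypermap hV).f y = x := by rw [← e1, hinv]
  have f2 : (contactHypermap hV).f z = y := by rw [← e2, hinv]
  have f3 : (contactHypermap hV).f x = z := by rw [← hinv z, e3]
  have hper : Function.IsPeriodicPt (contactHypermap hV).f 3 x := by
    change (contactHypermap hV).f ((contactHypermap hV).f ((contactHypermap hV).f x)) = x
    rw [f3, f2, f1]
  exact le_antisymm (hper.minimalPeriod_le (by norm_num)) (face_period hT x).1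

lemma face_tri (x : (contactHypermap hV).Dart)
    (hin : ⟪dartHead hV x, dartHead hV ((contactHypermap hV).n x)⟫ = 2) :
    Function.minimalPeriod (contactHypermap hV).f x = 3 ∨
      ((contactHypermap hV).n ((contactHypermap hV).n x) = x ∧
        Function.minimalPeriod (contactHypermap hV).f ((contactHypermap hV).n x) = 3) := by
  have hw := dartHead_mem hT x
  have hu := dartHead_mem hT ((contactHypermap hV).n x)
  rw [dartPos_n] at hu
  rcases lt_or_gt_of_ne (hV.det3_ne_zero hw hu hin) with h | h
  · right
    have h' : 0 < det3 (dartPos hV x) (dartHead hV ((contactHypermap hV).n x)) (dartHead hV x) := by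
      rw [det3_swap]
      linarith
    have hs := hV.succPt_of_contact hu hw (by rwa [real_inner_comm]) h'
    have hnn : (contactHypermap hV).n ((contactHypermap hV).n x) = x := by
      apply dart_ext hV (x := (contactHypermap hV).n ((contactHypermap hV).n x)) (y := x) rfl
      rw [dartHead_n_eq hT]
      exact hs
    refine ⟨hnn, face_triangle hT ?_ ?_⟩
    · rwa [hnn, real_inner_comm]
    · rwa [hnn]
  · left
    exact face_triangle hT hin h

lemma face_convex (x : (contactHypermap hV).Dart)
    (hnn : (contactHypermap hV).n ((contactHypermap hV).n x) ≠ x)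
    (hk : Function.minimalPeriod (contactHypermap hV).f x ≤ 4) :
    0 < det3 (dartPos hV x) (dartHead hV x) (dartHead hV ((contactHypermap hV).n x)) := by
  have hn1 : (contactHypermap hV).n x ≠ x := by
    intro h
    rw [h, h] at hnn
    exact hnn rfl
  have hinj : ∀ y z, dartPos hV y = dartPos hV z → dartHead hV y = dartHead hV z → y = z :=
    fun y z => dart_ext hV
  have hw := dartHead_mem hT x
  have hu := dartHead_mem hT ((contactHypermap hV).n x)
  have hx2 := dartHead_mem hT ((contactHypermap hV).n ((contactHypermap hV).n x))
  rw [dartPos_n] at hu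
  rw [dartPos_n, dartPos_n] at hx2
  have hs := dartHead_n_eq hT x
  rw [hs]
  refine hV.det3_succPt_pos hw hx2 ?_ ?_ ?_
  · exact fun h => hnn (hinj _ _ rfl h)
  · rw [← hs]
    exact fun h => hn1 ((contactHypermap hV).n.injective (hinj _ _ rfl h))
  · rw [← hs]
    -- the head of `x` and of `n x` touch, or are opposite corners of a rhombus
    have hinv : ∀ y, (contactHypermap hV).f ((contactHypermap hV).e ((contactHypermap hV).n y)) = y := by
      intro y
      rw [contactHypermap_f, hT.plain]
      simp
    have h3 := (face_period hT x).1
    have hper := Function.isPeriodicPt_minimalPeriod (contactHypermap hV).f x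
    have c34 : Function.minimalPeriod (contactHypermap hV).f x = 3 ∨ Function.minimalPeriod (contactHypermap hV).f x = 4 := by omega
    set y := (contactHypermap hV).e ((contactHypermap hV).n x) with hy
    set z := (contactHypermap hV).f x with hz
    have hyx : (contactHypermap hV).f y = x := hinv x
    have hzpos : dartPos hV z = dartHead hV x := rfl
    rcases c34 with h | h
    · rw [h] at hper
      have hfy : (contactHypermap hV).f z = y := by
        apply (contactHypermap hV).f.injective
        rw [hyx]
        exact hper
      have : ⟪dartHead hV x, dartHead hV ((contactHypermap hV).n x)⟫ = 2 := by
        have h5 := dart_inner hT z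
        have h6 : dartHead hV z = dartHead hV ((contactHypermap hV).n x) := by
          change dartPos hV ((contactHypermap hV).f z) = _
          rw [hfy]; rfl
        rw [← h6]
        exact h5
      linarith
    · rw [h] at hper
      have hfy : (contactHypermap hV).f ((contactHypermap hV).f z) = y := by
        apply (contactHypermap hV).f.injective
        rw [hyx]
        exact hper
      set t := (contactHypermap hV).f z with ht
      have i1 := dart_inner hT x
      have i2 := dart_inner hT z
      have i3 := dart_inner hT t
      have i4 := dart_inner hT y
      have p1 : dartHead hV z = dartPos hV t := rfl
      have p2 : dartHead hV t = dartPos hV y := by rw [← hfy]; rfl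
      have p3 : dartHead hV y = dartPos hV x := rfl
      have p4 : dartPos hV y = dartHead hV ((contactHypermap hV).n x) := rfl
      rw [← hzpos] at i1
      rw [p1] at i2
      rw [p2] at i3
      rw [p3] at i4
      have q := fun a => hV.inner_self (dartPos_mem hT a)
      have hxt : dartPos hV x ≠ dartPos hV t := by
        intro h5
        have h6 := face_simple hT x t ⟨2, by rfl⟩ h5
        have : Function.minimalPeriod (contactHypermap hV).f x ≤ 2 :=
          Function.IsPeriodicPt.minimalPeriod_le (by norm_num) (by
            change (contactHypermap hV).f ((contactHypermap hV).f x) = x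
            exact h6.symm)
        omega
      have hzy : dartPos hV z ≠ dartPos hV y := by
        rw [hzpos, p4]
        exact fun h5 => hn1 (hinj _ _ rfl h5.symm)
      have hr := rhombus (q x) (q z) (q t) (q y) i1 i2 i3 (by rw [real_inner_comm]; exact i4)
        hxt hzy
      have hle := hV.inner_le_two (dartPos_mem hT x) (dartPos_mem hT t) hxt
      have hge := neg_four_le_inner (q x) (q t)
      rw [hzpos, p4] at hr
      by_contra hc
      push Not at hc
      have hge2 := neg_four_le_inner (q z) (q y)
      rw [hzpos, p4] at hge2
      -- in the boundary case the product would be `6 * (8 / 3)`, excluded by the gap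
      rcases hV.inner_cases (dartPos_mem hT x) (dartPos_mem hT t) hxt with h7 | h7
      · -- a diagonal of length `2` would cut the quadrilateral into triangles
        exfalso
        have hez : dartPos hV ((contactHypermap hV).e x) = dartPos hV z := rfl
        have hnz : (contactHypermap hV).n z = (contactHypermap hV).e x := by
          rw [hz, contactHypermap_f]
          simp
        have hkz : Function.minimalPeriod (contactHypermap hV).f z = 4 := by
          rw [← h]
          exact (minimalPeriod_sameCycle ⟨1, rfl⟩).symm
        have h8 := face_tri hT z (by
          rw [hnz, real_inner_comm]
          exact h7)
        rcases h8 with h8 | ⟨h8, h9⟩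
        · omega
        have hdeg : Function.minimalPeriod (contactHypermap hV).n z = 2 :=
          le_antisymm (Function.IsPeriodicPt.minimalPeriod_le (by norm_num) h8) (node_period hT z).1
        -- the end of `x` has two darts, on a triangle and a quadrilateral
        have hy : ∀ y, dartPos hV y = dartPos hV z → y = z ∨ y = (contactHypermap hV).n z := by
          intro y hy
          obtain ⟨i, hi, rfl⟩ := (sameCycle_iff_iterate _ _ _).mp (dart_same_node hT z y hy.symm)
          rw [hdeg] at hi
          interval_cases i
          · exact Or.inl rfl
          · exact Or.inr rfl
        have hsmall : ∀ y, dartPos hV y = dartPos hV z →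
            Function.minimalPeriod (contactHypermap hV).f y ≤ 4 := by
          intro y h10
          rcases hy y h10 with rfl | rfl <;> omega
        have h10 := node_type hT z hsmall
        have h11 := card_filter_and_split (dartPos hV) (dartPos hV z) _
          (fun y => (face_period hT y).1) hsmall
        have h12 : (Finset.univ.filter fun y => dartPos hV y = dartPos hV z).card = 2 := by
          rw [← hdeg, ← ncard_sameCycle, node_eq hT, Set.ncard_eq_toFinset_card']
          congr 1
          ext y
          simp
        simp only [List.mem_cons, Prod.mk.injEq, List.not_mem_nil, or_false] at h10
        omega
      · nlinarith


lemma edge_period (x : (contactHypermap hV).Dart) :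
    Function.minimalPeriod (contactHypermap hV).e x = 2 := by
  have h : Function.IsPeriodicPt (contactHypermap hV).e 2 x := hT.plain x
  have h1 := h.minimalPeriod_le (by norm_num)
  have h2 := minimalPeriod_perm_pos (contactHypermap hV).e x
  have h3 : Function.minimalPeriod (contactHypermap hV).e x ≠ 1 := by
    rw [Ne, Function.minimalPeriod_eq_one_iff_isFixedPt]
    exact hT.nondegenerate x
  omega

/-- The contact map of a configuration with tame contact. -/
noncomputable def contactMapOf : ContactMap (contactHypermap hV).Dart where
  e := (contactHypermap hV).e
  n := (contactHypermap hV).n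
  pos := dartPos hV
  e_e := hT.plain
  pos_n := dartPos_n hV
  same_node := dart_same_node hT
  simple := by
    rw [← contactHypermap_f_eq]
    exact face_simple hT
  inj := fun _ _ h1 h2 => dart_ext hV h1 h2
  norm := fun d => hV.inner_self (dartPos_mem hT d)
  contact := dart_inner hT
  gap := dart_gap hT
  two_le_deg := fun d => (node_period hT d).1
  deg_le_four := fun d => (node_period hT d).2
  three_le_face := by
    rw [← contactHypermap_f_eq]
    exact fun d => (face_period hT d).1
  tri := by
    rw [← contactHypermap_f_eq]
    exact face_tri hT
  convex := by
    rw [← contactHypermap_f_eq]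
    exact face_convex hT
  type := by
    rw [← contactHypermap_f_eq]
    exact node_type hT

end Extraction

/-! ### Counting faces and darts -/

section Counting

lemma sum_ncard_fiberwise {D : Type} [Fintype D] (S : Set (Set D)) (a b : ℕ)
    (h : ∀ O ∈ S, a ≤ O.ncard ∧ O.ncard ≤ b) (g : ℕ → ℝ) :
    ∑ O ∈ (Set.toFinite S).toFinset, g O.ncard =
      ∑ m ∈ Finset.Icc a b, ({O ∈ S | O.ncard = m}.ncard : ℝ) * g m := by
  rw [← Finset.sum_fiberwise_of_maps_to (t := Finset.Icc a b) (g := fun O : Set D => O.ncard)]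
  · apply Finset.sum_congr rfl
    intro m _
    have h1 : (Finset.filter (fun O : Set D => O.ncard = m) (Set.toFinite S).toFinset) =
        (Set.toFinite {O ∈ S | O.ncard = m}).toFinset := by
      ext O
      simp
    rw [h1, Set.ncard_eq_toFinset_card _ (Set.toFinite _), ← nsmul_eq_mul, ← Finset.sum_const]
    apply Finset.sum_congr rfl
    intro O hO
    simp only [Set.Finite.mem_toFinset] at hO
    rw [hO.2]
  · intro O hO
    simp only [Set.Finite.mem_toFinset] at hO
    exact Finset.mem_Icc.mpr (h O hO)

lemma ncard_eq_sum_fiberwise {D : Type} [Fintype D] (S : Set (Set D)) (a b : ℕ)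
    (h : ∀ O ∈ S, a ≤ O.ncard ∧ O.ncard ≤ b) :
    S.ncard = ∑ m ∈ Finset.Icc a b, {O ∈ S | O.ncard = m}.ncard := by
  have h1 := sum_ncard_fiberwise S a b h (fun _ => 1)
  simp only [Finset.sum_const, nsmul_eq_mul, mul_one] at h1
  rw [Set.ncard_eq_toFinset_card _ (Set.toFinite _)]
  exact_mod_cast h1

lemma card_eq_sum_orbits {D : Type} [Fintype D] (p : Equiv.Perm D) (a b : ℕ)
    (h : ∀ x, a ≤ Function.minimalPeriod p x ∧ Function.minimalPeriod p x ≤ b) :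
    Fintype.card D = ∑ m ∈ Finset.Icc a b,
      m * {O ∈ Hypermap.orbits p | O.ncard = m}.ncard := by
  rw [← Finset.card_univ, Finset.card_eq_sum_card_fiberwise (t := Finset.Icc a b)
    (f := fun x => Function.minimalPeriod p x) (fun x _ => by
      simp only [Finset.coe_Icc, Set.mem_Icc]
      exact h x)]
  exact Finset.sum_congr rfl fun m _ => card_minimalPeriod_eq p m

lemma sum_Icc_three_eight {A : Type} [AddCommMonoid A] (g : ℕ → A) :
    ∑ m ∈ Finset.Icc 3 8, g m = g 3 + g 4 + g 5 + g 6 + g 7 + g 8 := by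
  simp [Finset.sum_Icc_succ_top]

variable {V : Set Space} {hV : IsConfig V} (hT : (contactHypermap hV).HasTameContact)

/-- The number of faces with `m` darts. -/
noncomputable def faceCount (H : Hypermap) (m : ℕ) : ℕ := {F ∈ H.faces | F.ncard = m}.ncard

include hT

lemma card_darts_faces : Fintype.card (contactHypermap hV).Dart =
    3 * faceCount (contactHypermap hV) 3 + 4 * faceCount (contactHypermap hV) 4 +
    5 * faceCount (contactHypermap hV) 5 + 6 * faceCount (contactHypermap hV) 6 +
    7 * faceCount (contactHypermap hV) 7 + 8 * faceCount (contactHypermap hV) 8 :=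
  (card_eq_sum_orbits (contactHypermap hV).f 3 8 (face_period hT)).trans (sum_Icc_three_eight _)

/-- Euler's relation for twelve nodes, in terms of the numbers of faces. -/
lemma euler_count : 24 + 2 * (faceCount (contactHypermap hV) 3 + faceCount (contactHypermap hV) 4 +
    faceCount (contactHypermap hV) 5 + faceCount (contactHypermap hV) 6 +
    faceCount (contactHypermap hV) 7 + faceCount (contactHypermap hV) 8) =
    Fintype.card (contactHypermap hV).Dart + 4 := by
  have h1 := ncard_eq_sum_fiberwise (contactHypermap hV).faces 3 8 hT.face_size
  have h2 := card_eq_sum_orbits (contactHypermap hV).e 2 2 fun x => by simp [edge_period hT]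
  have h3 := ncard_eq_sum_fiberwise (contactHypermap hV).edges 2 2 (by
    rintro _ ⟨x, rfl⟩
    simp [ncard_sameCycle, edge_period hT])
  have h4 := hT.planar
  rw [hT.node_count, Nat.card_eq_fintype_card] at h4
  simp only [Finset.Icc_self, Finset.sum_singleton] at h2 h3
  rw [sum_Icc_three_eight] at h1
  change _ = faceCount (contactHypermap hV) 3 + faceCount (contactHypermap hV) 4 +
    faceCount (contactHypermap hV) 5 + faceCount (contactHypermap hV) 6 +
    faceCount (contactHypermap hV) 7 + faceCount (contactHypermap hV) 8 at h1
  change _ = 2 * {O ∈ (contactHypermap hV).edges | O.ncard = 2}.ncard at h2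
  omega

/-- A face with `m ≥ 4` darts weighs at least `0.206 + 0.27 * (m - 4)`, and the total weight is less
than `1.541`. -/
lemma weight_count : 206 * faceCount (contactHypermap hV) 4 +
    476 * faceCount (contactHypermap hV) 5 + 746 * faceCount (contactHypermap hV) 6 +
    1016 * faceCount (contactHypermap hV) 7 + 1286 * faceCount (contactHypermap hV) 8 < 1541 := by
  obtain ⟨τ, hτ, hsum⟩ := hT.weights
  rw [finsum_mem_eq_finite_toFinset_sum _ (Set.toFinite _)] at hsum
  have h1 := sum_ncard_fiberwise (contactHypermap hV).faces 3 8 hT.face_size d1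
  have h2 : ∑ O ∈ (Set.toFinite (contactHypermap hV).faces).toFinset, d1 O.ncard ≤
      ∑ O ∈ (Set.toFinite (contactHypermap hV).faces).toFinset, τ O :=
    Finset.sum_le_sum fun O hO => hτ.face O (by simpa using hO)
  have h3 : ∑ m ∈ Finset.Icc 3 8,
      ({O ∈ (contactHypermap hV).faces | O.ncard = m}.ncard : ℝ) * d1 m =
      0 + 0.206 * faceCount (contactHypermap hV) 4 +
    0.476 * faceCount (contactHypermap hV) 5 + 0.746 * faceCount (contactHypermap hV) 6 +
    1.016 * faceCount (contactHypermap hV) 7 + 1.286 * faceCount (contactHypermap hV) 8 := by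
    rw [sum_Icc_three_eight]
    simp only [d1, faceCount]
    norm_num
    ring
  rw [h1, h3] at h2
  unfold tgt at hsum
  have h4 : (206 * faceCount (contactHypermap hV) 4 +
    476 * faceCount (contactHypermap hV) 5 + 746 * faceCount (contactHypermap hV) 6 +
    1016 * faceCount (contactHypermap hV) 7 + 1286 * faceCount (contactHypermap hV) 8 : ℝ) < 1541 :=
    by linarith
  exact_mod_cast h4

lemma card_face_darts (m : ℕ) :
    (Finset.univ.filter fun d => (contactMapOf hT).k d = m).card =
      m * faceCount (contactHypermap hV) m := by
  have h := card_minimalPeriod_eq (contactHypermap hV).f m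
  rw [contactHypermap_f_eq] at h
  rw [faceCount, Hypermap.faces, contactHypermap_f_eq]
  exact h

end Counting

namespace ContactMap

variable {D : Type} [Fintype D]

/-- The global conditions on a contact map with `fc m` faces of `m` darts: Euler's relation for a
sphere with twelve nodes, the bound on the total weight of the faces (in thousandths), and
connectedness. -/
structure IsTame (M : ContactMap D) (fc : ℕ → ℕ) : Prop where
  card_k : ∀ m, (Finset.univ.filter fun d => M.k d = m).card = m * fc m
  k_le : ∀ d, M.k d ≤ 8
  card_darts : Fintype.card D = 3 * fc 3 + 4 * fc 4 + 5 * fc 5 + 6 * fc 6 + 7 * fc 7 + 8 * fc 8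
  euler : 20 + 2 * (fc 3 + fc 4 + fc 5 + fc 6 + fc 7 + fc 8) = Fintype.card D
  weight : 206 * fc 4 + 476 * fc 5 + 746 * fc 6 + 1016 * fc 7 + 1286 * fc 8 < 1541
  card_nodes : (Finset.univ.image M.pos).card = 12
  connected : ∀ S : Set D, S.Nonempty → (∀ d ∈ S, M.e d ∈ S ∧ M.n d ∈ S) → S = Set.univ

end ContactMap

section

variable {V : Set Space} {hV : IsConfig V} (hT : (contactHypermap hV).HasTameContact)

lemma isTame_contactMapOf : (contactMapOf hT).IsTame (faceCount (contactHypermap hV)) where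
  card_k := card_face_darts hT
  k_le := by
    intro d
    have := (face_period hT d).2
    rw [contactHypermap_f_eq] at this
    exact this
  card_darts := card_darts_faces hT
  euler := by
    have := euler_count hT
    omega
  weight := weight_count hT
  card_nodes := by
    rw [← hV.card, ← Set.ncard_coe_finset]
    congr 1
    ext v
    simp only [Finset.coe_image, Finset.coe_univ, Set.image_univ, Set.mem_range]
    constructor
    · rintro ⟨x, rfl⟩
      exact dartPos_mem hT x
    · exact exists_dart_at
  connected := by
    intro S hne hS
    have hE : ∀ d, (contactHypermap hV).e d ∈ S ↔ d ∈ S := by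
      intro d
      refine ⟨fun h => ?_, fun h => (hS _ h).1⟩
      have h1 : (contactHypermap hV).e ((contactHypermap hV).e d) ∈ S := (hS _ h).1
      rwa [hT.plain] at h1
    have hN : ∀ d, (contactHypermap hV).n d ∈ S ↔ d ∈ S := by
      intro d
      refine ⟨fun h => ?_, fun h => (hS _ h).2⟩
      have h1 : ∀ i : ℕ, (contactHypermap hV).n^[i] ((contactHypermap hV).n d) ∈ S := by
        intro i
        induction i with
        | zero => exact h
        | succ i ih =>
          rw [Function.iterate_succ_apply']
          exact (hS _ ih).2
      obtain ⟨i, -, hi⟩ := (sameCycle_iff_iterate (contactHypermap hV).n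
        ((contactHypermap hV).n d) d).mp (⟨-1, by simp⟩)
      rw [← hi]
      exact h1 i
    have hF : ∀ d, (contactHypermap hV).f d ∈ S ↔ d ∈ S := by
      intro d
      rw [← hN, contactHypermap_f, ← hE d]
      simp
    obtain ⟨x, hx⟩ := hne
    ext y
    simp only [Set.mem_univ, iff_true]
    obtain ⟨g, hg, rfl⟩ := hT.biconnected.1.2 x y
    have key : ∀ d, g d ∈ S ↔ d ∈ S := by
      induction hg using Subgroup.closure_induction with
      | mem g hg =>
        simp only [Set.mem_insert_iff, Set.mem_singleton_iff] at hg
        rcases hg with rfl | rfl | rfl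
        · exact hE
        · exact hN
        · exact hF
      | one => simp
      | mul a b _ _ ha hb =>
        intro d
        rw [Equiv.Perm.mul_apply, ha, hb]
      | inv a _ ha =>
        intro d
        rw [← ha]
        simp
    exact (key x).mpr hx

end

namespace ContactMap

variable {D : Type} [Fintype D] {M : ContactMap D} {fc : ℕ → ℕ}

variable (M) in
/-- The number of darts at a point whose faces have a given property. -/
noncomputable def cnt (P : ℕ → Prop) [DecidablePred P] (v : Space) : ℕ :=
  (Finset.univ.filter fun d => M.pos d = v ∧ P (M.k d)).card

lemma card_pos_eq (d : D) : (Finset.univ.filter fun d' => M.pos d' = M.pos d).card = M.deg d := by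
  rw [deg, ← ncard_sameCycle, Set.ncard_eq_toFinset_card']
  congr 1
  ext y
  simp only [Finset.mem_filter, Finset.mem_univ, true_and, Set.mem_toFinset, Set.mem_ofPred_eq]
  refine ⟨fun h => M.same_node d y h.symm, fun h => ?_⟩
  obtain ⟨i, -, rfl⟩ := (sameCycle_iff_iterate _ _ _).mp h
  clear h
  induction i with
  | zero => rfl
  | succ i ih => rw [Function.iterate_succ_apply', M.pos_n, ih]

lemma card_filter_k_eq_sum (P : ℕ → Prop) [DecidablePred P] : (Finset.univ.filter fun d => P (M.k d)).card =
    ∑ v ∈ Finset.univ.image M.pos, M.cnt P v := by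
  rw [Finset.card_eq_sum_card_fiberwise (f := M.pos) (t := Finset.univ.image M.pos)
    (fun x _ => Finset.mem_coe.mpr (Finset.mem_image_of_mem _ (Finset.mem_univ x)))]
  apply Finset.sum_congr rfl
  intro v _
  rw [cnt, Finset.filter_filter]
  congr 1
  ext d
  simp [and_comm]

lemma card_eq_sum_deg : Fintype.card D =
    ∑ v ∈ Finset.univ.image M.pos, (Finset.univ.filter fun d => M.pos d = v).card := by
  have := M.card_filter_k_eq_sum (fun _ => True)
  simpa [cnt] using this

lemma IsTame.card_le (h : M.IsTame fc) : Fintype.card D ≤ 48 := by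
  rw [M.card_eq_sum_deg]
  calc _ ≤ ∑ v ∈ Finset.univ.image M.pos, 4 := by
        apply Finset.sum_le_sum
        intro v hv
        simp only [Finset.mem_image, Finset.mem_univ, true_and] at hv
        obtain ⟨d, rfl⟩ := hv
        rw [card_pos_eq]
        exact M.deg_le_four d
    _ = 48 := by simp [h.card_nodes]

/-- The face counts allowed by Euler's relation and the weight bound. There are at most `48` darts, as
a point has at most four contacts. -/
lemma IsTame.cases (h : M.IsTame fc) :
    (Fintype.card D = 48 ∧ (fc 3, fc 4, fc 5, fc 6, fc 7, fc 8) ∈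
      [(8, 6, 0, 0, 0, 0), (9, 4, 1, 0, 0, 0), (10, 2, 2, 0, 0, 0), (11, 0, 3, 0, 0, 0),
        (10, 3, 0, 1, 0, 0), (11, 1, 1, 1, 0, 0), (12, 0, 0, 2, 0, 0), (11, 2, 0, 0, 1, 0),
        (12, 0, 1, 0, 1, 0), (12, 1, 0, 0, 0, 1)]) ∨
    (Fintype.card D = 46 ∧ (fc 3, fc 4, fc 5, fc 6, fc 7, fc 8) ∈
      [(6, 7, 0, 0, 0, 0), (7, 5, 1, 0, 0, 0)]) := by
  have h1 := h.card_le
  have h2 := h.card_darts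
  have h3 := h.euler
  have h4 := h.weight
  generalize fc 3 = x3 at *
  generalize fc 4 = x4 at *
  generalize fc 5 = x5 at *
  generalize fc 6 = x6 at *
  generalize fc 7 = x7 at *
  generalize fc 8 = x8 at *
  generalize Fintype.card D = N at *
  -- the excess `w` of the face sizes over triangles is `20` minus the number of faces
  have hw : x4 + 2 * x5 + 3 * x6 + 4 * x7 + 5 * x8 = 6 ∨
      x4 + 2 * x5 + 3 * x6 + 4 * x7 + 5 * x8 = 7 := by omega
  have hc : x5 + 2 * x6 + 3 * x7 + 4 * x8 ≤ 4 := by omega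
  rcases hw with hw | hw
  · left
    have a5 : x5 ≤ 3 := by omega
    have a6 : x6 ≤ 2 := by omega
    have a7 : x7 ≤ 1 := by omega
    have a8 : x8 ≤ 1 := by omega
    obtain rfl : N = 48 := by omega
    refine ⟨rfl, ?_⟩
    obtain rfl : x4 = 6 - (2 * x5 + 3 * x6 + 4 * x7 + 5 * x8) := by omega
    obtain rfl : x3 = 8 + x5 + 2 * x6 + 3 * x7 + 4 * x8 := by omega
    interval_cases x5 <;> interval_cases x6 <;> interval_cases x7 <;> interval_cases x8 <;>
      first | decide | omega
  · right
    have a5 : x5 ≤ 1 := by omega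
    obtain rfl : x6 = 0 := by omega
    obtain rfl : x7 = 0 := by omega
    obtain rfl : x8 = 0 := by omega
    obtain rfl : N = 46 := by omega
    refine ⟨rfl, ?_⟩
    obtain rfl : x4 = 7 - 2 * x5 := by omega
    obtain rfl : x3 = 6 + x5 := by omega
    interval_cases x5 <;> decide

end ContactMap

/-! ### Local structure of contact maps -/

namespace ContactMap

variable {D : Type} [Fintype D] (M : ContactMap D)

/-- The terminal point of a dart. -/
def head (d : D) : Space := M.pos (M.e d)

/-- The inner product of the two contacts of `pos d` that bound the corner of `d`. -/
noncomputable def dot (d : D) : ℝ := ⟪M.head d, M.head (M.n d)⟫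

lemma head_e (d : D) : M.head (M.e d) = M.pos d := by rw [head, e_e]

lemma pos_e (d : D) : M.pos (M.e d) = M.head d := rfl

lemma pos_f (d : D) : M.pos (M.f d) = M.head d := by rw [← M.pos_n, n_f, pos_e]

lemma inner_head (d : D) : ⟪M.pos d, M.head d⟫ = 2 := M.contact d

lemma inner_head' (d : D) : ⟪M.head d, M.pos d⟫ = 2 := by rw [real_inner_comm, inner_head]

lemma norm_head (d : D) : ⟪M.head d, M.head d⟫ = 4 := M.norm _

lemma three_le_k (d : D) : 3 ≤ M.k d := M.three_le_face d

variable {M}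

lemma ext {d d' : D} (h1 : M.pos d = M.pos d') (h2 : M.head d = M.head d') : d = d' :=
  M.inj d d' h1 h2

lemma n_ne (d : D) : M.n d ≠ d := by
  intro h
  have h1 := M.two_le_deg d
  have h2 : Function.minimalPeriod M.n d = 1 := Function.minimalPeriod_eq_one_iff_isFixedPt.mpr h
  omega

lemma f_iterate_eq {d : D} {i : ℕ} (h : M.f^[i] d = d) : M.k d ∣ i :=
  Function.IsPeriodicPt.minimalPeriod_dvd h

lemma n_iterate_eq {d : D} {i : ℕ} (h : M.n^[i] d = d) : M.deg d ∣ i :=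
  Function.IsPeriodicPt.minimalPeriod_dvd h

lemma n2 {d : D} (h : M.deg d = 2) : M.n (M.n d) = d := by
  have := Function.iterate_minimalPeriod (f := M.n) (x := d)
  rw [show Function.minimalPeriod M.n d = 2 from h] at this
  exact this

lemma n3 {d : D} (h : M.deg d = 3) : M.n (M.n (M.n d)) = d := by
  have := Function.iterate_minimalPeriod (f := M.n) (x := d)
  rw [show Function.minimalPeriod M.n d = 3 from h] at this
  exact this

lemma n4 {d : D} (h : M.deg d = 4) : M.n (M.n (M.n (M.n d))) = d := by
  have := Function.iterate_minimalPeriod (f := M.n) (x := d)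
  rw [show Function.minimalPeriod M.n d = 4 from h] at this
  exact this

lemma nn_ne {d : D} (h : M.deg d ≠ 2) : M.n (M.n d) ≠ d := by
  intro h1
  have := Nat.le_of_dvd (by norm_num) (n_iterate_eq (i := 2) h1)
  have := M.two_le_deg d
  unfold deg at *
  omega

lemma nnn_ne {d : D} (h : M.deg d = 4) : M.n (M.n (M.n d)) ≠ d := by
  intro h1
  have := n_iterate_eq (i := 3) h1
  rw [h] at this
  omega

lemma deg_cases (d : D) : M.deg d = 2 ∨ M.deg d = 3 ∨ M.deg d = 4 := by
  have := M.two_le_deg d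
  have := M.deg_le_four d
  unfold deg
  omega

lemma deg_eq_of_pos {d d' : D} (h : M.pos d = M.pos d') : M.deg d = M.deg d' :=
  minimalPeriod_sameCycle (M.same_node d d' h)

lemma f3 {d : D} (h : M.k d = 3) : M.f (M.f (M.f d)) = d := by
  have := Function.iterate_minimalPeriod (f := M.f) (x := d)
  rw [show Function.minimalPeriod M.f d = 3 from h] at this
  exact this

lemma f4 {d : D} (h : M.k d = 4) : M.f (M.f (M.f (M.f d))) = d := by
  have := Function.iterate_minimalPeriod (f := M.f) (x := d)
  rw [show Function.minimalPeriod M.f d = 4 from h] at this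
  exact this

lemma f5 {d : D} (h : M.k d = 5) : M.f (M.f (M.f (M.f (M.f d)))) = d := by
  have := Function.iterate_minimalPeriod (f := M.f) (x := d)
  rw [show Function.minimalPeriod M.f d = 5 from h] at this
  exact this

lemma f6 {d : D} (h : M.k d = 6) : M.f (M.f (M.f (M.f (M.f (M.f d))))) = d := by
  have := Function.iterate_minimalPeriod (f := M.f) (x := d)
  rw [show Function.minimalPeriod M.f d = 6 from h] at this
  exact this

/-- Distinct darts of a face have distinct initial points. -/
lemma pos_f_iterate_ne {d : D} {i : ℕ} (h0 : 0 < i) (h : i < M.k d) :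
    M.pos (M.f^[i] d) ≠ M.pos d := by
  intro h1
  have h2 := M.simple d (M.f^[i] d) ⟨i, by rw [zpow_natCast, Equiv.Perm.coe_pow]; rfl⟩ h1.symm
  exact absurd (Nat.le_of_dvd h0 (f_iterate_eq h2.symm)) (by omega)

lemma head_ne_pos (d : D) : M.head d ≠ M.pos d := by
  rw [← pos_f]
  exact pos_f_iterate_ne (i := 1) one_pos (by have := M.three_le_k d; omega)

lemma head_n_ne (d : D) : M.head (M.n d) ≠ M.head d :=
  fun h => n_ne d (ext (M.pos_n d) h)

lemma head_nn_ne {d : D} (h : M.deg d ≠ 2) : M.head (M.n (M.n d)) ≠ M.head d :=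
  fun h1 => nn_ne h (ext (by rw [M.pos_n, M.pos_n]) h1)

/-! ### Triangles -/

lemma ff_tri {d : D} (h : M.k d = 3) : M.f (M.f d) = M.e (M.n d) := by
  apply M.f.injective
  rw [f3 h, f_e_n]

/-- The apex of a triangle, seen from both ends of the opposite edge. -/
lemma tri_head {d : D} (h : M.k d = 3) : M.head (M.n (M.e (M.n d))) = M.head d := by
  have h1 : M.f d = M.e (M.n (M.e (M.n d))) := by
    apply M.f.injective
    rw [ff_tri h, f_e_n]
  rw [head, ← h1, pos_f]

lemma tri_head_f {d : D} (h : M.k d = 3) : M.head (M.f d) = M.head (M.n d) := by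
  rw [← pos_f, ff_tri h, pos_e]

lemma dot_tri {d : D} (h : M.k d = 3) : M.dot d = 2 := by
  rw [dot, ← tri_head_f h, ← M.pos_f d]
  exact M.inner_head _

/-! ### Quadrilaterals -/

lemma fff_quad {d : D} (h : M.k d = 4) : M.f (M.f (M.f d)) = M.e (M.n d) := by
  apply M.f.injective
  rw [f4 h, f_e_n]

/-- The opposite vertex of a quadrilateral touches the two neighbours. -/
lemma quad_inner {d : D} (h : M.k d = 4) :
    ⟪M.head d, M.head (M.f d)⟫ = 2 ∧ ⟪M.head (M.f d), M.head (M.n d)⟫ = 2 ∧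
      M.pos d ≠ M.head (M.f d) := by
  refine ⟨?_, ?_, ?_⟩
  · rw [← M.pos_f d]
    exact M.inner_head _
  · have h1 := M.inner_head (M.f (M.f d))
    rw [pos_f, ← pos_f (M := M) (M.f (M.f d)), fff_quad h] at h1
    exact h1
  · rw [← pos_f (M := M) (M.f d)]
    exact (pos_f_iterate_ne (i := 2) two_pos (by omega)).symm

lemma dot_f (d : D) : M.dot (M.f d) = ⟪M.head (M.f d), M.pos d⟫ := by
  rw [dot, n_f, head_e]

lemma quad_mul {d : D} (h : M.k d = 4) : (4 + M.dot d) * (4 + M.dot (M.f d)) = 16 := by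
  obtain ⟨h1, h2, h3⟩ := quad_inner h
  rw [dot_f, mul_comm, real_inner_comm]
  exact rhombus (M.norm d) (M.norm_head d) (M.norm_head _) (M.norm_head _) (M.inner_head d) h1 h2
    (by rw [← M.pos_n d]; exact M.inner_head _) h3 (head_n_ne d).symm

/-! ### The darts at a point -/

lemma pos_eq_iff {d d' : D} : M.pos d' = M.pos d ↔ ∃ i < M.deg d, M.n^[i] d = d' := by
  constructor
  · intro h
    exact (sameCycle_iff_iterate _ _ _).mp (M.same_node d d' h.symm)
  · rintro ⟨i, -, rfl⟩
    induction i with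
    | zero => rfl
    | succ i ih => rw [Function.iterate_succ_apply', M.pos_n, ih]

lemma filter_pos (d : D) : (Finset.univ.filter fun d' => M.pos d' = M.pos d) =
    (Finset.range (M.deg d)).image fun i => M.n^[i] d := by
  ext d'
  simp [pos_eq_iff]

lemma sum_pos (d : D) (g : D → ℕ) : ∑ d' with M.pos d' = M.pos d, g d' =
    ∑ i ∈ Finset.range (M.deg d), g (M.n^[i] d) := by
  rw [filter_pos, Finset.sum_image]
  intro i hi j hj hij
  simp only [Finset.coe_range, Set.mem_Iio] at hi hj
  exact Function.iterate_injOn_Iio_minimalPeriod hi hj hij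

lemma card_pos_and (d : D) (P : D → Prop) [DecidablePred P] :
    (Finset.univ.filter fun d' => M.pos d' = M.pos d ∧ P d').card =
      ∑ i ∈ Finset.range (M.deg d), if P (M.n^[i] d) then 1 else 0 := by
  rw [← sum_pos d fun x => if P x then 1 else 0, Finset.sum_boole, Finset.filter_filter]
  simp

lemma card_pos_and_four {d : D} (h : M.deg d = 4) (P : D → Prop) [DecidablePred P] :
    (Finset.univ.filter fun d' => M.pos d' = M.pos d ∧ P d').card =
      (if P d then 1 else 0) + (if P (M.n d) then 1 else 0) + (if P (M.n (M.n d)) then 1 else 0) +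
        (if P (M.n (M.n (M.n d))) then 1 else 0) := by
  rw [card_pos_and, h]
  simp only [Finset.sum_range_succ, Finset.sum_range_zero, zero_add]
  rfl

lemma card_pos_and_three {d : D} (h : M.deg d = 3) (P : D → Prop) [DecidablePred P] :
    (Finset.univ.filter fun d' => M.pos d' = M.pos d ∧ P d').card =
      (if P d then 1 else 0) + (if P (M.n d) then 1 else 0) +
        (if P (M.n (M.n d)) then 1 else 0) := by
  rw [card_pos_and, h]
  simp only [Finset.sum_range_succ, Finset.sum_range_zero, zero_add]
  rfl

lemma card_pos_and_two {d : D} (h : M.deg d = 2) (P : D → Prop) [DecidablePred P] :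
    (Finset.univ.filter fun d' => M.pos d' = M.pos d ∧ P d').card =
      (if P d then 1 else 0) + (if P (M.n d) then 1 else 0) := by
  rw [card_pos_and, h]
  simp only [Finset.sum_range_succ, Finset.sum_range_zero, zero_add]
  rfl

lemma forall_pos_four {d : D} (h : M.deg d = 4) (P : D → Prop) :
    (∀ d', M.pos d' = M.pos d → P d') ↔
      P d ∧ P (M.n d) ∧ P (M.n (M.n d)) ∧ P (M.n (M.n (M.n d))) := by
  constructor
  · intro h1
    exact ⟨h1 _ rfl, h1 _ (M.pos_n _), h1 _ (by rw [M.pos_n, M.pos_n]),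
      h1 _ (by rw [M.pos_n, M.pos_n, M.pos_n])⟩
  · rintro ⟨h0, h1, h2, h3⟩ d' hd
    obtain ⟨i, hi, rfl⟩ := pos_eq_iff.mp hd
    rw [h] at hi
    interval_cases i
    exacts [h0, h1, h2, h3]

lemma forall_pos_two {d : D} (h : M.deg d = 2) (P : D → Prop) :
    (∀ d', M.pos d' = M.pos d → P d') ↔ P d ∧ P (M.n d) := by
  constructor
  · intro h1
    exact ⟨h1 _ rfl, h1 _ (M.pos_n _)⟩
  · rintro ⟨h0, h1⟩ d' hd
    obtain ⟨i, hi, rfl⟩ := pos_eq_iff.mp hd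
    rw [h] at hi
    interval_cases i
    exacts [h0, h1]

/-! ### Points with three triangles and one larger face -/

/-- The point of `d` has three triangular faces besides the face of `d`. -/
def IsTTT (d : D) : Prop :=
  M.deg d = 4 ∧ M.k (M.n d) = 3 ∧ M.k (M.n (M.n d)) = 3 ∧ M.k (M.n (M.n (M.n d))) = 3

lemma inner_head_n (d : D) : ⟪M.pos d, M.head (M.n d)⟫ = 2 := by
  rw [← M.pos_n d]
  exact M.inner_head _

lemma inner_head_nn (d : D) : ⟪M.pos d, M.head (M.n (M.n d))⟫ = 2 := by
  rw [← M.pos_n d]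
  exact M.inner_head_n _

lemma inner_head_nnn (d : D) : ⟪M.pos d, M.head (M.n (M.n (M.n d)))⟫ = 2 := by
  rw [← M.pos_n d]
  exact M.inner_head_nn _

/-- Two consecutive triangles at a point: their outer vertices are mirror images in the plane of the
common edge. -/
lemma apex_nn {d : D} (h : M.deg d ≠ 2) (h0 : M.k d = 3) (h1 : M.k (M.n d) = 3) :
    M.head (M.n (M.n d)) = (2 / 3 : ℝ) • (M.pos d + M.head (M.n d)) - M.head d :=
  apex_eq (M.norm d) (M.norm_head _) (M.norm_head _) (M.norm_head _) (M.inner_head_n d)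
    (M.inner_head d) (by rw [real_inner_comm]; exact dot_tri h0) (M.inner_head_nn d) (dot_tri h1)
    (head_nn_ne h).symm

/-- Three consecutive triangles determine the fourth contact. -/
lemma IsTTT.head_nnn {d : D} (h : M.IsTTT d) : M.head (M.n (M.n (M.n d))) =
    (2 : ℝ) • M.pos d - (9 / 5 : ℝ) • M.head (M.n d) - (6 / 5 : ℝ) • M.head d := by
  obtain ⟨h4, h1, h2, h3⟩ := h
  have h4' : M.deg (M.n d) ≠ 2 := by rw [deg_n]; omega
  have h4'' : M.deg (M.n (M.n d)) ≠ 2 := by rw [deg_n, deg_n]; omega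
  have e1 := apex_nn h4' h1 h2
  have e2 := apex_nn h4'' h2 h3
  rw [n4 h4, M.pos_n, M.pos_n] at e2
  rw [M.pos_n] at e1
  have e3 : M.head (M.n (M.n d)) = (3 / 2 : ℝ) • (M.head (M.n (M.n (M.n d))) + M.head (M.n d))
      - M.pos d := by
    rw [e1]
    module
  rw [e3] at e2
  have e4 : M.head d = (5 / 3 : ℝ) • M.pos d - (5 / 6 : ℝ) • M.head (M.n (M.n (M.n d)))
      - (3 / 2 : ℝ) • M.head (M.n d) := by
    nth_rewrite 1 [e2]
    module
  rw [e4]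
  module

lemma IsTTT.head_nn {d : D} (h : M.IsTTT d) : M.head (M.n (M.n d)) =
    (2 : ℝ) • M.pos d - (9 / 5 : ℝ) • M.head d - (6 / 5 : ℝ) • M.head (M.n d) := by
  have e3 := h.head_nnn
  obtain ⟨h4, h1, h2, h3⟩ := h
  have h4' : M.deg (M.n d) ≠ 2 := by rw [deg_n]; omega
  have e1 := apex_nn h4' h1 h2
  rw [M.pos_n, e3] at e1
  have e2 : (2 / 3 : ℝ) • M.head (M.n (M.n d)) = (2 / 3 : ℝ) • ((2 : ℝ) • M.pos d
      - (9 / 5 : ℝ) • M.head d - (6 / 5 : ℝ) • M.head (M.n d)) + (0 : ℝ) • M.pos d := by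
    have : (2 / 3 : ℝ) • M.head (M.n (M.n d)) =
      (2 / 3 : ℝ) • (M.pos d + M.head (M.n (M.n d))) - M.head (M.n d)
        - (2 / 3 : ℝ) • M.pos d + M.head (M.n d) := by module
    rw [this, ← e1]
    module
  have e4 := congrArg (fun x => (3 / 2 : ℝ) • x) e2
  simp only [smul_add, smul_smul] at e4
  norm_num at e4
  rw [e4]

lemma IsTTT.dot_eq {d : D} (h : M.IsTTT d) : M.dot d = -14 / 9 := by
  have h1 := congrArg (fun x => ⟪M.head d, x⟫) h.head_nnn
  simp only [inner_sub_right, inner_smul_right] at h1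
  have h2 : M.dot (M.n (M.n (M.n d))) = 2 := dot_tri h.2.2.2
  rw [dot, n4 h.1, real_inner_comm] at h2
  rw [h2, M.inner_head', M.norm_head] at h1
  unfold dot
  linarith

lemma nnn_eq {d : D} (h : M.deg d = 4) {y : D} (hy : M.n y = d) : M.n (M.n (M.n d)) = y := by
  apply M.n.injective
  rw [n4 h, hy]

/-- The apex of the triangle on the right of a dart, seen from both ends. -/
lemma apex_across {d : D} (h : M.deg d = 4) (hk : M.k (M.n (M.n (M.n d))) = 3) :
    M.head (M.n (M.n (M.f d))) = M.head (M.n (M.n (M.n d))) := by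
  rw [n_f, ← tri_head hk, n4 h]

/-- Two consecutive points of a face with three triangles each: the next point of the face lies in
the plane of the previous three. -/
lemma IsTTT.next {d : D} (h : M.IsTTT d) (h' : M.IsTTT (M.f d)) :
    M.head (M.f d) = M.head (M.n d) + (16 / 9 : ℝ) • (M.head d - M.pos d) := by
  have e1 := h.head_nnn
  have e2 := h'.head_nn
  rw [apex_across h.1 h.2.2.2, e1, n_f, head_e, pos_f] at e2
  have e3 : (9 / 5 : ℝ) • M.head (M.f d) =
      (9 / 5 : ℝ) • (M.head (M.n d) + (16 / 9 : ℝ) • (M.head d - M.pos d)) := by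
    have : (9 / 5 : ℝ) • M.head (M.f d) = (2 : ℝ) • M.head d - (6 / 5 : ℝ) • M.pos d -
        ((2 : ℝ) • M.head d - (9 / 5 : ℝ) • M.head (M.f d) - (6 / 5 : ℝ) • M.pos d) := by module
    rw [this, ← e2]
    module
  exact smul_right_injective Space (by norm_num : (9 / 5 : ℝ) ≠ 0) e3

/-- Two contacts of a common point are not further apart than in a straight angle. -/
lemma neg_two_le_inner {a b c : Space} (ha : ⟪a, a⟫ = 4) (hb : ⟪b, b⟫ = 4) (hc : ⟪c, c⟫ = 4)
    (hab : ⟪a, b⟫ = 2) (hbc : ⟪b, c⟫ = 2) : -2 ≤ ⟪a, c⟫ := by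
  have h := real_inner_self_nonneg (x := a + c - b)
  simp only [inner_sub_left, inner_sub_right, inner_add_left, inner_add_right] at h
  rw [real_inner_comm a c, real_inner_comm b c, real_inner_comm a b] at h
  have := real_inner_comm a b
  have := real_inner_comm c b
  have := real_inner_comm c a
  linarith

lemma neg_two_le_dot (d : D) : -2 ≤ M.dot d :=
  neg_two_le_inner (M.norm_head d) (M.norm d) (M.norm_head _) (M.inner_head' d) (M.inner_head_n d)

lemma dot_eq_inner (d : D) : M.dot (M.f d) = ⟪M.pos d, M.head (M.f d)⟫ := by
  rw [dot, n_f, head_e, real_inner_comm]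

/-- The relation between the angle at a vertex of a pentagon and the angles at the ends of the
opposite edge. -/
lemma pent_chain {d : D} (h : M.k d = 5) :
    chainDet (M.dot d) (M.dot (M.f (M.f d))) (M.dot (M.f (M.f (M.f d)))) = 0 := by
  have h5 := f5 h
  have h4 : M.f (M.f (M.f (M.f d))) = M.e (M.n d) := by
    apply M.f.injective
    rw [h5, f_e_n]
  have e1 : M.head (M.f (M.f (M.f d))) = M.head (M.n d) := by
    rw [← pos_f, h4, pos_e]
  have i1 := M.inner_head (M.f d)
  have i2 := M.inner_head (M.f (M.f d))
  have i3 := M.inner_head (M.f (M.f (M.f d)))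
  rw [pos_f] at i1 i2 i3
  rw [e1] at i3
  have := chainDet_eq_zero (M.norm_head d) (M.norm_head (M.f d)) (M.norm_head (M.f (M.f d)))
    (M.norm_head (M.n d)) i1 i2 i3
  rw [dot_eq_inner, dot_eq_inner, pos_f, pos_f, e1]
  exact this

/-- Consecutive points of a pentagon do not both have three triangles. -/
lemma IsTTT.not_next_pent {d : D} (hk : M.k d = 5) (h : M.IsTTT d) : ¬ M.IsTTT (M.f d) := by
  intro h'
  -- the angle opposite to the edge from `d` to `f d`
  set x := M.f (M.f (M.f d)) with hx
  have h5 := f5 hk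
  have hkx : M.k x = 5 := by rw [hx, k_f, k_f, k_f, hk]
  have h1 := pent_chain hkx
  rw [hx, h5, h.dot_eq, h'.dot_eq] at h1
  exact chain_three_triangles_false h1 (neg_two_le_dot _)

/-- Not all points of a hexagon have three triangles: the recursion for consecutive points then
makes two points of the hexagon coincide. -/
lemma exists_not_TTT_hex {d : D} (hk : M.k d = 6) : ∃ i, ¬ M.IsTTT (M.f^[i] d) := by
  by_contra hc
  push Not at hc
  have h6 := f6 hk
  have a0 := (hc 0).next (hc 1)
  have a1 := (hc 1).next (hc 2)
  have a2 := (hc 2).next (hc 3)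
  have a3 := (hc 3).next (hc 4)
  have a4 := (hc 4).next (hc 5)
  simp only [Function.iterate_succ_apply', Function.iterate_zero, id_eq] at a0 a1 a2 a3 a4
  rw [n_f, head_e, pos_f] at a1 a2 a3 a4
  have e5 : M.f (M.f (M.f (M.f (M.f d)))) = M.e (M.n d) := by
    apply M.f.injective
    rw [h6, f_e_n]
  have e5' : M.head (M.f (M.f (M.f (M.f d)))) = M.head (M.n d) := by
    rw [← pos_f, e5, pos_e]
  have e6 : M.head (M.f (M.f (M.f (M.f (M.f d))))) = M.pos d := by
    rw [← pos_f, h6]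
  rw [pos_f] at a2 a3 a4
  rw [e5'] at a3
  rw [e6, e5'] at a4
  have hne : M.head (M.f (M.f d)) ≠ M.head d := by
    have := pos_f_iterate_ne (M := M) (d := M.f d) (i := 2) two_pos (by rw [k_f]; omega)
    simp only [Function.iterate_succ_apply', Function.iterate_zero, id_eq] at this
    rwa [pos_f, pos_f] at this
  apply hne
  generalize M.head (M.f (M.f (M.f d))) = v4 at *
  generalize M.head (M.f (M.f d)) = v3 at *
  generalize M.head (M.f d) = v2 at *
  generalize M.head (M.n d) = v5 at *
  generalize M.head d = v1 at *
  generalize M.pos d = v0 at *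
  linear_combination (norm := module) (9 / 2 : ℝ) • a1 + (9 / 2 : ℝ) • a2 + (81 / 32 : ℝ) • (a0 + a3)

end ContactMap

namespace ContactMap

variable {D : Type} [Fintype D] {M : ContactMap D} {fc : ℕ → ℕ}

/-! ### Counting around the points -/

lemma cnt_pos (P : ℕ → Prop) [DecidablePred P] (d : D) : M.cnt P (M.pos d) =
    (Finset.univ.filter fun d' => M.pos d' = M.pos d ∧ P (M.k d')).card := rfl

lemma type_mem (d : D) (h : ∀ d', M.pos d' = M.pos d → M.k d' ≤ 4) :
    (M.cnt (· = 3) (M.pos d), M.cnt (· = 4) (M.pos d)) ∈ [(0, 3), (1, 3), (2, 2)] :=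
  M.type d h

/-- A face size up to the distinction of the sizes beyond four. -/
def kind (k : ℕ) : Fin 3 := if k = 3 then 0 else if k = 4 then 1 else 2

lemma kind_eq_zero {k : ℕ} : kind k = 0 ↔ k = 3 := by
  unfold kind; split_ifs <;> simp_all

lemma kind_eq_one {k : ℕ} : kind k = 1 ↔ k = 4 := by
  unfold kind; split_ifs <;> simp_all

lemma kind_eq_two {k : ℕ} (h : 3 ≤ k) : kind k = 2 ↔ 5 ≤ k := by
  unfold kind; split_ifs <;> simp <;> omega

lemma four_faces_count : ∀ a b c d : Fin 3,
    ((a ≠ 2 → b ≠ 2 → c ≠ 2 → d ≠ 2 → 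
      2 ≤ (if a = 1 then 1 else 0) + (if b = 1 then 1 else 0) + (if c = 1 then 1 else 0) +
        (if d = 1 then 1 else 0)) →
    2 + ((if a = 2 ∧ ¬ (b = 0 ∧ c = 0 ∧ d = 0) then 1 else 0) +
      (if b = 2 ∧ ¬ (c = 0 ∧ d = 0 ∧ a = 0) then 1 else 0) +
      (if c = 2 ∧ ¬ (d = 0 ∧ a = 0 ∧ b = 0) then 1 else 0) +
      (if d = 2 ∧ ¬ (a = 0 ∧ b = 0 ∧ c = 0) then 1 else 0)) ≤
    ((if a = 1 then 1 else 0) + (if b = 1 then 1 else 0) + (if c = 1 then 1 else 0) +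
        (if d = 1 then 1 else 0)) +
    2 * ((if a = 2 then 1 else 0) + (if b = 2 then 1 else 0) + (if c = 2 then 1 else 0) +
        (if d = 2 then 1 else 0))) := by
  decide

lemma IsTTT_iff {d : D} (h : M.deg d = 4) : M.IsTTT d ↔ kind (M.k (M.n d)) = 0 ∧
    kind (M.k (M.n (M.n d))) = 0 ∧ kind (M.k (M.n (M.n (M.n d)))) = 0 := by
  simp only [IsTTT, h, true_and, kind_eq_zero]

/-- At a point with four contacts, the quadrilaterals and the large faces outnumber the large faces
that are not accompanied by three triangles. -/
lemma four_contacts_count {d : D} (h : M.deg d = 4) :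
    2 + (Finset.univ.filter fun d' => M.pos d' = M.pos d ∧ (5 ≤ M.k d' ∧ ¬ M.IsTTT d')).card ≤
      M.cnt (· = 4) (M.pos d) + 2 * M.cnt (5 ≤ ·) (M.pos d) := by
  have h1 : M.deg (M.n d) = 4 := by rw [deg_n, h]
  have h2 : M.deg (M.n (M.n d)) = 4 := by rw [deg_n, h1]
  have h3 : M.deg (M.n (M.n (M.n d))) = 4 := by rw [deg_n, h2]
  rw [cnt_pos, cnt_pos, card_pos_and_four h, card_pos_and_four h, card_pos_and_four h]
  simp only [IsTTT_iff h, IsTTT_iff h1, IsTTT_iff h2, IsTTT_iff h3, n4 h, ← kind_eq_one,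
    ← kind_eq_two (M.three_le_k _)]
  apply four_faces_count
  intro k0 k1 k2 k3
  have hle : ∀ x, kind (M.k x) ≠ 2 → M.k x ≤ 4 := by
    intro x hx
    rw [Ne, kind_eq_two (M.three_le_k x)] at hx
    omega
  have ht := type_mem d ((forall_pos_four h _).mpr ⟨hle _ k0, hle _ k1, hle _ k2, hle _ k3⟩)
  have hq : 2 ≤ M.cnt (· = 4) (M.pos d) := by
    simp only [List.mem_cons, Prod.mk.injEq, List.not_mem_nil, or_false] at ht
    omega
  rw [cnt_pos, card_pos_and_four h] at hq
  simpa only [← kind_eq_one] using hq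

lemma IsTame.deg_eq_four (h : M.IsTame fc) (hD : Fintype.card D = 48) (d : D) : M.deg d = 4 := by
  by_contra hc
  have h1 := M.card_eq_sum_deg
  have h2 : ∑ v ∈ Finset.univ.image M.pos, (Finset.univ.filter fun d => M.pos d = v).card <
      ∑ v ∈ Finset.univ.image M.pos, 4 := by
    apply Finset.sum_lt_sum
    · intro v hv
      simp only [Finset.mem_image, Finset.mem_univ, true_and] at hv
      obtain ⟨x, rfl⟩ := hv
      rw [card_pos_eq]
      exact M.deg_le_four x
    · refine ⟨M.pos d, Finset.mem_image_of_mem _ (Finset.mem_univ _), ?_⟩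
      rw [card_pos_eq]
      exact lt_of_le_of_ne (M.deg_le_four d) hc
  rw [← h1, hD, Finset.sum_const, h.card_nodes] at h2
  simp at h2

lemma card_filter_and_eq_sum (P : D → Prop) [DecidablePred P] : (Finset.univ.filter fun d => P d).card =
    ∑ v ∈ Finset.univ.image M.pos, (Finset.univ.filter fun d => M.pos d = v ∧ P d).card := by
  rw [Finset.card_eq_sum_card_fiberwise (f := M.pos) (t := Finset.univ.image M.pos)
    (fun x _ => Finset.mem_coe.mpr (Finset.mem_image_of_mem _ (Finset.mem_univ x)))]
  apply Finset.sum_congr rfl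
  intro v _
  rw [Finset.filter_filter]
  congr 1
  ext d
  simp [and_comm]

lemma IsTame.card_five_le (h : M.IsTame fc) : (Finset.univ.filter fun d => 5 ≤ M.k d).card =
    5 * fc 5 + 6 * fc 6 + 7 * fc 7 + 8 * fc 8 := by
  have h1 : (Finset.univ.filter fun d => 5 ≤ M.k d).card = ∑ m ∈ Finset.Icc 5 8,
      (Finset.univ.filter fun d => M.k d = m).card := by
    rw [Finset.card_eq_sum_card_fiberwise (f := M.k) (t := Finset.Icc 5 8)
      (fun x hx => by
        simp only [Finset.coe_filter, Finset.mem_univ, true_and] at hx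
        simp only [Finset.coe_Icc, Set.mem_Icc]
        exact ⟨hx, h.k_le x⟩)]
    apply Finset.sum_congr rfl
    intro m hm
    rw [Finset.filter_filter]
    congr 1
    ext d
    simp only [Finset.mem_Icc] at hm
    simp only [Finset.mem_filter, Finset.mem_univ, true_and]
    constructor
    · exact fun h => h.2
    · exact fun h => ⟨by omega, h⟩
  rw [h1]
  simp [Finset.sum_Icc_succ_top, h.card_k]

/-- The previous inequality, summed over the twelve points. -/
lemma IsTame.count_not_TTT (h : M.IsTame fc) (hD : Fintype.card D = 48) :
    24 + (Finset.univ.filter fun d => 5 ≤ M.k d ∧ ¬ M.IsTTT d).card ≤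
      4 * fc 4 + 2 * (5 * fc 5 + 6 * fc 6 + 7 * fc 7 + 8 * fc 8) := by
  rw [← h.card_five_le, ← h.card_k 4, M.card_filter_and_eq_sum, M.card_filter_k_eq_sum (· = 4),
    M.card_filter_k_eq_sum (5 ≤ ·), Finset.mul_sum, ← Finset.sum_add_distrib]
  have h1 : (24 : ℕ) = ∑ v ∈ Finset.univ.image M.pos, 2 := by
    rw [Finset.sum_const, h.card_nodes]; rfl
  rw [h1, ← Finset.sum_add_distrib]
  apply Finset.sum_le_sum
  intro v hv
  simp only [Finset.mem_image, Finset.mem_univ, true_and] at hv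
  obtain ⟨x, rfl⟩ := hv
  exact four_contacts_count (h.deg_eq_four hD x)

/-- At least half of the darts of the pentagons are not accompanied by three triangles. -/
lemma IsTame.pent_not_TTT (h : M.IsTame fc) :
    5 * fc 5 ≤ 2 * (Finset.univ.filter fun d => M.k d = 5 ∧ ¬ M.IsTTT d).card := by
  have h1 : (Finset.univ.filter fun d => M.k d = 5 ∧ M.IsTTT d).card ≤
      (Finset.univ.filter fun d => M.k d = 5 ∧ ¬ M.IsTTT d).card := by
    apply Finset.card_le_card_of_injOn M.f
    · intro d hd
      simp only [Finset.coe_filter, Finset.mem_univ, true_and, Set.mem_ofPred_eq] at hd ⊢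
      exact ⟨by rw [k_f, hd.1], hd.2.not_next_pent hd.1⟩
    · exact M.f.injective.injOn
  have h2 := Finset.card_filter_add_card_filter_not (s := Finset.univ.filter fun d => M.k d = 5)
    (fun d => M.IsTTT d)
  rw [Finset.filter_filter, Finset.filter_filter, h.card_k 5] at h2
  omega

lemma IsTame.exists_hex_not_TTT (h : M.IsTame fc) (h6 : fc 6 ≠ 0) :
    1 ≤ (Finset.univ.filter fun d => M.k d = 6 ∧ ¬ M.IsTTT d).card := by
  have h1 : 0 < (Finset.univ.filter fun d => M.k d = 6).card := by
    rw [h.card_k 6]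
    omega
  obtain ⟨d, hd⟩ := Finset.card_pos.mp h1
  simp only [Finset.mem_filter, Finset.mem_univ, true_and] at hd
  obtain ⟨i, hi⟩ := exists_not_TTT_hex hd
  apply Finset.card_pos.mpr
  refine ⟨M.f^[i] d, ?_⟩
  simp only [Finset.mem_filter, Finset.mem_univ, true_and]
  refine ⟨?_, hi⟩
  clear hi
  induction i with
  | zero => exact hd
  | succ i ih => rw [Function.iterate_succ_apply', k_f, ih]

lemma card_not_TTT_add_le :
    (Finset.univ.filter fun d => M.k d = 5 ∧ ¬ M.IsTTT d).card +
      (Finset.univ.filter fun d => M.k d = 6 ∧ ¬ M.IsTTT d).card ≤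
      (Finset.univ.filter fun d => 5 ≤ M.k d ∧ ¬ M.IsTTT d).card := by
  rw [← Finset.card_union_of_disjoint]
  · apply Finset.card_le_card
    intro d
    simp only [Finset.mem_union, Finset.mem_filter, Finset.mem_univ, true_and]
    rintro (⟨h1, h2⟩ | ⟨h1, h2⟩) <;> exact ⟨by omega, h2⟩
  · rw [Finset.disjoint_left]
    intro d
    simp only [Finset.mem_filter, Finset.mem_univ, true_and]
    omega

lemma k_le_four_of_count (h : M.IsTame fc) (h5 : fc 5 = 0) (h6 : fc 6 = 0) (h7 : fc 7 = 0)
    (h8 : fc 8 = 0) (d : D) : M.k d = 3 ∨ M.k d = 4 := by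
  have h1 := h.card_five_le
  rw [h5, h6, h7, h8] at h1
  simp only [mul_zero, add_zero, Finset.card_eq_zero, Finset.filter_eq_empty_iff] at h1
  have h2 := h1 (Finset.mem_univ d)
  have := M.three_le_k d
  omega

/-- With the maximal number of contacts, there are no large faces. -/
lemma IsTame.faces_of_card_eq (h : M.IsTame fc) (hD : Fintype.card D = 48) :
    fc 3 = 8 ∧ fc 4 = 6 ∧ fc 5 = 0 ∧ fc 6 = 0 ∧ fc 7 = 0 ∧ fc 8 = 0 := by
  have h1 := h.count_not_TTT hD
  have h2 := h.pent_not_TTT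
  have h3 := h.exists_hex_not_TTT
  have h4 := card_not_TTT_add_le (M := M)
  rcases h.cases with ⟨-, h5⟩ | ⟨h5, -⟩
  · simp only [List.mem_cons, Prod.mk.injEq, List.not_mem_nil, or_false] at h5
    by_cases h6 : fc 6 = 0
    · omega
    · have h7 := h3 h6
      omega
  · omega

/-- With the maximal number of contacts, each point has two triangles and two quadrilaterals. -/
lemma IsTame.cnt_eq_two (h : M.IsTame fc) (hD : Fintype.card D = 48) (d : D) :
    M.cnt (· = 3) (M.pos d) = 2 ∧ M.cnt (· = 4) (M.pos d) = 2 := by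
  obtain ⟨-, h4, h5, h6, h7, h8⟩ := h.faces_of_card_eq hD
  have hk := k_le_four_of_count h h5 h6 h7 h8
  have ht : ∀ d, (M.cnt (· = 3) (M.pos d) = 1 ∧ M.cnt (· = 4) (M.pos d) = 3) ∨
      (M.cnt (· = 3) (M.pos d) = 2 ∧ M.cnt (· = 4) (M.pos d) = 2) := by
    intro d
    have h1 := type_mem (M := M) d fun d' _ => by have := hk d'; omega
    have h2 : M.cnt (· = 3) (M.pos d) + M.cnt (· = 4) (M.pos d) = 4 := by
      rw [cnt_pos, cnt_pos, card_pos_and_four (h.deg_eq_four hD d),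
        card_pos_and_four (h.deg_eq_four hD d)]
      rcases hk d with a | a <;> rcases hk (M.n d) with b | b <;>
        rcases hk (M.n (M.n d)) with c | c <;> rcases hk (M.n (M.n (M.n d))) with e | e <;>
        simp [a, b, c, e]
    simp only [List.mem_cons, Prod.mk.injEq, List.not_mem_nil, or_false] at h1
    omega
  have h1 : ∑ v ∈ Finset.univ.image M.pos, 2 = ∑ v ∈ Finset.univ.image M.pos, M.cnt (· = 4) v := by
    rw [← M.card_filter_k_eq_sum, h.card_k 4, h4, Finset.sum_const, h.card_nodes]
    rfl
  have h2 := (Finset.sum_eq_sum_iff_of_le (fun v hv => by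
    simp only [Finset.mem_image, Finset.mem_univ, true_and] at hv
    obtain ⟨x, rfl⟩ := hv
    have := ht x
    omega)).mp h1 (M.pos d) (Finset.mem_image_of_mem _ (Finset.mem_univ _))
  have := ht d
  omega

end ContactMap

/-! ### Recognition of a contact map from a table -/

/-- A dart of a map with twelve nodes of degree four: a node and a place in the cyclic order. -/
abbrev Slot : Type := Fin 12 × Fin 4

/-- The next dart around the node. -/
def Slot.succ (x : Slot) : Slot := (x.1, x.2 + 1)

/-- The previous dart around the node. -/
def Slot.pred (x : Slot) : Slot := (x.1, x.2 + 3)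

lemma Slot.succ_pred (x : Slot) : x.pred.succ = x := by
  obtain ⟨i, s⟩ := x
  simp only [pred, succ, Prod.mk.injEq, true_and]
  revert s
  decide

/-- A map with twelve nodes of degree four: the neighbour of each node in each place of the cyclic
order, the place of the node among the neighbours of that neighbour, and the size of the face. -/
structure MapTable where
  nb : Fin 12 → Fin 4 → Fin 12
  back : Fin 12 → Fin 4 → Fin 4
  size : Fin 12 → Fin 4 → ℕ

namespace MapTable

variable (T : MapTable)

/-- The other end of an edge. -/
def opp (x : Slot) : Slot := (T.nb x.1 x.2, T.back x.1 x.2)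

/-- The next dart of the face of `x`, against the orientation. -/
def turn (x : Slot) : Slot := T.opp x.succ

/-- The size of the face of a dart. -/
def faceSize (x : Slot) : ℕ := T.size x.1 x.2

/-- The steps by which a map is explored. `face`: a triangle or quadrilateral of which all edges but
one are known is closed up. `edge`: the size of a face is carried across an edge. `node`: of the two
triangles and two quadrilaterals at a node, both faces of one kind are known, and so are the others.
`alt`: triangles and quadrilaterals alternate at the node, so that one of them determines the others. -/
inductive Step
  | face (x : Slot)
  | edge (x : Slot)
  | node (i : Fin 12) (s t : Fin 4)
  | alt (i : Fin 12) (s : Fin 4)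

/-- The darts with a known edge, and the darts with a known face size. -/
abbrev State : Type := List Slot × List Slot

/-- The result of a step; the state is left unchanged by inapplicable steps. -/
def explore (S : State) : Step → State
  | .face x =>
    if T.faceSize x = 3 ∧ x ∈ S.2 ∧ T.turn (T.turn (T.turn x)) = x ∧ x.succ ∈ S.1 ∧
      (T.turn x).succ ∈ S.1 then ((T.turn (T.turn x)).succ :: x :: S.1, S.2)
    else if T.faceSize x = 4 ∧ x ∈ S.2 ∧ T.turn (T.turn (T.turn (T.turn x))) = x ∧ x.succ ∈ S.1 ∧
      (T.turn x).succ ∈ S.1 ∧ (T.turn (T.turn x)).succ ∈ S.1 then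
      ((T.turn (T.turn (T.turn x))).succ :: x :: S.1, S.2)
    else S
  | .edge x =>
    if x ∈ S.1 ∧ T.faceSize x.pred = T.faceSize (T.opp x) then
      (S.1, (if x.pred ∈ S.2 then [T.opp x] else []) ++ (if T.opp x ∈ S.2 then [x.pred] else []) ++
        S.2)
    else S
  | .node i s t =>
    if s ≠ t ∧ (i, s) ∈ S.2 ∧ (i, t) ∈ S.2 ∧ T.size i s = T.size i t ∧
      ∀ u, u ≠ s → u ≠ t → T.size i u + T.size i s = 7 then
      (S.1, [(i, 0), (i, 1), (i, 2), (i, 3)] ++ S.2)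
    else S
  | .alt i s =>
    if (i, s) ∈ S.2 ∧ ∀ u, T.size i u + T.size i (u + 1) = 7 then
      (S.1, [(i, 0), (i, 1), (i, 2), (i, 3)] ++ S.2)
    else S

end MapTable

namespace ContactMap

variable {D : Type} [Fintype D] {M : ContactMap D} {fc : ℕ → ℕ}

/-- The dart of `M` at a slot, when `r` chooses a dart at each node. -/
def place (M : ContactMap D) (r : Fin 12 → D) (x : Slot) : D := M.n^[x.2.val] (r x.1)

lemma place_succ (h : ∀ d, M.deg d = 4) (r : Fin 12 → D) (x : Slot) :
    M.place r x.succ = M.n (M.place r x) := by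
  obtain ⟨i, s⟩ := x
  have h4 : M.n^[4] (r i) = r i := n4 (h _)
  fin_cases s
  · rfl
  · rfl
  · rfl
  · exact h4.symm

/-- What a state of the exploration claims to be known is true of `M`. -/
def Sound (M : ContactMap D) (T : MapTable) (r : Fin 12 → D) (S : MapTable.State) : Prop :=
  (∀ x ∈ S.1, M.e (M.place r x) = M.place r (T.opp x)) ∧
    ∀ x ∈ S.2, M.k (M.place r x) = T.faceSize x

lemma k_cases_of_two {a b c d : ℕ} (ha : a = 3 ∨ a = 4) (hb : b = 3 ∨ b = 4) (hc : c = 3 ∨ c = 4)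
    (hd : d = 3 ∨ d = 4) (h : (if a = 3 then 1 else 0) + (if b = 3 then 1 else 0) +
      (if c = 3 then 1 else 0) + (if d = 3 then 1 else 0) = 2) : a + b + c + d = 14 := by
  rcases ha with rfl | rfl <;> rcases hb with rfl | rfl <;> rcases hc with rfl | rfl <;>
    rcases hd with rfl | rfl <;> simp_all

lemma two_of_each {k l : Fin 4 → ℕ} (h3 : ∀ s, k s = 3 ∨ k s = 4)
    (hs : k 0 + k 1 + k 2 + k 3 = 14) {s t : Fin 4} (hst : s ≠ t) (h : k s = l s) (h' : k t = l t)
    (hl : l s = l t) (hu : ∀ u, u ≠ s → u ≠ t → l u + l s = 7) : k = l := by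
  funext u
  have a0 := h3 0
  have a1 := h3 1
  have a2 := h3 2
  have a3 := h3 3
  by_cases h1 : u = s
  · rw [h1, h]
  by_cases h2 : u = t
  · rw [h2, h']
  have h4 := hu u h1 h2
  fin_cases s <;> fin_cases t <;> fin_cases u <;> simp at * <;> omega

lemma alternate {k l : Fin 4 → ℕ} (h3 : ∀ s, k s = 3 ∨ k s = 4) (hk : ∀ s, k (s + 1) ≠ k s)
    {s : Fin 4} (h : k s = l s) (hl : ∀ u, l u + l (u + 1) = 7) : k = l := by
  have key : ∀ u, k u = l u → k (u + 1) = l (u + 1) := by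
    intro u hu
    have := hl u
    have := h3 u
    have := h3 (u + 1)
    have := hk u
    omega
  have h1 := key s h
  have h2 := key _ h1
  have h4 := key _ h2
  funext u
  fin_cases s <;> fin_cases u <;> assumption

lemma tri_close {x a b : D} (hk : M.k x = 3) (h1 : M.e (M.n x) = a) (h2 : M.e (M.n a) = b) :
    M.e (M.n b) = x := by
  have h : M.f (M.f (M.f (M.e (M.n b)))) = M.f (M.f (M.f x)) := by
    rw [f_e_n, ← h2, f_e_n, ← h1, f_e_n, f3 hk]
  exact M.f.injective (M.f.injective (M.f.injective h))

lemma quad_close {x a b c : D} (hk : M.k x = 4) (h1 : M.e (M.n x) = a) (h2 : M.e (M.n a) = b)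
    (h3 : M.e (M.n b) = c) : M.e (M.n c) = x := by
  have h : M.f (M.f (M.f (M.f (M.e (M.n c))))) = M.f (M.f (M.f (M.f x))) := by
    rw [f_e_n, ← h3, f_e_n, ← h2, f_e_n, ← h1, f_e_n, f4 hk]
  exact M.f.injective (M.f.injective (M.f.injective (M.f.injective h)))

lemma Sound.explore {T : MapTable} {r : Fin 12 → D} {S : MapTable.State} (h : M.Sound T r S)
    (hdeg : ∀ d, M.deg d = 4) (hk : ∀ d, M.k d = 3 ∨ M.k d = 4)
    (hsum : ∀ d, M.k d + M.k (M.n d) + M.k (M.n (M.n d)) + M.k (M.n (M.n (M.n d))) = 14)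
    (hopp : ∀ x, T.opp (T.opp x) = x) (step : MapTable.Step)
    (halt : (∀ i s, step ≠ .alt i s) ∨ ∀ d, M.k (M.n d) ≠ M.k d) :
    M.Sound T r (T.explore S step) := by
  have hsucc := fun x => place_succ hdeg r x
  have hturn : ∀ x, x.succ ∈ S.1 → M.e (M.n (M.place r x)) = M.place r (T.turn x) := by
    intro x hx
    rw [← hsucc]
    exact h.1 _ hx
  have hnode : ∀ i, (∀ s : Fin 4, M.k (M.place r (i, s)) = T.size i s) →
      ∀ x ∈ ([(i, 0), (i, 1), (i, 2), (i, 3)] ++ S.2 : List Slot),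
        M.k (M.place r x) = T.faceSize x := by
    intro i hi x hx
    rcases List.mem_append.mp hx with h1 | h1
    · simp only [List.mem_cons, List.not_mem_nil, or_false] at h1
      rcases h1 with rfl | rfl | rfl | rfl <;> exact hi _
    · exact h.2 x h1
  cases step with
  | face x =>
    simp only [MapTable.explore]
    split_ifs with h1 h1'
    · obtain ⟨h2, h3, h4, h5, h6⟩ := h1
      have hc := tri_close ((h.2 x h3).trans h2) (hturn x h5) (hturn _ h6)
      rw [← hsucc] at hc
      have ho : T.opp (T.turn (T.turn x)).succ = x := h4
      refine ⟨?_, h.2⟩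
      intro y hy
      rcases List.mem_cons.mp hy with rfl | hy
      · rw [hc, ho]
      rcases List.mem_cons.mp hy with rfl | hy
      · rw [← hc, M.e_e]
        congr 1
        rw [← hopp (T.turn (T.turn y)).succ, ho]
      · exact h.1 y hy
    · obtain ⟨h2, h3, h4, h5, h6, h7⟩ := h1'
      have hc := quad_close ((h.2 x h3).trans h2) (hturn x h5) (hturn _ h6) (hturn _ h7)
      rw [← hsucc] at hc
      have ho : T.opp (T.turn (T.turn (T.turn x))).succ = x := h4
      refine ⟨?_, h.2⟩
      intro y hy
      rcases List.mem_cons.mp hy with rfl | hy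
      · rw [hc, ho]
      rcases List.mem_cons.mp hy with rfl | hy
      · rw [← hc, M.e_e]
        congr 1
        rw [← hopp (T.turn (T.turn (T.turn y))).succ, ho]
      · exact h.1 y hy
    · exact h
  | edge x =>
    simp only [MapTable.explore]
    by_cases h1 : x ∈ S.1 ∧ T.faceSize x.pred = T.faceSize (T.opp x)
    · rw [if_pos h1]
      obtain ⟨h2, h3⟩ := h1
      have key : M.k (M.place r (T.opp x)) = M.k (M.place r x.pred) := by
        rw [← h.1 x h2, ← M.k_e_n (M.place r x.pred), ← hsucc, Slot.succ_pred]
      refine ⟨h.1, fun y hy => ?_⟩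
      simp only [List.mem_append, List.mem_ite_nil_right, List.mem_singleton] at hy
      rcases hy with (⟨h4, rfl⟩ | ⟨h4, rfl⟩) | hy
      · rw [key, h.2 _ h4, h3]
      · rw [← key, h.2 _ h4, h3]
      · exact h.2 y hy
    · rw [if_neg h1]
      exact h
  | node i s t =>
    simp only [MapTable.explore]
    split_ifs with h1
    · obtain ⟨h2, h3, h4, h5, h6⟩ := h1
      refine ⟨h.1, hnode i fun u => ?_⟩
      exact congrFun (two_of_each (k := fun s => M.k (M.place r (i, s))) (l := T.size i)
        (fun s => hk _) (hsum (r i)) h2 (h.2 _ h3) (h.2 _ h4) h5 h6) u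
    · exact h
  | alt i s =>
    rcases halt with halt | halt
    · exact absurd rfl (halt i s)
    simp only [MapTable.explore]
    split_ifs with h1
    · refine ⟨h.1, hnode i fun u => ?_⟩
      refine congrFun (alternate (k := fun s => M.k (M.place r (i, s))) (l := T.size i)
        (fun s => hk _) (fun s => ?_) (h.2 _ h1.1) h1.2) u
      have := hsucc (i, s)
      change M.place r (i, s + 1) = _ at this
      simp only [this]
      exact halt _
    · exact h

/-- If the chosen darts follow the edges of a table, the table describes the whole map, since the map
is connected and the numbers of darts agree. -/
lemma exists_equiv_of_table {T : MapTable} {r : Fin 12 → D} (h : M.IsTame fc)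
    (hD : Fintype.card D = 48) (he : ∀ x, M.e (M.place r x) = M.place r (T.opp x)) :
    ∃ φ : Slot ≃ D, (∀ x, M.e (φ x) = φ (T.opp x)) ∧ ∀ x, M.n (φ x) = φ x.succ := by
  have hn := fun x => (place_succ (h.deg_eq_four hD) r x).symm
  have hr : Set.range (M.place r) = Set.univ := by
    refine h.connected _ ⟨M.place r (0, 0), (0, 0), rfl⟩ ?_
    rintro _ ⟨x, rfl⟩
    exact ⟨⟨_, (he x).symm⟩, ⟨_, (hn x).symm⟩⟩
  have hb : Function.Bijective (M.place r) := by
    rw [Fintype.bijective_iff_surjective_and_card]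
    refine ⟨Set.range_eq_univ.mp hr, ?_⟩
    rw [hD]
    rfl
  exact ⟨Equiv.ofBijective _ hb, he, hn⟩

end ContactMap

/-! ### The contact hypermaps of the two patterns -/

/-- The cuboctahedron: triangles and quadrilaterals alternate at each node. The numbering is that of
`fccPoint`. -/
def fccMap : MapTable where
  nb := ![![5, 9, 8, 4], ![5, 4, 10, 11], ![9, 7, 6, 8], ![11, 10, 6, 7], ![0, 8, 10, 1],
    ![0, 1, 11, 9], ![8, 2, 3, 10], ![9, 11, 3, 2], ![0, 2, 6, 4], ![0, 5, 7, 2], ![4, 6, 3, 1],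
    ![5, 1, 3, 7]]
  back := ![![0, 0, 0, 0], ![1, 3, 3, 1], ![3, 3, 1, 1], ![2, 2, 2, 2], ![3, 3, 0, 1],
    ![0, 0, 0, 1], ![2, 2, 2, 1], ![2, 3, 3, 1], ![2, 3, 0, 1], ![1, 3, 0, 0], ![2, 3, 1, 2],
    ![2, 3, 0, 1]]
  size := ![![3, 4, 3, 4], ![4, 3, 4, 3], ![3, 4, 3, 4], ![4, 3, 4, 3], ![3, 4, 3, 4],
    ![4, 3, 4, 3], ![3, 4, 3, 4], ![4, 3, 4, 3], ![4, 3, 4, 3], ![3, 4, 3, 4], ![4, 3, 4, 3],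
    ![3, 4, 3, 4]]

/-- The triangular orthobicupola: the two triangles are adjacent at six of the nodes. The numbering is
that of `hcpPoint`. -/
def hcpMap : MapTable where
  nb := ![![9, 2, 6, 4], ![10, 5, 7, 3], ![0, 9, 3, 6], ![2, 10, 1, 7], ![0, 8, 5, 11],
    ![4, 8, 1, 11], ![0, 2, 7, 8], ![6, 3, 1, 8], ![6, 7, 5, 4], ![0, 11, 10, 2], ![9, 11, 1, 3],
    ![9, 4, 5, 10]]
  back := ![![0, 0, 0, 0], ![2, 2, 2, 2], ![1, 3, 0, 1], ![2, 3, 3, 1], ![3, 3, 0, 1],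
    ![2, 2, 1, 2], ![2, 3, 0, 0], ![2, 3, 2, 1], ![3, 3, 1, 1], ![0, 0, 0, 1], ![2, 3, 0, 1],
    ![1, 3, 3, 1]]
  size := ![![3, 3, 4, 4], ![4, 4, 3, 3], ![3, 4, 4, 3], ![4, 3, 3, 4], ![4, 3, 3, 4],
    ![3, 4, 4, 3], ![3, 4, 3, 4], ![4, 3, 4, 3], ![3, 4, 3, 4], ![4, 3, 4, 3], ![3, 4, 3, 4],
    ![4, 3, 4, 3]]

lemma fccMap_opp : ∀ x, fccMap.opp (fccMap.opp x) = x := by decide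

lemma hcpMap_opp : ∀ x, hcpMap.opp (hcpMap.opp x) = x := by decide

open MapTable.Step in
/-- An exploration of the cuboctahedron, beginning with a spanning tree of the nodes and one triangle. -/
def fccSteps : List MapTable.Step :=
  [alt 0 0, edge (5, 0), edge (9, 0), edge (8, 0), edge (4, 0), alt 5 3, alt 9 3, alt 8 3, alt 4 3,
    edge (1, 0), edge (11, 0), edge (7, 0), edge (2, 0), edge (6, 0), edge (10, 0), alt 1 3,
    alt 11 3, alt 7 3, alt 2 3, alt 6 3, alt 10 3, edge (3, 0), alt 3 3, face (1, 3), face (2, 3),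
    face (2, 2), face (4, 3), face (5, 3), face (7, 3), face (8, 3), face (6, 3), face (10, 3),
    face (10, 2), face (6, 2), face (7, 2), face (7, 1)]

open MapTable.Step in
/-- An exploration of the triangular orthobicupola, beginning with a spanning tree of the nodes and two
adjacent triangles at a node. -/
def hcpSteps : List MapTable.Step :=
  [edge (0, 1), edge (0, 2), edge (2, 0), edge (9, 0), node 0 0 1, node 2 0 3, edge (0, 0),
    edge (0, 3), edge (2, 2), edge (3, 0), edge (4, 0), edge (6, 0), edge (8, 0), edge (9, 1),
    node 3 0 3, node 4 0 3, edge (4, 2), edge (5, 0), node 5 0 3, face (2, 3), edge (2, 3),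
    edge (6, 2), node 6 1 3, edge (6, 3), edge (7, 0), face (3, 3), edge (3, 3), node 7 1 3,
    face (4, 3), edge (4, 3), face (5, 3), edge (5, 3), node 11 0 2, edge (11, 0), node 9 1 3,
    edge (9, 2), edge (10, 0), face (7, 3), edge (7, 3), node 8 1 3, face (8, 3), face (8, 2),
    face (9, 3), face (10, 3), edge (10, 3), node 10 0 2, edge (1, 0), edge (10, 2), face (1, 3),
    edge (1, 3), node 1 2 3, face (1, 2), face (1, 1), face (10, 1)]

set_option maxRecDepth 100000 in
lemma fcc_explored : ∀ x, x ∈ (fccSteps.foldl fccMap.explore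
    ([(0, 0), (5, 0), (0, 1), (9, 0), (0, 2), (8, 0), (0, 3), (4, 0), (5, 1), (1, 0), (5, 2),
      (11, 0), (9, 2), (7, 0), (9, 3), (2, 0), (8, 2), (6, 0), (4, 2), (10, 0), (11, 2), (3, 0)],
      [(0, 0)])).1 := by
  decide

set_option maxRecDepth 100000 in
lemma hcp_explored : ∀ x, x ∈ (hcpSteps.foldl hcpMap.explore
    ([(0, 0), (9, 0), (0, 1), (2, 0), (0, 2), (6, 0), (0, 3), (4, 0), (9, 1), (11, 0), (9, 2),
      (10, 0), (2, 2), (3, 0), (6, 2), (7, 0), (6, 3), (8, 0), (4, 2), (5, 0), (10, 2), (1, 0)],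
      [(0, 0), (0, 1)])).1 := by
  decide

namespace ContactMap

variable {D : Type} [Fintype D] {M : ContactMap D} {fc : ℕ → ℕ}

lemma Sound.foldl {T : MapTable} {r : Fin 12 → D}
    (hdeg : ∀ d, M.deg d = 4) (hk : ∀ d, M.k d = 3 ∨ M.k d = 4)
    (hsum : ∀ d, M.k d + M.k (M.n d) + M.k (M.n (M.n d)) + M.k (M.n (M.n (M.n d))) = 14)
    (hopp : ∀ x, T.opp (T.opp x) = x) (l : List MapTable.Step)
    (halt : (∀ i s, .alt i s ∉ l) ∨ ∀ d, M.k (M.n d) ≠ M.k d) (S : MapTable.State)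
    (h : M.Sound T r S) : M.Sound T r (l.foldl T.explore S) := by
  induction l generalizing S with
  | nil => exact h
  | cons a l ih =>
    rw [List.foldl_cons]
    refine ih (halt.imp_left fun h i s hm => h i s (List.mem_cons_of_mem _ hm)) _
      (h.explore hdeg hk hsum hopp a (halt.imp_left fun h i s ha => h i s ?_))
    rw [ha]
    exact List.mem_cons_self

lemma IsTame.sum_k (h : M.IsTame fc) (hD : Fintype.card D = 48) (d : D) :
    M.k d + M.k (M.n d) + M.k (M.n (M.n d)) + M.k (M.n (M.n (M.n d))) = 14 := by
  obtain ⟨-, h4, h5, h6, h7, h8⟩ := h.faces_of_card_eq hD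
  have hk := k_le_four_of_count h h5 h6 h7 h8
  have h1 := (h.cnt_eq_two hD d).1
  rw [cnt_pos, card_pos_and_four (h.deg_eq_four hD d)] at h1
  exact k_cases_of_two (hk _) (hk _) (hk _) (hk _) h1

/-- With the maximal number of contacts, the map is given by one of the two tables. The alternating
case is the cuboctahedron; otherwise there is a point with two adjacent triangles. -/
lemma IsTame.exists_equiv (h : M.IsTame fc) (hD : Fintype.card D = 48) :
    ∃ T : MapTable, (T = fccMap ∨ T = hcpMap) ∧
      ∃ φ : Slot ≃ D, (∀ x, M.e (φ x) = φ (T.opp x)) ∧ ∀ x, M.n (φ x) = φ x.succ := by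
  have hdeg := h.deg_eq_four hD
  obtain ⟨-, h4, h5, h6, h7, h8⟩ := h.faces_of_card_eq hD
  have hk := k_le_four_of_count h h5 h6 h7 h8
  have hsum := h.sum_k hD
  by_cases halt : ∀ d, M.k (M.n d) ≠ M.k d
  · refine ⟨fccMap, Or.inl rfl, ?_⟩
    have hne : Nonempty D := Fintype.card_pos_iff.mp (by omega)
    obtain ⟨d, hd⟩ : ∃ d, M.k d = 3 := by
      obtain ⟨d⟩ := hne
      have := hk d
      have := hk (M.n d)
      have := halt d
      by_cases h9 : M.k d = 3
      · exact ⟨d, h9⟩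
      · exact ⟨M.n d, by omega⟩
    set r0 := d
    set r5 := M.e r0 with e5
    set r9 := M.e (M.n r0) with e9
    set r8 := M.e (M.n (M.n r0)) with e8
    set r4 := M.e (M.n (M.n (M.n r0))) with e4
    set r1 := M.e (M.n r5) with e1
    set r11 := M.e (M.n (M.n r5)) with e11
    set r7 := M.e (M.n (M.n r9)) with e7
    set r2 := M.e (M.n (M.n (M.n r9))) with e2
    set r6 := M.e (M.n (M.n r8)) with e6
    set r10 := M.e (M.n (M.n r4)) with e10
    set r3 := M.e (M.n (M.n r11)) with e3
    have hS : M.Sound fccMap ![r0, r1, r2, r3, r4, r5, r6, r7, r8, r9, r10, r11]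
        ([(0, 0), (5, 0), (0, 1), (9, 0), (0, 2), (8, 0), (0, 3), (4, 0), (5, 1), (1, 0), (5, 2),
          (11, 0), (9, 2), (7, 0), (9, 3), (2, 0), (8, 2), (6, 0), (4, 2), (10, 0), (11, 2),
          (3, 0)], [(0, 0)]) := by
      constructor
      · intro x hx
        fin_cases hx
        exacts [e5.symm, M.e_e _, e9.symm, M.e_e _, e8.symm, M.e_e _, e4.symm, M.e_e _, e1.symm,
          M.e_e _, e11.symm, M.e_e _, e7.symm, M.e_e _, e2.symm, M.e_e _, e6.symm, M.e_e _,
          e10.symm, M.e_e _, e3.symm, M.e_e _]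
      · intro x hx
        rw [List.mem_singleton.mp hx]
        exact hd
    have hF := Sound.foldl hdeg hk hsum fccMap_opp fccSteps (Or.inr halt) _ hS
    exact exists_equiv_of_table h hD fun x => hF.1 x (fcc_explored x)
  · refine ⟨hcpMap, Or.inr rfl, ?_⟩
    push Not at halt
    obtain ⟨d, hd, hd'⟩ : ∃ d, M.k d = 3 ∧ M.k (M.n d) = 3 := by
      obtain ⟨x, hx⟩ := halt
      have h1 := hsum x
      rcases hk x with h2 | h2
      · exact ⟨x, h2, by omega⟩
      · have h3 := hk (M.n (M.n x))
        have h4 := hk (M.n (M.n (M.n x)))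
        exact ⟨M.n (M.n x), by omega, by omega⟩
    set r0 := d
    set r9 := M.e r0 with e9
    set r2 := M.e (M.n r0) with e2
    set r6 := M.e (M.n (M.n r0)) with e6
    set r4 := M.e (M.n (M.n (M.n r0))) with e4
    set r11 := M.e (M.n r9) with e11
    set r10 := M.e (M.n (M.n r9)) with e10
    set r3 := M.e (M.n (M.n r2)) with e3
    set r7 := M.e (M.n (M.n r6)) with e7
    set r8 := M.e (M.n (M.n (M.n r6))) with e8
    set r5 := M.e (M.n (M.n r4)) with e5
    set r1 := M.e (M.n (M.n r10)) with e1
    have hS : M.Sound hcpMap ![r0, r1, r2, r3, r4, r5, r6, r7, r8, r9, r10, r11]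
        ([(0, 0), (9, 0), (0, 1), (2, 0), (0, 2), (6, 0), (0, 3), (4, 0), (9, 1), (11, 0), (9, 2),
          (10, 0), (2, 2), (3, 0), (6, 2), (7, 0), (6, 3), (8, 0), (4, 2), (5, 0), (10, 2),
          (1, 0)], [(0, 0), (0, 1)]) := by
      constructor
      · intro x hx
        fin_cases hx
        exacts [e9.symm, M.e_e _, e2.symm, M.e_e _, e6.symm, M.e_e _, e4.symm, M.e_e _, e11.symm,
          M.e_e _, e10.symm, M.e_e _, e3.symm, M.e_e _, e7.symm, M.e_e _, e8.symm, M.e_e _,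
          e5.symm, M.e_e _, e1.symm, M.e_e _]
      · intro x hx
        fin_cases hx
        · exact hd
        · exact hd'
    have hF := Sound.foldl hdeg hk hsum hcpMap_opp hcpSteps
      (Or.inl (by intro i s; simp [hcpSteps])) _ hS
    exact exists_equiv_of_table h hD fun x => hF.1 x (hcp_explored x)

end ContactMap

section Patterns

/-- The contact hypermap of twelve explicit points is given by a table, as soon as the table lists
the contacts of each point in the order prescribed by the signs of the determinants. -/
lemma exists_equiv_of_points {p : Fin 12 → Space} (hV : IsConfig (Set.range p)) (T : MapTable)
    (hopp : ∀ x, T.opp (T.opp x) = x) (hnb : ∀ i, Function.Injective (T.nb i))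
    (hin : ∀ i j, ⟪p i, p j⟫ = 2 ↔ ∃ s, T.nb i s = j)
    (hpos : ∀ i s, 0 < det3 (p i) (p (T.nb i s)) (p (T.nb i (s + 1))))
    (hneg : ∀ i s t, t ≠ s → t ≠ s + 1 → det3 (p i) (p (T.nb i s)) (p (T.nb i t)) ≤ 0 ∨
      det3 (p i) (p (T.nb i t)) (p (T.nb i (s + 1))) ≤ 0) :
    ∃ φ : Slot ≃ (contactHypermap hV).Dart, (∀ x, (contactHypermap hV).e (φ x) = φ (T.opp x)) ∧
      ∀ x, (contactHypermap hV).n (φ x) = φ x.succ := by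
  have hp : Function.Injective p := by
    rw [← Set.injOn_univ]
    refine Set.injOn_of_ncard_image_eq ?_ (Set.toFinite _)
    rw [Set.image_univ, hV.card, Set.ncard_univ, Nat.card_eq_fintype_card, Fintype.card_fin]
  have hmem : ∀ i s, p (T.nb i s) ∈ nbrs (contactEdges (Set.range p)) (p i) := fun i s =>
    hV.mem_nbrs.mpr ⟨⟨i, rfl⟩, ⟨_, rfl⟩, (hin _ _).mpr ⟨s, rfl⟩⟩
  have hall : ∀ i, ∀ w ∈ nbrs (contactEdges (Set.range p)) (p i), ∃ s, w = p (T.nb i s) := by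
    intro i w hw
    obtain ⟨-, ⟨j, rfl⟩, h⟩ := hV.mem_nbrs.mp hw
    obtain ⟨s, rfl⟩ := (hin _ _).mp h
    exact ⟨s, rfl⟩
  let g : Slot → (contactHypermap hV).Dart :=
    fun x => ⟨(p x.1, p (T.nb x.1 x.2)), Or.inl (hmem x.1 x.2)⟩
  have hg : Function.Bijective g := by
    constructor
    · rintro ⟨i, s⟩ ⟨j, t⟩ h
      have h1 := congrArg (fun d : (contactHypermap hV).Dart => d.1.1) h
      have h2 := congrArg (fun d : (contactHypermap hV).Dart => d.1.2) h
      obtain rfl : i = j := hp h1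
      obtain rfl : s = t := hnb i (hp h2)
      rfl
    · rintro ⟨⟨v, w⟩, h⟩
      rcases h with h | ⟨h1, h2, h3⟩
      · obtain ⟨⟨i, rfl⟩, -, -⟩ := hV.mem_nbrs.mp h
        obtain ⟨s, rfl⟩ := hall i w h
        exact ⟨(i, s), rfl⟩
      · exfalso
        obtain ⟨i, hi⟩ := h1
        have h4 := hmem i 0
        rw [hi, h2] at h4
        exact h4
  refine ⟨Equiv.ofBijective g hg, fun x => ?_, fun x => ?_⟩
  · apply dart_ext hV
    · rfl
    · change p x.1 = p (T.nb (T.opp x).1 (T.opp x).2)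
      have h : T.nb (T.opp x).1 (T.opp x).2 = x.1 := congrArg Prod.fst (hopp x)
      rw [h]
  · apply dart_ext hV
    · rfl
    · change sigma hV.isFan (p x.1) (p (T.nb x.1 x.2)) = p (T.nb x.1 (x.2 + 1))
      rw [sigma_of_mem hV.isFan (hmem x.1 x.2)]
      refine hV.succPt_eq (hmem _ _) (hmem _ _) (hpos _ _) ?_
      intro w hw h1 h2
      obtain ⟨t, rfl⟩ := hall _ _ hw
      exact hneg _ _ _ (fun h => h1 (by rw [h])) (fun h => h2 (by rw [h]))

/-- The integer determinant of three rows of a table. -/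
def detTable (a : Fin 12 → Fin 3 → ℤ) (i j k : Fin 12) : ℤ :=
  a i 0 * a j 1 * a k 2 - a i 0 * a j 2 * a k 1 - a i 1 * a j 0 * a k 2 + a i 1 * a j 2 * a k 0
      + a i 2 * a j 0 * a k 1 - a i 2 * a j 1 * a k 0

lemma det3_fcc (i j k : Fin 12) :
    det3 (fccPoint i) (fccPoint j) (fccPoint k) = √2 ^ 3 * detTable fccTable i j k := by
  rw [det3_coord]
  simp only [fccPoint, detTable, PiLp.toLp_apply, Matrix.cons_val_zero, Matrix.cons_val_one,
    Matrix.cons_val]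
  push_cast
  ring

lemma inner_fcc (i j : Fin 12) : ⟪fccPoint i, fccPoint j⟫ =
    2 * ((fccTable i 0 * fccTable j 0 + fccTable i 1 * fccTable j 1 + fccTable i 2 * fccTable j 2 :
      ℤ) : ℝ) := by
  have hs : √2 ^ 2 = (2 : ℝ) := Real.sq_sqrt (by norm_num)
  rw [inner_coord]
  simp only [fccPoint, PiLp.toLp_apply, Matrix.cons_val_zero, Matrix.cons_val_one,
    Matrix.cons_val]
  push_cast
  linear_combination ((fccTable i 0 : ℝ) * fccTable j 0 + fccTable i 1 * fccTable j 1 +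
    fccTable i 2 * fccTable j 2) * hs

lemma det3_hcp (i j k : Fin 12) : det3 (hcpPoint i) (hcpPoint j) (hcpPoint k) =
    √(8 / 3) / √3 * detTable hcpTable i j k := by
  rw [det3_coord]
  simp only [hcpPoint, detTable, PiLp.toLp_apply, Matrix.cons_val_zero, Matrix.cons_val_one,
    Matrix.cons_val]
  push_cast
  ring

lemma inner_hcp (i j : Fin 12) : ⟪hcpPoint i, hcpPoint j⟫ =
    ((3 * hcpTable i 0 * hcpTable j 0 + hcpTable i 1 * hcpTable j 1 +
      8 * hcpTable i 2 * hcpTable j 2 : ℤ) : ℝ) / 3 := by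
  have hs : √3 ^ 2 = (3 : ℝ) := Real.sq_sqrt (by norm_num)
  have hs' : √(8 / 3) ^ 2 = (8 / 3 : ℝ) := Real.sq_sqrt (by norm_num)
  have h3 : √3 ≠ (0 : ℝ) := by positivity
  have h1 : (hcpTable i 1 : ℝ) / √3 * (hcpTable j 1 / √3) = hcpTable i 1 * hcpTable j 1 / 3 := by
    rw [div_mul_div_comm, ← sq, hs]
  rw [inner_coord]
  simp only [hcpPoint, PiLp.toLp_apply, Matrix.cons_val_zero, Matrix.cons_val_one,
    Matrix.cons_val]
  rw [h1]
  push_cast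
  linear_combination ((hcpTable i 2 : ℝ) * hcpTable j 2) * hs'

lemma mul_cast_nonpos {κ : ℝ} (h : 0 < κ) {z : ℤ} (hz : z ≤ 0) : κ * (z : ℝ) ≤ 0 :=
  mul_nonpos_of_nonneg_of_nonpos h.le (by exact_mod_cast hz)

lemma fccHypermap_equiv : ∃ φ : Slot ≃ fccHypermap.Dart,
    (∀ x, fccHypermap.e (φ x) = φ (fccMap.opp x)) ∧ ∀ x, fccHypermap.n (φ x) = φ x.succ := by
  have hκ : (0 : ℝ) < √2 ^ 3 := by positivity
  have h1 : ∀ i s, 0 < detTable fccTable i (fccMap.nb i s) (fccMap.nb i (s + 1)) := by decide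
  have h2 : ∀ i s t, t ≠ s → t ≠ s + 1 → detTable fccTable i (fccMap.nb i s) (fccMap.nb i t) ≤ 0 ∨
      detTable fccTable i (fccMap.nb i t) (fccMap.nb i (s + 1)) ≤ 0 := by decide
  have h3 : ∀ i j, fccTable i 0 * fccTable j 0 + fccTable i 1 * fccTable j 1 +
      fccTable i 2 * fccTable j 2 = 1 ↔ ∃ s, fccMap.nb i s = j := by decide
  refine exists_equiv_of_points isConfig_fcc fccMap fccMap_opp ?_ ?_ ?_ ?_
  · unfold Function.Injective
    decide
  · intro i j
    rw [← h3, inner_fcc, mul_eq_left₀ two_ne_zero]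
    norm_cast
  · intro i s
    rw [det3_fcc]
    exact mul_pos hκ (by exact_mod_cast h1 i s)
  · intro i s t hs ht
    rw [det3_fcc, det3_fcc]
    exact (h2 i s t hs ht).imp (mul_cast_nonpos hκ) (mul_cast_nonpos hκ)

lemma hcpHypermap_equiv : ∃ φ : Slot ≃ hcpHypermap.Dart,
    (∀ x, hcpHypermap.e (φ x) = φ (hcpMap.opp x)) ∧ ∀ x, hcpHypermap.n (φ x) = φ x.succ := by
  have hκ : (0 : ℝ) < √(8 / 3) / √3 := by positivity
  have h1 : ∀ i s, 0 < detTable hcpTable i (hcpMap.nb i s) (hcpMap.nb i (s + 1)) := by decide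
  have h2 : ∀ i s t, t ≠ s → t ≠ s + 1 → detTable hcpTable i (hcpMap.nb i s) (hcpMap.nb i t) ≤ 0 ∨
      detTable hcpTable i (hcpMap.nb i t) (hcpMap.nb i (s + 1)) ≤ 0 := by decide
  have h3 : ∀ i j, 3 * hcpTable i 0 * hcpTable j 0 + hcpTable i 1 * hcpTable j 1 +
      8 * hcpTable i 2 * hcpTable j 2 = 6 ↔ ∃ s, hcpMap.nb i s = j := by decide
  refine exists_equiv_of_points isConfig_hcp hcpMap hcpMap_opp ?_ ?_ ?_ ?_
  · unfold Function.Injective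
    decide
  · intro i j
    rw [← h3, inner_hcp, div_eq_iff three_ne_zero]
    norm_num
    norm_cast
  · intro i s
    rw [det3_hcp]
    exact mul_pos hκ (by exact_mod_cast h1 i s)
  · intro i s t hs ht
    rw [det3_hcp, det3_hcp]
    exact (h2 i s t hs ht).imp (mul_cast_nonpos hκ) (mul_cast_nonpos hκ)

/-- Hypermaps with the same table are isomorphic. -/
lemma iso_of_table {H K : Hypermap} {T : MapTable}
    (hH : ∃ φ : Slot ≃ H.Dart, (∀ x, H.e (φ x) = φ (T.opp x)) ∧ ∀ x, H.n (φ x) = φ x.succ)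
    (hK : ∃ φ : Slot ≃ K.Dart, (∀ x, K.e (φ x) = φ (T.opp x)) ∧ ∀ x, K.n (φ x) = φ x.succ) :
    Nonempty (Hypermap.Iso H K) := by
  obtain ⟨φ, hφe, hφn⟩ := hH
  obtain ⟨ψ, hψe, hψn⟩ := hK
  have he : ∀ x, ψ (φ.symm (H.e x)) = K.e (ψ (φ.symm x)) := by
    intro x
    obtain ⟨y, rfl⟩ := φ.surjective x
    rw [hφe, φ.symm_apply_apply, φ.symm_apply_apply, hψe]
  have hn : ∀ x, ψ (φ.symm (H.n x)) = K.n (ψ (φ.symm x)) := by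
    intro x
    obtain ⟨y, rfl⟩ := φ.surjective x
    rw [hφn, φ.symm_apply_apply, φ.symm_apply_apply, hψn]
  refine ⟨⟨φ.symm.trans ψ, he, hn, fun x => ?_⟩⟩
  change ψ (φ.symm (H.f x)) = K.f (ψ (φ.symm x))
  apply K.n.injective
  apply K.e.injective
  rw [K.enf, ← hn, ← he, H.enf]

/-- A configuration with tame contact and the maximal number of contacts is one of the two
patterns. -/
lemma iso_of_card_eq {V : Set Space} {hV : IsConfig V} (hT : (contactHypermap hV).HasTameContact)
    (hD : Fintype.card (contactHypermap hV).Dart = 48) :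
    Nonempty (Hypermap.Iso (contactHypermap hV) fccHypermap) ∨
      Nonempty (Hypermap.Iso (contactHypermap hV) hcpHypermap) := by
  obtain ⟨T, rfl | rfl, hφ⟩ := (isTame_contactMapOf hT).exists_equiv hD
  · exact Or.inl (iso_of_table hφ fccHypermap_equiv)
  · exact Or.inr (iso_of_table hφ hcpHypermap_equiv)

end Patterns

/-! ### Angles at the corners of quadrilaterals -/

/-- Two angles next to two triangles around a point, with cosines `c₁` and `c₂`; `7 / 9` is minus the
cosine of twice the angle of a triangle. -/
lemma two_triangles_relation {c₁ c₂ s₁ s₂ : ℝ} (h1 : c₁ ^ 2 + s₁ ^ 2 = 1) (h2 : c₂ ^ 2 + s₂ ^ 2 = 1)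
    (h : c₁ * c₂ - s₁ * s₂ = -7 / 9) :
    c₁ ^ 2 + c₂ ^ 2 + 14 / 9 * (c₁ * c₂) = 32 / 81 := by
  have hsq : (s₁ * s₂) ^ 2 = (1 - c₁ ^ 2) * (1 - c₂ ^ 2) := by
    rw [mul_pow]
    rw [show s₁ ^ 2 = 1 - c₁ ^ 2 by linarith, show s₂ ^ 2 = 1 - c₂ ^ 2 by linarith]
  have h3 : s₁ * s₂ = c₁ * c₂ + 7 / 9 := by linarith
  rw [h3] at hsq
  nlinarith

/-- For two such angles, if obtuse, the product is at most `16`, with equality only for squares. At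
adjacent vertices of one quadrilateral the product is equal to `16`, by `quad_mul`. -/
lemma two_triangles_mul_le {c₁ c₂ : ℝ} (h : c₁ ^ 2 + c₂ ^ 2 + 14 / 9 * (c₁ * c₂) = 32 / 81)
    (h1 : c₁ ≤ 0) (h2 : c₂ ≤ 0) : (5 + 3 * c₁) * (5 + 3 * c₂) ≤ 16 ∧
      (16 ≤ (5 + 3 * c₁) * (5 + 3 * c₂) → c₁ = -1 / 3 ∧ c₂ = -1 / 3) := by
  have hp : 0 ≤ c₁ * c₂ := mul_nonneg_of_nonpos_of_nonpos h1 h2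
  have hS : -2 / 3 ≤ c₁ + c₂ := by nlinarith [sq_nonneg (c₁ - c₂)]
  have hS' : c₁ + c₂ ≤ -0.6 := by nlinarith
  have key : (5 + 3 * c₁) * (5 + 3 * c₂) - 16 = 81 / 4 * (c₁ + c₂ + 2 / 3) * (c₁ + c₂ + 2 / 27) := by
    nlinarith
  constructor
  · nlinarith
  · intro h3
    have h4 : c₁ + c₂ = -2 / 3 := by
      by_contra hne
      have : -2 / 3 < c₁ + c₂ := lt_of_le_of_ne hS (Ne.symm hne)
      nlinarith
    have h5 : c₂ = -2 / 3 - c₁ := by linarith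
    rw [h5] at h
    have h6 : (c₁ + 1 / 3) ^ 2 = 0 := by nlinarith
    have h7 : c₁ + 1 / 3 = 0 := by simpa using h6
    constructor <;> linarith

/-- The same product for two of the three angles of quadrilaterals around a point is less than `16`. -/
lemma two_angles_mul_lt {c₁ c₂ s₁ s₂ : ℝ} (h1 : c₁ ^ 2 + s₁ ^ 2 = 1) (h2 : c₂ ^ 2 + s₂ ^ 2 = 1)
    (hc1 : -0.5614 ≤ c₁) (hc1' : c₁ ≤ 0) (hc2 : -0.5614 ≤ c₂) (hc2' : c₂ ≤ 0) (hs1 : 0 ≤ s₁)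
    (hs2 : 0 ≤ s₂) (h : -0.5614 ≤ c₁ * c₂ - s₁ * s₂) : (5 + 3 * c₁) * (5 + 3 * c₂) < 16 := by
  by_contra hc
  push Not at hc
  have hp : 0 ≤ c₁ * c₂ := mul_nonneg_of_nonpos_of_nonpos hc1' hc2'
  have hS : -2 / 3 ≤ c₁ + c₂ := by nlinarith [sq_nonneg (c₁ - c₂)]
  have hsq : (s₁ * s₂) ^ 2 = (1 - c₁ ^ 2) * (1 - c₂ ^ 2) := by
    rw [mul_pow]
    rw [show s₁ ^ 2 = 1 - c₁ ^ 2 by linarith, show s₂ ^ 2 = 1 - c₂ ^ 2 by linarith]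
  have h3 : s₁ * s₂ ≤ c₁ * c₂ + 0.5614 := by linarith
  have h4 : (s₁ * s₂) ^ 2 ≤ (c₁ * c₂ + 0.5614) ^ 2 := pow_le_pow_left₀ (mul_nonneg hs1 hs2) h3 2
  have h5 : (c₁ + c₂) ^ 2 ≤ 4 / 9 := by
    have := mul_nonneg (by linarith : 0 ≤ c₁ + c₂ + 2 / 3) (by linarith : 0 ≤ 2 / 3 - (c₁ + c₂))
    linear_combination this
  rw [hsq] at h4
  have h6 : (1 - c₁ ^ 2) * (1 - c₂ ^ 2) = 1 - (c₁ + c₂) ^ 2 + 2 * (c₁ * c₂) + (c₁ * c₂) ^ 2 := by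
    ring
  rw [h6] at h4
  linarith

namespace ContactMap

variable {D : Type} [Fintype D] {M : ContactMap D} {fc : ℕ → ℕ}

/-- The cosine of the angle at the corner of a dart. -/
noncomputable def cosine (M : ContactMap D) (d : D) : ℝ := (M.dot d - 1) / 3

/-- The sine of the angle at the corner of a dart. -/
noncomputable def sine (M : ContactMap D) (d : D) : ℝ :=
  det3 (M.pos d) (M.head d) (M.head (M.n d)) / 6

/-- The angle at the corner of a dart, as a complex number. -/
noncomputable def angle (M : ContactMap D) (d : D) : ℂ := ⟨M.cosine d, M.sine d⟩

lemma angle_eq (d : D) : M.angle d = corner (M.pos d) (M.head d) (M.head (M.n d)) := rfl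

lemma sq_add_sq (d : D) : M.cosine d ^ 2 + M.sine d ^ 2 = 1 :=
  normSq_corner (M.norm d) (M.norm_head d) (M.norm_head _) (M.inner_head d) (M.inner_head_n d)

lemma dot_eq_cosine (d : D) : M.dot d = 3 * M.cosine d + 1 := by
  unfold cosine
  ring

lemma angle_mul (d : D) : M.angle d * M.angle (M.n d) =
    corner (M.pos d) (M.head d) (M.head (M.n (M.n d))) := by
  rw [angle_eq, angle_eq, M.pos_n]
  exact corner_mul (M.norm d) (M.norm_head _) (M.inner_head d) (M.inner_head_n d)
    (M.inner_head_nn d)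

lemma angle_mul_three (d : D) : M.angle d * M.angle (M.n d) * M.angle (M.n (M.n d)) =
    corner (M.pos d) (M.head d) (M.head (M.n (M.n (M.n d)))) := by
  rw [angle_mul, angle_eq, M.pos_n, M.pos_n]
  exact corner_mul (M.norm d) (M.norm_head _) (M.inner_head d) (M.inner_head_nn d)
    (M.inner_head_nnn d)

/-- The angle of a dart, in terms of the other angles around the point. -/
lemma dot_of_deg_three {d : D} (h : M.deg d = 3) :
    M.dot d = 3 * (M.angle (M.n d) * M.angle (M.n (M.n d))).re + 1 := by
  rw [angle_mul, n3 h, M.pos_n, corner_swap_re, dot]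
  simp only [corner]
  ring

lemma dot_of_deg_four {d : D} (h : M.deg d = 4) : M.dot d = 3 * (M.angle (M.n d) *
    M.angle (M.n (M.n d)) * M.angle (M.n (M.n (M.n d)))).re + 1 := by
  rw [angle_mul_three, n4 h, M.pos_n, corner_swap_re, dot]
  simp only [corner]
  ring

lemma dot_of_deg_two {d : D} (h : M.deg d = 2) : M.dot d = M.dot (M.n d) := by
  rw [dot, dot, n2 h, real_inner_comm]

lemma sine_pos {d : D} (h : M.deg d ≠ 2) (hk : M.k d ≤ 4) : 0 < M.sine d :=
  div_pos (M.convex d (nn_ne h) hk) (by norm_num)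

lemma cosine_tri {d : D} (h : M.k d = 3) : M.cosine d = 1 / 3 := by
  rw [cosine, dot_tri h]
  norm_num

lemma sine_tri {d : D} (h : M.k d = 3) (hd : M.deg d ≠ 2) : M.sine d = 2 * √2 / 3 := by
  have h1 := sq_add_sq (M := M) d
  rw [cosine_tri h] at h1
  have h2 := sine_pos hd (M := M) (by omega)
  have h3 : √2 ^ 2 = (2 : ℝ) := Real.sq_sqrt (by norm_num)
  have h4 : (0 : ℝ) < √2 := by positivity
  have h5 : (M.sine d - 2 * √2 / 3) * (M.sine d + 2 * √2 / 3) = 0 := by nlinarith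
  rcases mul_eq_zero.mp h5 with h6 | h6
  · linarith
  · nlinarith

/-- A corner that is not cut off by a triangle is wide, because of the gap. -/
lemma dot_le_gap {d : D} (h : M.k d ≠ 3) (h' : M.n (M.n d) = d → M.k (M.n d) ≠ 3) :
    M.dot d ≤ 0.8248 := by
  rcases M.gap (M.e d) (M.e (M.n d)) (head_n_ne d).symm with ⟨x, hx1, hx2⟩ | h1
  · exfalso
    have h2 : ⟪M.pos (M.e d), M.pos (M.e (M.n d))⟫ = 2 := by
      rw [← hx1, ← hx2]
      exact M.contact x
    rcases M.tri d h2 with h3 | ⟨h3, h4⟩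
    · exact h h3
    · exact h' h3 h4
  · exact h1

lemma dot_quad_le {d : D} (h : M.k d = 4) : M.dot d ≤ 0.8248 := by
  apply dot_le_gap (by omega)
  intro hn hk
  have h2 : M.deg d = 2 := by
    have h1 : M.deg d ∣ 2 := n_iterate_eq (i := 2) hn
    have := Nat.le_of_dvd (by norm_num) h1
    have := M.two_le_deg d
    unfold deg at *
    omega
  have ht := type_mem d ((forall_pos_two h2 fun x => M.k x ≤ 4).mpr ⟨by omega, by omega⟩)
  rw [cnt_pos, cnt_pos, card_pos_and_two h2, card_pos_and_two h2] at ht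
  simp [h, hk] at ht

lemma le_dot_quad {d : D} (h : M.k d = 4) : -0.684 ≤ M.dot d := by
  have h1 := quad_mul h
  have h2 := dot_quad_le (d := M.f d) (by rw [k_f, h])
  have h3 := neg_two_le_dot (M := M) d
  nlinarith

/-- The angle of a quadrilateral is bounded below by the gap, hence above by the angle next to it. -/
lemma cosine_quad {d : D} (h : M.k d = 4) : -0.5614 ≤ M.cosine d ∧ M.cosine d ≤ -0.0584 := by
  have h1 := dot_quad_le h
  have h2 := le_dot_quad h
  unfold cosine
  constructor <;> linarith

lemma sine_quad {d : D} (h : M.k d = 4) (hd : M.deg d ≠ 2) : 0.8275 ≤ M.sine d := by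
  have h1 := sq_add_sq (M := M) d
  obtain ⟨h2, h3⟩ := cosine_quad h
  have h4 := sine_pos hd (M := M) (by omega)
  nlinarith

lemma four_add_dot (d : D) : 4 + M.dot d = 5 + 3 * M.cosine d := by
  rw [dot_eq_cosine]
  ring

/-! ### Points with two triangles and two quadrilaterals -/

lemma tri_sq {x y : D} (hx : M.k x = 3) (hy : M.k y = 3) (hx2 : M.deg x ≠ 2)
    (hy2 : M.deg y ≠ 2) : M.angle x * M.angle y = ⟨-7 / 9, 4 * √2 / 9⟩ := by
  have h3 : √2 ^ 2 = (2 : ℝ) := Real.sq_sqrt (by norm_num)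
  apply Complex.ext
  · simp only [angle, Complex.mul_re, cosine_tri hx, cosine_tri hy, sine_tri hx hx2,
      sine_tri hy hy2]
    linear_combination (-4 / 9 : ℝ) * h3
  · simp only [angle, Complex.mul_im, cosine_tri hx, cosine_tri hy, sine_tri hx hx2,
      sine_tri hy hy2]
    ring

lemma re_of_mul_eq_one {z w : ℂ} (h : z * w = 1) (hz : z.re ^ 2 + z.im ^ 2 = 1) :
    w.re = z.re := by
  have h1 := congrArg Complex.re h
  have h2 := congrArg Complex.im h
  simp only [Complex.mul_re, Complex.mul_im, Complex.one_re, Complex.one_im] at h1 h2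
  have : w.re * (z.re ^ 2 + z.im ^ 2) = z.re := by linear_combination z.re * h1 + z.im * h2
  rw [hz, mul_one] at this
  exact this

/-- Two quadrilaterals `x`, `y` and two triangles `a`, `b` around a point, in any order. -/
lemma quads_mul_le {x y a b : D} (hx : M.k x = 4) (hy : M.k y = 4) (ha : M.k a = 3)
    (hb : M.k b = 3) (ha2 : M.deg a ≠ 2) (hb2 : M.deg b ≠ 2)
    (h : M.angle a * M.angle b * (M.angle x * M.angle y) = 1) :
    (4 + M.dot x) * (4 + M.dot y) ≤ 16 ∧
      (16 ≤ (4 + M.dot x) * (4 + M.dot y) → M.dot x = 0 ∧ M.dot y = 0) := by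
  rw [tri_sq ha hb ha2 hb2] at h
  have h3 : √2 ^ 2 = (2 : ℝ) := Real.sq_sqrt (by norm_num)
  have h4 := re_of_mul_eq_one h (by simp only; linear_combination (16 / 81 : ℝ) * h3)
  simp only [angle, Complex.mul_re] at h4
  have h5 := two_triangles_mul_le (two_triangles_relation (sq_add_sq x) (sq_add_sq y) h4)
    (by linarith [(cosine_quad hx).2]) (by linarith [(cosine_quad hy).2])
  rw [← four_add_dot, ← four_add_dot] at h5
  refine ⟨h5.1, fun h6 => ?_⟩
  obtain ⟨h7, h8⟩ := h5.2 h6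
  rw [dot_eq_cosine, dot_eq_cosine, h7, h8]
  norm_num

lemma angle_mul_four {d : D} (h : M.deg d = 4) :
    M.angle d * M.angle (M.n d) * M.angle (M.n (M.n d)) * M.angle (M.n (M.n (M.n d))) = 1 := by
  rw [angle_mul_three, angle_eq, n4 h, M.pos_n, M.pos_n, M.pos_n,
    corner_mul (M.norm d) (M.norm_head _) (M.inner_head d) (M.inner_head_nnn d) (M.inner_head d),
    corner_self (M.norm_head d)]

/-- Two adjacent quadrilaterals at a point with two triangles. -/
lemma adjacent_quads_mul_le {d : D} (h : M.deg d = 4) (h0 : M.k d = 4) (h1 : M.k (M.n d) = 4)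
    (h2 : M.k (M.n (M.n d)) = 3) (h3 : M.k (M.n (M.n (M.n d))) = 3) :
    (4 + M.dot d) * (4 + M.dot (M.n d)) ≤ 16 ∧
      (16 ≤ (4 + M.dot d) * (4 + M.dot (M.n d)) → M.dot d = 0 ∧ M.dot (M.n d) = 0) := by
  apply quads_mul_le h0 h1 h2 h3 (by simp only [deg_n]; omega) (by simp only [deg_n]; omega)
  rw [← angle_mul_four h]
  ring

/-- Two opposite quadrilaterals at a point with two triangles. -/
lemma opposite_quads_mul_le {d : D} (h : M.deg d = 4) (h0 : M.k d = 4) (h1 : M.k (M.n d) = 3)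
    (h2 : M.k (M.n (M.n d)) = 4) (h3 : M.k (M.n (M.n (M.n d))) = 3) :
    (4 + M.dot d) * (4 + M.dot (M.n (M.n d))) ≤ 16 ∧
      (16 ≤ (4 + M.dot d) * (4 + M.dot (M.n (M.n d))) →
        M.dot d = 0 ∧ M.dot (M.n (M.n d)) = 0) := by
  apply quads_mul_le h0 h2 h1 h3 (by simp only [deg_n]; omega) (by simp only [deg_n]; omega)
  rw [← angle_mul_four h]
  ring

/-- The point of a dart has four contacts, the quadrilaterals being on both sides of the dart. -/
def IsQQ (M : ContactMap D) (d : D) : Prop :=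
  M.deg d = 4 ∧ M.k d = 4 ∧ M.k (M.n d) = 3 ∧ M.k (M.n (M.n d)) = 3 ∧
    M.k (M.n (M.n (M.n d))) = 4

lemma IsQQ.mul_le {d : D} (h : M.IsQQ d) :
    (4 + M.dot (M.n (M.n (M.n d)))) * (4 + M.dot d) ≤ 16 ∧
      (16 ≤ (4 + M.dot (M.n (M.n (M.n d)))) * (4 + M.dot d) →
        M.dot (M.n (M.n (M.n d))) = 0 ∧ M.dot d = 0) := by
  obtain ⟨h4, h0, h1, h2, h3⟩ := h
  have := adjacent_quads_mul_le (M := M) (d := M.n (M.n (M.n d))) (by simp only [deg_n]; omega) h3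
    (by rw [n4 h4]; exact h0) (by rw [n4 h4]; exact h1) (by rw [n4 h4]; exact h2)
  rwa [n4 h4] at this

/-- A dart between two quadrilaterals both of whose ends have two triangles: the quadrilaterals are
squares. The products in `IsQQ.mul_le` are at most `16` at both ends, and multiply to `16 ^ 2` by
`quad_mul`. -/
lemma squares_of_QQ {d : D} (h : M.IsQQ d) (h' : M.IsQQ (M.e d)) :
    M.dot d = 0 ∧ M.dot (M.n (M.n (M.n d))) = 0 := by
  set y := M.n (M.n (M.n d)) with hy
  have hny : M.n y = d := n4 h.1
  have hky : M.k y = 4 := h.2.2.2.2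
  -- the quadrilaterals continue at the other end
  have e1 : M.n (M.n (M.n (M.e d))) = M.f d := nnn_eq h'.1 (n_f M d)
  have e2 : M.f (M.e d) = y := by rw [← hny, f_e_n]
  have m1 := h.mul_le
  have m2 := h'.mul_le
  have q1 := quad_mul h.2.1
  have q2 := quad_mul h'.2.1
  rw [e1] at m2
  rw [e2] at q2
  rw [← hy] at m1
  have p1 := neg_two_le_dot (M := M) d
  have p2 := neg_two_le_dot (M := M) y
  have p3 := neg_two_le_dot (M := M) (M.f d)
  have p4 := neg_two_le_dot (M := M) (M.e d)
  have h16 : 16 ≤ (4 + M.dot y) * (4 + M.dot d) := by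
    by_contra hc
    push Not at hc
    have h5 : ((4 + M.dot y) * (4 + M.dot d)) * ((4 + M.dot (M.f d)) * (4 + M.dot (M.e d))) =
        256 := by linear_combination ((4 + M.dot (M.e d)) * (4 + M.dot y)) * q1 + 16 * q2
    have h6 : 0 < (4 + M.dot (M.f d)) * (4 + M.dot (M.e d)) :=
      mul_pos (by linarith) (by linarith)
    nlinarith [m2.1]
  exact (m1.2 h16).symm

/-- A point with three quadrilaterals does not touch a point with two triangles. -/
lemma not_QQ_of_three_quads {d : D} (hd : M.deg d = 3) (h0 : M.k d = 4) (h1 : M.k (M.n d) = 4)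
    (h2 : M.k (M.n (M.n d)) = 4) : ¬ M.IsQQ (M.e d) := by
  intro h'
  have e1 : M.n (M.n (M.n (M.e d))) = M.f d := nnn_eq h'.1 (n_f M d)
  set y := M.n (M.n d) with hy
  have hny : M.n y = d := n3 hd
  have e2 : M.f (M.e d) = y := by rw [← hny, f_e_n]
  have m2 := h'.mul_le.1
  have q1 := quad_mul h0
  have q2 := quad_mul h'.2.1
  rw [e1] at m2
  rw [e2] at q2
  have hy3 : M.deg y = 3 := by rw [hy, deg_n, deg_n, hd]
  have hnd : M.deg (M.n d) = 3 := by rw [deg_n, hd]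
  have h3 := dot_of_deg_three hnd
  rw [← hy, hny] at h3
  have h4 := (cosine_quad h1).1
  rw [cosine, h3] at h4
  simp only [angle, Complex.mul_re] at h4
  have h5 := two_angles_mul_lt (sq_add_sq y) (sq_add_sq d) (cosine_quad h2).1
    (by linarith [(cosine_quad h2).2]) (cosine_quad h0).1 (by linarith [(cosine_quad h0).2])
    (sine_pos (by omega) (by omega)).le (sine_pos (by omega) (by omega)).le (by linarith)
  rw [← four_add_dot, ← four_add_dot] at h5
  have p1 := neg_two_le_dot (M := M) d
  have p2 := neg_two_le_dot (M := M) y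
  have p3 := neg_two_le_dot (M := M) (M.f d)
  have p4 := neg_two_le_dot (M := M) (M.e d)
  have h6 : ((4 + M.dot y) * (4 + M.dot d)) * ((4 + M.dot (M.f d)) * (4 + M.dot (M.e d))) =
      256 := by linear_combination ((4 + M.dot (M.e d)) * (4 + M.dot y)) * q1 + 16 * q2
  have h7 : 0 < (4 + M.dot y) * (4 + M.dot d) := mul_pos (by linarith) (by linarith)
  nlinarith

end ContactMap

namespace ContactMap

variable {D : Type} [Fintype D] {M : ContactMap D} {fc : ℕ → ℕ}

/-! ### Six triangles and seven quadrilaterals -/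

lemma sum_eq_add_card_filter (S : Finset Space) (g : Space → ℕ) (a : ℕ)
    (h : ∀ v ∈ S, g v = a ∨ g v = a + 1) :
    ∑ v ∈ S, g v = a * S.card + (S.filter fun v => g v = a + 1).card := by
  rw [Finset.card_filter, mul_comm, ← smul_eq_mul, ← Finset.sum_const, ← Finset.sum_add_distrib]
  apply Finset.sum_congr rfl
  intro v hv
  rcases h v hv with h1 | h1 <;> simp [h1]

/-- The point of a dart has no face with more than four darts. -/
def Small (M : ContactMap D) (d : D) : Prop := ∀ d', M.pos d' = M.pos d → M.k d' ≤ 4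

lemma Small.k_eq {d : D} (h : M.Small d) : M.k d = 3 ∨ M.k d = 4 := by
  have := h d rfl
  have := M.three_le_k d
  omega

lemma Small.n {d : D} (h : M.Small d) : M.Small (M.n d) := fun d' hd' => h d' (by rwa [M.pos_n] at hd')

lemma Small.of_pos {d d' : D} (h : M.Small d) (hp : M.pos d' = M.pos d) : M.Small d' :=
  fun x hx => h x (hx.trans hp)

/-- A point without large faces has three quadrilaterals, or four faces with two or three
quadrilaterals among them. -/
lemma Small.cases {d : D} (h : M.Small d) :
    (M.deg d = 3 ∧ M.k d = 4 ∧ M.k (M.n d) = 4 ∧ M.k (M.n (M.n d)) = 4) ∨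
    (M.deg d = 4 ∧ (M.k d + M.k (M.n d) + M.k (M.n (M.n d)) + M.k (M.n (M.n (M.n d))) = 14 ∨
      M.k d + M.k (M.n d) + M.k (M.n (M.n d)) + M.k (M.n (M.n (M.n d))) = 15)) := by
  have ht := type_mem d h
  have h0 := h.k_eq
  have h1 := h.n.k_eq
  have h2 := h.n.n.k_eq
  have h3 := h.n.n.n.k_eq
  rcases deg_cases (M := M) d with hd | hd | hd
  · rw [cnt_pos, cnt_pos, card_pos_and_two hd, card_pos_and_two hd] at ht
    rcases h0 with h0 | h0 <;> rcases h1 with h1 | h1 <;> simp [h0, h1] at ht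
  · rw [cnt_pos, cnt_pos, card_pos_and_three hd, card_pos_and_three hd] at ht
    rcases h0 with h0 | h0 <;> rcases h1 with h1 | h1 <;> rcases h2 with h2 | h2 <;>
      simp [h0, h1, h2, hd] at ht ⊢
  · rw [cnt_pos, cnt_pos, card_pos_and_four hd, card_pos_and_four hd] at ht
    rcases h0 with h0 | h0 <;> rcases h1 with h1 | h1 <;> rcases h2 with h2 | h2 <;>
      rcases h3 with h3 | h3 <;> simp [h0, h1, h2, h3, hd] at ht ⊢

lemma Small.cnt_four {d : D} (h : M.Small d) :
    M.cnt (· = 4) (M.pos d) = 2 ∨ M.cnt (· = 4) (M.pos d) = 3 := by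
  have ht := type_mem d h
  simp only [List.mem_cons, Prod.mk.injEq, List.not_mem_nil, or_false] at ht
  omega

/-- A point between two quadrilaterals is not of type `(2, 2)` if it touches a point with three
quadrilaterals. -/
lemma cnt_head_of_three_quads {d : D} (hd : M.deg d = 3) (h0 : M.k d = 4) (h1 : M.k (M.n d) = 4)
    (h2 : M.k (M.n (M.n d)) = 4) (hs : M.Small (M.e d)) : M.cnt (· = 4) (M.head d) = 3 := by
  have hq := not_QQ_of_three_quads hd h0 h1 h2
  have k0 : M.k (M.e d) = 4 := by
    have := M.k_e_n (M.n (M.n d))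
    rw [n3 hd] at this
    rw [this, h2]
  have k1 : M.k (M.f d) = 4 := by rw [k_f, h0]
  rcases hs.cnt_four with h3 | h3
  · exfalso
    have hc := hs.cases
    rw [cnt_pos] at h3
    rcases hc with ⟨hd', a0, a1, a2⟩ | ⟨hd', a⟩
    · rw [card_pos_and_three hd'] at h3
      simp [a0, a1, a2] at h3
    · have e1 := nnn_eq hd' (n_f M d)
      rw [card_pos_and_four hd'] at h3
      have b1 := hs.n.k_eq
      have b2 := hs.n.n.k_eq
      rw [e1] at h3 a
      apply hq
      refine ⟨hd', k0, ?_, ?_, by rw [e1, k1]⟩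
      · rcases b1 with b1 | b1 <;> rcases b2 with b2 | b2 <;> simp [k0, k1, b1, b2] at h3 ⊢
      · rcases b1 with b1 | b1 <;> rcases b2 with b2 | b2 <;> simp [k0, k1, b1, b2] at h3 ⊢
  · exact h3

lemma mem_points (d : D) : M.pos d ∈ Finset.univ.image M.pos :=
  Finset.mem_image_of_mem _ (Finset.mem_univ _)

/-- Four points have three quadrilaterals, and two of them have no other face. Each of these two touches
the other three of the four, which gives three mutually touching points across a quadrilateral. -/
lemma IsTame.not_six_seven (h : M.IsTame fc) (hD : Fintype.card D = 46) (h4 : fc 4 = 7)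
    (h5 : fc 5 = 0) (h6 : fc 6 = 0) (h7 : fc 7 = 0) (h8 : fc 8 = 0) : False := by
  have hk := k_le_four_of_count h h5 h6 h7 h8
  have hs : ∀ d, M.Small d := fun d d' _ => by rcases hk d' with h | h <;> omega
  -- the points with three quadrilaterals, and those with three contacts
  set X := (Finset.univ.image M.pos).filter fun v => M.cnt (· = 4) v = 2 + 1 with hX
  have hXc : X.card = 4 := by
    have h1 : ∑ v ∈ Finset.univ.image M.pos, M.cnt (· = 4) v =
        2 * (Finset.univ.image M.pos).card + X.card := sum_eq_add_card_filter _ _ 2 (by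
      intro v hv
      simp only [Finset.mem_image, Finset.mem_univ, true_and] at hv
      obtain ⟨x, rfl⟩ := hv
      exact (hs x).cnt_four)
    rw [← M.card_filter_k_eq_sum, h.card_k 4, h4, h.card_nodes] at h1
    omega
  set Y := (Finset.univ.image M.pos).filter fun v =>
    (Finset.univ.filter fun d => M.pos d = v).card = 3 + 1 with hY
  have hYc : Y.card = 10 := by
    have h1 : ∑ v ∈ Finset.univ.image M.pos, (Finset.univ.filter fun d => M.pos d = v).card =
        3 * (Finset.univ.image M.pos).card + Y.card := sum_eq_add_card_filter _ _ 3 (by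
      intro v hv
      simp only [Finset.mem_image, Finset.mem_univ, true_and] at hv
      obtain ⟨x, rfl⟩ := hv
      rw [card_pos_eq]
      rcases (hs x).cases with h | h
      · exact Or.inl h.1
      · exact Or.inr h.1)
    rw [← M.card_eq_sum_deg, h.card_nodes, hD] at h1
    omega
  have hYc' : 1 < ((Finset.univ.image M.pos) \ Y).card := by
    rw [Finset.card_sdiff_of_subset (Finset.filter_subset _ _), h.card_nodes, hYc]
    norm_num
  have hY3 : ∀ v ∈ (Finset.univ.image M.pos) \ Y, ∃ d, M.pos d = v ∧ M.deg d = 3 := by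
    intro v hv
    simp only [hY, Finset.mem_sdiff, Finset.mem_filter, not_and] at hv
    obtain ⟨hv, hv'⟩ := hv
    have h1 := hv' hv
    simp only [Finset.mem_image, Finset.mem_univ, true_and] at hv
    obtain ⟨x, rfl⟩ := hv
    rw [card_pos_eq] at h1
    refine ⟨x, rfl, ?_⟩
    rcases (hs x).cases with h | h
    · exact h.1
    · exact absurd h.1 h1
  -- a point with three contacts touches the other three points with three quadrilaterals
  have key : ∀ d, M.deg d = 3 → M.k d = 4 ∧ M.k (M.n d) = 4 ∧ M.pos d ∈ X ∧
      X = {M.pos d, M.head d, M.head (M.n d), M.head (M.n (M.n d))} := by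
    intro d hd
    have hd1 : M.deg (M.n d) = 3 := by rw [deg_n, hd]
    have hd2 : M.deg (M.n (M.n d)) = 3 := by rw [deg_n, hd1]
    rcases (hs d).cases with ⟨-, k0, k1, k2⟩ | h1
    · have c0 := cnt_head_of_three_quads hd k0 k1 k2 (hs _)
      have c1 := cnt_head_of_three_quads hd1 k1 k2 (by rw [n3 hd, k0]) (hs _)
      have c2 := cnt_head_of_three_quads hd2 k2 (by rw [n3 hd, k0]) (by rw [n3 hd, k1]) (hs _)
      have c3 : M.cnt (· = 4) (M.pos d) = 3 := by
        rw [cnt_pos, card_pos_and_three hd]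
        simp [k0, k1, k2]
      have m3 : M.pos d ∈ X := Finset.mem_filter.mpr ⟨mem_points d, c3⟩
      refine ⟨k0, k1, m3, ?_⟩
      symm
      apply Finset.eq_of_subset_of_card_le
      · intro v hv
        simp only [Finset.mem_insert, Finset.mem_singleton] at hv
        rcases hv with rfl | rfl | rfl | rfl
        · exact m3
        · exact Finset.mem_filter.mpr ⟨mem_points _, c0⟩
        · exact Finset.mem_filter.mpr ⟨mem_points _, c1⟩
        · exact Finset.mem_filter.mpr ⟨mem_points _, c2⟩
      · rw [hXc]
        have n0 := head_ne_pos (M := M) d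
        have n1 := head_ne_pos (M := M) (M.n d)
        have n2 := head_ne_pos (M := M) (M.n (M.n d))
        rw [M.pos_n] at n1
        rw [M.pos_n, M.pos_n] at n2
        have m0 := head_n_ne (M := M) d
        have m1 := head_n_ne (M := M) (M.n d)
        have m2 := head_n_ne (M := M) (M.n (M.n d))
        rw [n3 hd] at m2
        rw [Finset.card_insert_of_notMem, Finset.card_insert_of_notMem,
          Finset.card_insert_of_notMem, Finset.card_singleton]
        · simpa using m1.symm
        · simp only [Finset.mem_insert, Finset.mem_singleton, not_or]
          exact ⟨m0.symm, m2⟩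
        · simp only [Finset.mem_insert, Finset.mem_singleton, not_or]
          exact ⟨n0.symm, n1.symm, n2.symm⟩
    · omega
  obtain ⟨v, hv, u, hu, hne⟩ := Finset.one_lt_card.mp hYc'
  obtain ⟨d, rfl, hd⟩ := hY3 v hv
  obtain ⟨d', rfl, hd'⟩ := hY3 u hu
  obtain ⟨-, -, -, hXd⟩ := key d hd
  obtain ⟨-, -, hm, hXd'⟩ := key d' hd'
  -- choose the dart from the one to the other
  obtain ⟨x, hx, hxh⟩ : ∃ x, M.pos x = M.pos d ∧ M.head x = M.pos d' := by
    rw [hXd] at hm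
    simp only [Finset.mem_insert, Finset.mem_singleton] at hm
    rcases hm with hm | hm | hm | hm
    · exact absurd hm.symm hne
    · exact ⟨d, rfl, hm.symm⟩
    · exact ⟨M.n d, M.pos_n d, hm.symm⟩
    · exact ⟨M.n (M.n d), by rw [M.pos_n, M.pos_n], hm.symm⟩
  obtain ⟨kx, -, -, hXx⟩ := key x (by rw [deg_eq_of_pos hx, hd])
  have hmem : M.head (M.n x) ∈ X := by
    rw [hXx]
    simp
  rw [hXd'] at hmem
  have hcon : ⟪M.pos d', M.head (M.n x)⟫ = 2 := by
    simp only [Finset.mem_insert, Finset.mem_singleton] at hmem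
    rcases hmem with hm | hm | hm | hm
    · exact absurd (hm.trans hxh.symm) (head_n_ne x)
    · rw [hm]
      exact M.inner_head d'
    · rw [hm]
      exact M.inner_head_n d'
    · rw [hm]
      exact M.inner_head_nn d'
  rw [← hxh] at hcon
  have := dot_quad_le kx
  rw [dot, hcon] at this
  norm_num at this

end ContactMap

namespace ContactMap

variable {D : Type} [Fintype D] {M : ContactMap D} {fc : ℕ → ℕ}

/-! ### Reflection of a contact map -/

lemma face_conj (M : ContactMap D) : (M.n⁻¹)⁻¹ * M.e = M.n * M.f⁻¹ * M.n⁻¹ := by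
  have he : M.e⁻¹ = M.e := by
    apply inv_eq_of_mul_eq_one_left
    ext d
    exact M.e_e d
  rw [f, mul_inv_rev, inv_inv, he]
  group

lemma period_mirror (M : ContactMap D) (d : D) :
    Function.minimalPeriod ((M.n⁻¹)⁻¹ * M.e) d = M.k (M.n⁻¹ d) := by
  rw [k, ← ncard_sameCycle, ← ncard_sameCycle, face_conj,
    ← Set.ncard_image_of_injective {y | M.f.SameCycle (M.n⁻¹ d) y} M.n.injective]
  congr 1
  ext y
  rw [Set.mem_image]
  change (M.n * M.f⁻¹ * M.n⁻¹).SameCycle d y ↔ ∃ x, M.f.SameCycle (M.n⁻¹ d) x ∧ M.n x = y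
  rw [Equiv.Perm.sameCycle_conj, Equiv.Perm.sameCycle_inv]
  constructor
  · intro h
    exact ⟨_, h, by simp⟩
  · rintro ⟨x, hx, rfl⟩
    simpa using hx

lemma n_n_inv (M : ContactMap D) (d : D) : M.n (M.n⁻¹ d) = d := by simp

lemma n_inv_n (M : ContactMap D) (d : D) : M.n⁻¹ (M.n d) = d := by simp

lemma period_n_inv (M : ContactMap D) (d : D) :
    Function.minimalPeriod (M.n⁻¹ : Equiv.Perm D) d = M.deg d := by
  rw [deg, ← ncard_sameCycle, ← ncard_sameCycle]
  simp only [Equiv.Perm.sameCycle_inv]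

lemma pos_n_inv (M : ContactMap D) (d : D) : M.pos (M.n⁻¹ d) = M.pos d := by
  rw [← M.pos_n, n_n_inv]

lemma card_n_inv (M : ContactMap D) (P : D → Prop) [DecidablePred P] :
    (Finset.univ.filter fun d => P (M.n⁻¹ d)).card = (Finset.univ.filter fun d => P d).card := by
  refine Finset.card_bij (fun d _ => M.n⁻¹ d) ?_ ?_ ?_
  · simp
  · simp
  · intro b hb
    exact ⟨M.n b, by simpa using hb, by simp⟩

lemma det3_neg (u v w : Space) : det3 (-u) (-v) (-w) = det3 u w v := by
  simp only [det3, Matrix.det_fin_three, Matrix.of_apply, Matrix.cons_val]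
  simp
  ring

/-- The reflection of a contact map in the origin, which reverses the orientation. The corner
of `d` in the reflection is the corner of `n⁻¹ d` in the original. -/
noncomputable def mirror (M : ContactMap D) : ContactMap D where
  e := M.e
  n := M.n⁻¹
  pos d := - M.pos d
  e_e := M.e_e
  pos_n d := by rw [M.pos_n_inv]
  same_node d d' h := (M.same_node d d' (neg_injective h)).inv
  simple d d' h h' := by
    rw [face_conj, Equiv.Perm.sameCycle_conj, Equiv.Perm.sameCycle_inv] at h
    exact M.n⁻¹.injective (M.simple _ _ h (by rw [M.pos_n_inv, M.pos_n_inv]; exact neg_injective h'))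
  inj d d' h h' := M.inj d d' (neg_injective h) (neg_injective h')
  norm d := by rw [inner_neg_neg, M.norm]
  contact d := by rw [inner_neg_neg, M.contact]
  gap d d' h := by
    rw [inner_neg_neg]
    simpa using M.gap d d' fun h' => h (by rw [h'])
  two_le_deg d := by
    rw [period_n_inv]
    exact M.two_le_deg d
  deg_le_four d := by
    rw [period_n_inv]
    exact M.deg_le_four d
  three_le_face d := by
    rw [period_mirror]
    exact M.three_le_k _
  tri d h := by
    rw [inner_neg_neg, real_inner_comm] at h
    rw [period_mirror, period_mirror]
    have := M.tri (M.n⁻¹ d) (by rwa [n_n_inv])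
    rw [n_n_inv] at this
    change M.k _ = 3 ∨ _ ∧ M.k _ = 3 at this
    rcases this with h1 | ⟨h1, h2⟩
    · exact Or.inl h1
    · have h3 : M.n⁻¹ (M.n⁻¹ d) = d := by rw [← h1, n_inv_n]
      exact Or.inr ⟨h3, by rw [h3]; exact h2⟩
  convex d h h' := by
    rw [period_mirror] at h'
    rw [det3_neg]
    have := M.convex (M.n⁻¹ d) (fun h1 => h (by
      rw [n_n_inv] at h1
      rw [← h1, n_inv_n])) h'
    rwa [n_n_inv, M.pos_n_inv] at this
  type d h := by
    simp only [period_mirror, neg_inj] at h ⊢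
    have := M.type d fun d' hd' => by
      have := h (M.n d') (by rw [M.pos_n, hd'])
      rw [n_inv_n] at this
      exact this
    have h3 := M.card_n_inv fun d' => M.pos d' = M.pos d ∧ M.k d' = 3
    have h4 := M.card_n_inv fun d' => M.pos d' = M.pos d ∧ M.k d' = 4
    simp only [M.pos_n_inv] at h3 h4
    rw [h3, h4]
    exact this

lemma mirror_e (d : D) : M.mirror.e d = M.e d := rfl

lemma mirror_n (d : D) : M.mirror.n d = M.n⁻¹ d := rfl

lemma mirror_k (d : D) : M.mirror.k d = M.k (M.n⁻¹ d) := M.period_mirror d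

lemma mirror_k_n (d : D) : M.mirror.k (M.n d) = M.k d := by
  rw [mirror_k, n_inv_n]

lemma mirror_deg (d : D) : M.mirror.deg d = M.deg d := M.period_n_inv d

lemma mirror_f_n_f (d : D) : M.mirror.f (M.n (M.f d)) = M.n d := by
  apply M.mirror.n.injective
  rw [M.mirror.n_f, mirror_e, mirror_n, n_f, M.e_e, n_inv_n]

/-! ### Contact maps with a single pentagon -/

/-- A contact map with seven triangles, five quadrilaterals and one pentagon. -/
structure IsPentagonal (M : ContactMap D) : Prop where
  k_eq : ∀ d, M.k d = 3 ∨ M.k d = 4 ∨ M.k d = 5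
  card_four : (Finset.univ.filter fun d => M.k d = 4).card = 20
  card_five : (Finset.univ.filter fun d => M.k d = 5).card = 5
  card_darts : Fintype.card D = 46
  card_nodes : (Finset.univ.image M.pos).card = 12

lemma IsPentagonal.mirror (P : M.IsPentagonal) : M.mirror.IsPentagonal where
  k_eq d := by
    rw [mirror_k]
    exact P.k_eq _
  card_four := by
    simp only [mirror_k]
    rw [M.card_n_inv fun d => M.k d = 4, P.card_four]
  card_five := by
    simp only [mirror_k]
    rw [M.card_n_inv fun d => M.k d = 5, P.card_five]
  card_darts := P.card_darts
  card_nodes := by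
    have : Finset.univ.image M.mirror.pos = (Finset.univ.image M.pos).image fun v => -v := by
      rw [Finset.image_image]
      rfl
    rw [this, Finset.card_image_of_injective _ neg_injective, P.card_nodes]

lemma pos_f_iterate_injOn {d : D} :
    Set.InjOn (fun i => M.pos (M.f^[i] d)) (Finset.range (M.k d)) := by
  intro i hi j hj hij
  simp only [Finset.coe_range, Set.mem_Iio] at hi hj
  apply Function.iterate_injOn_Iio_minimalPeriod (f := M.f) (x := d) hi hj
  apply M.simple _ _ _ hij
  have h1 : ∀ i, M.f.SameCycle d (M.f^[i] d) := fun i =>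
    ⟨i, by rw [zpow_natCast, Equiv.Perm.coe_pow]⟩
  exact (h1 i).symm.trans (h1 j)

lemma k_f_iterate (d : D) (i : ℕ) : M.k (M.f^[i] d) = M.k d := by
  induction i with
  | zero => rfl
  | succ i ih => rw [Function.iterate_succ_apply', k_f, ih]

/-- There is only one pentagon. -/
lemma IsPentagonal.eq_iterate (P : M.IsPentagonal) {d x : D} (hd : M.k d = 5) (hx : M.k x = 5) :
    ∃ i < 5, M.f^[i] d = x := by
  have h : ((Finset.range 5).image fun i => M.f^[i] d) = Finset.univ.filter fun x => M.k x = 5 := by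
    apply Finset.eq_of_subset_of_card_le
    · intro x hx
      simp only [Finset.mem_image] at hx
      obtain ⟨i, -, rfl⟩ := hx
      simp [k_f_iterate, hd]
    · rw [P.card_five, Finset.card_image_of_injOn, Finset.card_range]
      intro i hi j hj hij
      exact pos_f_iterate_injOn (by rwa [hd]) (by rwa [hd]) (congrArg M.pos hij)
  have hx' : x ∈ Finset.univ.filter fun x => M.k x = 5 := by simp [hx]
  rw [← h] at hx'
  simpa using hx'

lemma IsPentagonal.eq_of_pos (P : M.IsPentagonal) {d x : D} (hd : M.k d = 5) (hx : M.k x = 5)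
    (h : M.pos x = M.pos d) : x = d := by
  obtain ⟨i, hi, rfl⟩ := P.eq_iterate hd hx
  have := pos_f_iterate_injOn (M := M) (d := d) (x₁ := i) (x₂ := 0) (by simpa [hd] using hi)
    (by simp [hd]) h
  rw [this]
  rfl

lemma IsPentagonal.small (P : M.IsPentagonal) {x : D} (h : ∀ y, M.pos y = M.pos x → M.k y ≠ 5) :
    M.Small x := fun y hy => by
  have := P.k_eq y
  have := h y hy
  omega

/-- The number of contacts and quadrilaterals at a point. The loads add up to `46 + 4 * 5 = 66`, and a
point away from the pentagon has a load of at least `6`, so that the pentagon has a load of at most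
`24`. -/
noncomputable def load (M : ContactMap D) (v : Space) : ℕ :=
  (Finset.univ.filter fun d => M.pos d = v).card + M.cnt (· = 4) v

lemma load_small {x : D} (h : M.Small x) : 6 ≤ M.load (M.pos x) := by
  rw [load, card_pos_eq]
  have h4 := h.cnt_four
  rcases h.cases with ⟨hd, a0, a1, a2⟩ | ⟨hd, a⟩
  · rw [cnt_pos, card_pos_and_three hd, hd]
    simp [a0, a1, a2]
  · omega

/-- The points away from the pentagon. -/
noncomputable def others (M : ContactMap D) (d : D) : Finset Space :=
  Finset.univ.image M.pos \ (Finset.range 5).image fun i => M.pos (M.f^[i] d)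

lemma sum_others {d : D} (hd : M.k d = 5) (g : Space → ℕ) :
    ∑ v ∈ Finset.univ.image M.pos, g v = ∑ v ∈ M.others d, g v +
      ∑ i ∈ Finset.range 5, g (M.pos (M.f^[i] d)) := by
  have hs : ((Finset.range 5).image fun i => M.pos (M.f^[i] d)) ⊆ Finset.univ.image M.pos := by
    intro v hv
    simp only [Finset.mem_image] at hv
    obtain ⟨i, -, rfl⟩ := hv
    exact mem_points _
  rw [others, ← Finset.sum_sdiff hs]
  congr 1
  rw [Finset.sum_image]
  rw [← hd]
  exact pos_f_iterate_injOn

lemma IsPentagonal.card_others (P : M.IsPentagonal) {d : D} (hd : M.k d = 5) :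
    (M.others d).card = 7 := by
  have := sum_others hd fun _ => 1
  simp [P.card_nodes] at this
  omega

lemma IsPentagonal.small_of_mem (P : M.IsPentagonal) {d : D} (hd : M.k d = 5) {v : Space}
    (hv : v ∈ M.others d) : ∃ x, M.pos x = v ∧ M.Small x := by
  simp only [others, Finset.mem_sdiff, Finset.mem_image, Finset.mem_univ, true_and,
    Finset.mem_range, not_exists, not_and] at hv
  obtain ⟨⟨x, rfl⟩, h⟩ := hv
  refine ⟨x, rfl, P.small fun y hy hy5 => ?_⟩
  obtain ⟨i, hi, rfl⟩ := P.eq_iterate hd hy5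
  exact h i hi hy

lemma mem_others {d : D} (hd : M.k d = 5) {x : D}
    (h : M.Small x) : M.pos x ∈ M.others d := by
  simp only [others, Finset.mem_sdiff, Finset.mem_image, Finset.mem_univ, true_and,
    Finset.mem_range, not_exists, not_and]
  refine ⟨⟨x, rfl⟩, fun i hi hx => ?_⟩
  have := h _ hx
  rw [k_f_iterate, hd] at this
  omega

lemma IsPentagonal.sum_deg (P : M.IsPentagonal) {d : D} (hd : M.k d = 5) :
    46 = ∑ v ∈ M.others d, (Finset.univ.filter fun x => M.pos x = v).card +
      ∑ i ∈ Finset.range 5, M.deg (M.f^[i] d) := by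
  rw [← P.card_darts, M.card_eq_sum_deg, sum_others hd]
  simp only [card_pos_eq]

lemma IsPentagonal.sum_load (P : M.IsPentagonal) {d : D} (hd : M.k d = 5) :
    66 = ∑ v ∈ M.others d, M.load v + ∑ i ∈ Finset.range 5, M.load (M.pos (M.f^[i] d)) := by
  rw [← sum_others hd]
  simp only [load, Finset.sum_add_distrib]
  rw [← M.card_filter_k_eq_sum (· = 4), ← M.card_eq_sum_deg, P.card_four, P.card_darts]

lemma card_pos_le (x : D) : (Finset.univ.filter fun y => M.pos y = M.pos x).card ≤ 4 := by
  rw [card_pos_eq]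
  exact M.deg_le_four x

/-- The seven points away from the pentagon have at most `28` of the `46` darts. -/
lemma IsPentagonal.le_sum_deg (P : M.IsPentagonal) {d : D} (hd : M.k d = 5) :
    18 ≤ ∑ i ∈ Finset.range 5, M.deg (M.f^[i] d) := by
  have h1 := P.sum_deg hd
  have h2 : ∑ v ∈ M.others d, (Finset.univ.filter fun x => M.pos x = v).card ≤
      ∑ v ∈ M.others d, 4 := by
    apply Finset.sum_le_sum
    intro v hv
    obtain ⟨x, rfl, -⟩ := P.small_of_mem hd hv
    exact card_pos_le x
  rw [Finset.sum_const, P.card_others hd] at h2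
  simp only [smul_eq_mul] at h2
  omega

/-- In the extreme case of the previous bound, all points away from the pentagon have four contacts. -/
lemma IsPentagonal.deg_eq_four (P : M.IsPentagonal) {d : D} (hd : M.k d = 5)
    (h : ∑ i ∈ Finset.range 5, M.deg (M.f^[i] d) = 18) {x : D} (hx : M.Small x) :
    M.deg x = 4 := by
  by_contra hc
  have h1 := P.sum_deg hd
  have h2 : ∑ v ∈ M.others d, (Finset.univ.filter fun x => M.pos x = v).card <
      ∑ v ∈ M.others d, 4 := by
    apply Finset.sum_lt_sum
    · intro v hv
      obtain ⟨x, rfl, -⟩ := P.small_of_mem hd hv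
      exact card_pos_le x
    · refine ⟨M.pos x, mem_others hd hx, lt_of_le_of_ne (card_pos_le x) ?_⟩
      rwa [card_pos_eq]
  rw [Finset.sum_const, P.card_others hd] at h2
  simp only [smul_eq_mul] at h2
  omega

lemma IsPentagonal.sum_load_le (P : M.IsPentagonal) {d : D} (hd : M.k d = 5) :
    ∑ i ∈ Finset.range 5, M.load (M.pos (M.f^[i] d)) ≤ 24 := by
  have h1 := P.sum_load hd
  have h2 : ∑ v ∈ M.others d, 6 ≤ ∑ v ∈ M.others d, M.load v := by
    apply Finset.sum_le_sum
    intro v hv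
    obtain ⟨x, rfl, hx⟩ := P.small_of_mem hd hv
    exact load_small hx
  rw [Finset.sum_const, P.card_others hd] at h2
  simp only [smul_eq_mul] at h2
  omega

lemma IsPentagonal.load_le (P : M.IsPentagonal) {d : D} (hd : M.k d = 5) {x : D}
    (hx : M.Small x) :
    ∑ i ∈ Finset.range 5, M.load (M.pos (M.f^[i] d)) + M.load (M.pos x) ≤ 30 := by
  have h1 := P.sum_load hd
  have hm := mem_others hd hx
  rw [← Finset.add_sum_erase _ _ hm] at h1
  have h2 : ∑ v ∈ (M.others d).erase (M.pos x), 6 ≤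
      ∑ v ∈ (M.others d).erase (M.pos x), M.load v := by
    apply Finset.sum_le_sum
    intro v hv
    obtain ⟨x, rfl, hx⟩ := P.small_of_mem hd (Finset.mem_of_mem_erase hv)
    exact load_small hx
  rw [Finset.sum_const, Finset.card_erase_of_mem hm, P.card_others hd] at h2
  simp only [smul_eq_mul] at h2
  omega

lemma IsPentagonal.load_add_load_le (P : M.IsPentagonal) {d : D} (hd : M.k d = 5) {x y : D}
    (hx : M.Small x) (hy : M.Small y) (hne : M.pos x ≠ M.pos y) :
    ∑ i ∈ Finset.range 5, M.load (M.pos (M.f^[i] d)) + M.load (M.pos x) + M.load (M.pos y) ≤ 36 := by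
  have h1 := P.sum_load hd
  have hm := mem_others hd hx
  have hm' : M.pos y ∈ (M.others d).erase (M.pos x) :=
    Finset.mem_erase.mpr ⟨hne.symm, mem_others hd hy⟩
  rw [← Finset.add_sum_erase _ _ hm, ← Finset.add_sum_erase _ _ hm'] at h1
  have h2 : ∑ v ∈ ((M.others d).erase (M.pos x)).erase (M.pos y), 6 ≤
      ∑ v ∈ ((M.others d).erase (M.pos x)).erase (M.pos y), M.load v := by
    apply Finset.sum_le_sum
    intro v hv
    obtain ⟨x, rfl, hx⟩ := P.small_of_mem hd (Finset.mem_of_mem_erase (Finset.mem_of_mem_erase hv))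
    exact load_small hx
  rw [Finset.sum_const, Finset.card_erase_of_mem hm', Finset.card_erase_of_mem hm,
    P.card_others hd] at h2
  simp only [smul_eq_mul] at h2
  omega

end ContactMap

namespace ContactMap

variable {D : Type} [Fintype D] {M : ContactMap D} {fc : ℕ → ℕ}

/-! ### The angles of a pentagon -/

/-- The angles of a triangle and a quadrilateral add up to almost `π`, with cosine at most `-0.96`. -/
lemma re_tri_quad {x y : D} (hx : M.k x = 3) (hy : M.k y = 4) (hx2 : M.deg x ≠ 2)
    (hy2 : M.deg y ≠ 2) : (M.angle x * M.angle y).re ≤ -0.96 := by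
  obtain ⟨h1, h2⟩ := cosine_quad hy
  have h3 := sq_add_sq (M := M) y
  have h4 := sine_quad hy hy2
  have h5 : √2 ^ 2 = (2 : ℝ) := Real.sq_sqrt (by norm_num)
  have h6 : (0 : ℝ) < √2 := by positivity
  simp only [angle, Complex.mul_re, cosine_tri hx, sine_tri hx hx2]
  set c := M.cosine y
  set s := M.sine y
  have h7 : c + 2.88 ≤ 2 * √2 * s := by
    by_contra hc
    push Not at hc
    have h8 : 0 ≤ 2 * √2 * s := by positivity
    have h9 := mul_self_lt_mul_self h8 hc
    have h10 : 2 * √2 * s * (2 * √2 * s) = 8 * (1 - c ^ 2) := by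
      linear_combination 4 * s ^ 2 * h5 + 8 * h3
    nlinarith
  linarith

/-- The angles of two quadrilaterals add up to at least `π`. -/
lemma quad_quad {x y : D} (hx : M.k x = 4) (hy : M.k y = 4) (hx2 : M.deg x ≠ 2)
    (hy2 : M.deg y ≠ 2) : (M.angle x * M.angle y).re ≤ -0.36 ∧ (M.angle x * M.angle y).im ≤ 0 ∧
      -1 ≤ (M.angle x * M.angle y).re := by
  obtain ⟨a1, a2⟩ := cosine_quad hx
  obtain ⟨b1, b2⟩ := cosine_quad hy
  have a3 := sine_quad hx hx2
  have b3 := sine_quad hy hy2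
  have a4 := sq_add_sq (M := M) x
  have b4 := sq_add_sq (M := M) y
  simp only [angle, Complex.mul_re, Complex.mul_im]
  set c := M.cosine x
  set s := M.sine x
  set c' := M.cosine y
  set s' := M.sine y
  refine ⟨?_, ?_, ?_⟩
  · nlinarith [mul_nonneg (by linarith : 0 ≤ s - 0.8275) (by linarith : 0 ≤ s' - 0.8275),
      mul_nonneg (by linarith : 0 ≤ c + 0.5614) (by linarith : 0 ≤ -c')]
  · nlinarith [mul_nonneg (by linarith : 0 ≤ s) (by linarith : 0 ≤ -c'),
      mul_nonneg (by linarith : 0 ≤ s') (by linarith : 0 ≤ -c)]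
  · nlinarith [sq_nonneg (c + c'), sq_nonneg (s - s')]

lemma re_tri_tri_quad {x y z : D} (hx : M.k x = 3) (hy : M.k y = 3) (hz : M.k z = 4)
    (hx2 : M.deg x ≠ 2) (hy2 : M.deg y ≠ 2) (hz2 : M.deg z ≠ 2) :
    -1.75 / 3 ≤ (M.angle x * M.angle y * M.angle z).re := by
  obtain ⟨a1, a2⟩ := cosine_quad hz
  have a3 := sine_quad hz hz2
  have a4 := sq_add_sq (M := M) z
  rw [tri_sq hx hy hx2 hy2]
  simp only [angle, Complex.mul_re]
  set c := M.cosine z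
  set s := M.sine z
  have h1 : √2 ≤ (1.41422 : ℝ) := by
    rw [Real.sqrt_le_left (by norm_num)]
    norm_num
  have h2 : s ≤ 1 := by nlinarith
  have h3 : √2 * s ≤ 1.41422 := by nlinarith [Real.sqrt_nonneg 2]
  linarith

lemma re_tri_quad_quad {x y z : D} (hx : M.k x = 3) (hy : M.k y = 4) (hz : M.k z = 4)
    (hx2 : M.deg x ≠ 2) (hy2 : M.deg y ≠ 2) (hz2 : M.deg z ≠ 2) :
    -1 / 3 ≤ (M.angle x * (M.angle y * M.angle z)).re := by
  obtain ⟨-, h1, h2⟩ := quad_quad hy hz hy2 hz2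
  rw [Complex.mul_re]
  simp only [angle] at h1 h2 ⊢
  rw [cosine_tri hx, sine_tri hx hx2]
  nlinarith [Real.sqrt_nonneg 2]

lemma re_quad_quad_quad {x y z : D} (hx : M.k x = 4) (hy : M.k y = 4) (hz : M.k z = 4)
    (hx2 : M.deg x ≠ 2) (hy2 : M.deg y ≠ 2) (hz2 : M.deg z ≠ 2) :
    0 ≤ (M.angle x * (M.angle y * M.angle z)).re := by
  obtain ⟨h0, h1, h2⟩ := quad_quad hy hz hy2 hz2
  obtain ⟨a1, a2⟩ := cosine_quad hx
  have a3 := sine_quad hx hx2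
  rw [Complex.mul_re]
  set w := M.angle y * M.angle z
  simp only [angle]
  nlinarith [mul_nonneg (by linarith : 0 ≤ -M.cosine x) (by linarith : 0 ≤ -w.re),
    mul_nonneg (by linarith : 0 ≤ M.sine x) (by linarith : 0 ≤ -w.im)]

/-- The sequence of the faces around a vertex of a pentagon, the pentagon excepted, with `true` for
triangles. -/
noncomputable def spokes (M : ContactMap D) (d : D) : List Bool :=
  (List.range (M.deg d - 1)).map fun i => decide (M.k (M.n^[i + 1] d) = 3)

/-- The size of the faces encoded by `spokes`. -/
def side (b : Bool) : ℕ := bif b then 3 else 4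

lemma IsPentagonal.k_eq_side (P : M.IsPentagonal) {d x : D} (hd : M.k d = 5)
    (hx : M.pos x = M.pos d) (hne : x ≠ d) : M.k x = side (decide (M.k x = 3)) := by
  have h1 : M.k x ≠ 5 := fun h => hne (P.eq_of_pos hd h hx)
  rcases P.k_eq x with h | h | h <;> simp_all [side]

lemma IsPentagonal.spokes_cases (P : M.IsPentagonal) {d : D} (hd : M.k d = 5) :
    (∃ a, M.spokes d = [a] ∧ M.deg d = 2 ∧ M.k (M.n d) = side a) ∨
    (∃ a b, M.spokes d = [a, b] ∧ M.deg d = 3 ∧ M.k (M.n d) = side a ∧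
      M.k (M.n (M.n d)) = side b) ∨
    (∃ a b c, M.spokes d = [a, b, c] ∧ M.deg d = 4 ∧ M.k (M.n d) = side a ∧
      M.k (M.n (M.n d)) = side b ∧ M.k (M.n (M.n (M.n d))) = side c) := by
  have h1 := P.k_eq_side hd (M.pos_n d) (n_ne d)
  have h2 := fun h => P.k_eq_side (x := M.n (M.n d)) hd (by rw [M.pos_n, M.pos_n]) (nn_ne h)
  have h3 := fun h => P.k_eq_side (x := M.n (M.n (M.n d))) hd
    (by rw [M.pos_n, M.pos_n, M.pos_n]) (nnn_ne h)
  rcases deg_cases (M := M) d with h | h | h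
  · refine Or.inl ⟨_, ?_, h, h1⟩
    rw [spokes, h]
    rfl
  · refine Or.inr (Or.inl ⟨_, _, ?_, h, h1, h2 (by omega)⟩)
    rw [spokes, h]
    rfl
  · refine Or.inr (Or.inr ⟨_, _, _, ?_, h, h1, h2 (by omega), h3 h⟩)
    rw [spokes, h]
    rfl

lemma IsPentagonal.of_spokes_one (P : M.IsPentagonal) {d : D} (hd : M.k d = 5) {a : Bool}
    (h : M.spokes d = [a]) : M.deg d = 2 ∧ M.k (M.n d) = side a := by
  rcases P.spokes_cases hd with ⟨a, h1, h2⟩ | ⟨a, b, h1, h2⟩ | ⟨a, b, c, h1, h2⟩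
  all_goals
    rw [h] at h1
    simp only [List.cons.injEq, and_true, reduceCtorEq, and_false] at h1
  subst h1
  exact h2

lemma IsPentagonal.of_spokes_two (P : M.IsPentagonal) {d : D} (hd : M.k d = 5) {a b : Bool}
    (h : M.spokes d = [a, b]) : M.deg d = 3 ∧ M.k (M.n d) = side a ∧
      M.k (M.n (M.n d)) = side b := by
  rcases P.spokes_cases hd with ⟨a, h1, h2⟩ | ⟨a, b, h1, h2⟩ | ⟨a, b, c, h1, h2⟩
  all_goals
    rw [h] at h1
    simp only [List.cons.injEq, and_true, reduceCtorEq, and_false] at h1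
  obtain ⟨rfl, rfl⟩ := h1
  exact h2

lemma IsPentagonal.of_spokes_three (P : M.IsPentagonal) {d : D} (hd : M.k d = 5) {a b c : Bool}
    (h : M.spokes d = [a, b, c]) : M.deg d = 4 ∧ M.k (M.n d) = side a ∧
      M.k (M.n (M.n d)) = side b ∧ M.k (M.n (M.n (M.n d))) = side c := by
  rcases P.spokes_cases hd with ⟨a, h1, h2⟩ | ⟨a, b, h1, h2⟩ | ⟨a, b, c, h1, h2⟩
  all_goals
    rw [h] at h1
    simp only [List.cons.injEq, and_true, reduceCtorEq, and_false] at h1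
  obtain ⟨rfl, rfl, rfl⟩ := h1
  exact h2

lemma length_spokes (d : D) : (M.spokes d).length = M.deg d - 1 := by simp [spokes]

lemma IsPentagonal.count_spokes (P : M.IsPentagonal) {d : D} (hd : M.k d = 5) :
    (M.spokes d).count false = M.cnt (· = 4) (M.pos d) := by
  rcases P.spokes_cases hd with ⟨a, h1, h2, k1⟩ | ⟨a, b, h1, h2, k1, k2⟩ |
    ⟨a, b, c, h1, h2, k1, k2, k3⟩
  · rw [h1, cnt_pos, card_pos_and_two h2]
    cases a <;> simp [hd, k1, side]
  · rw [h1, cnt_pos, card_pos_and_three h2]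
    cases a <;> cases b <;> simp [hd, k1, k2, side]
  · rw [h1, cnt_pos, card_pos_and_four h2]
    cases a <;> cases b <;> cases c <;> simp [hd, k1, k2, k3, side]

/-- The neighbours of a vertex of the pentagon touch only if the triangle that they form with it is
the only other face there. -/
lemma IsPentagonal.dot_le (P : M.IsPentagonal) {d : D} (hd : M.k d = 5)
    (h : M.spokes d ≠ [true]) : M.dot d ≤ 0.8248 := by
  apply dot_le_gap (by omega)
  intro h1 h2
  apply h
  have h3 : M.deg d = 2 := by
    by_contra hc
    exact nn_ne hc h1
  rcases P.spokes_cases hd with ⟨a, h4, h5, h6⟩ | ⟨a, b, h4, h5, -⟩ | ⟨a, b, c, h4, h5, -⟩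
  · rw [h4]
    cases a
    · simp [side, h2] at h6
    · rfl
  · omega
  · omega

lemma IsPentagonal.dot_of_tri (P : M.IsPentagonal) {d : D} (hd : M.k d = 5)
    (h : M.spokes d = [true]) : M.dot d = 2 := by
  obtain ⟨h1, h2⟩ := P.of_spokes_one hd h
  rw [dot_of_deg_two h1]
  exact dot_tri h2

lemma deg_n_ne {d : D} (h : M.deg d ≠ 2) : M.deg (M.n d) ≠ 2 := by rwa [deg_n]

lemma IsPentagonal.dot_of_wide (P : M.IsPentagonal) {d : D} (hd : M.k d = 5)
    (h : M.spokes d ∈ Pentagon.wide) : M.dot d ≤ -1.88 := by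
  simp only [Pentagon.wide, List.mem_cons, List.not_mem_nil, or_false] at h
  rcases h with h | h
  all_goals
    obtain ⟨h1, h2, h3⟩ := P.of_spokes_two hd h
    rw [dot_of_deg_three h1]
    have hn := deg_n_ne (M := M) (d := d) (by omega)
    have hnn := deg_n_ne hn
  · have := re_tri_quad h2 h3 hn hnn
    linarith
  · have := re_tri_quad h3 h2 hnn hn
    rw [mul_comm] at this
    linarith

lemma IsPentagonal.dot_of_two_triangles (P : M.IsPentagonal) {d : D} (hd : M.k d = 5)
    (h : M.spokes d = [true, true]) : M.dot d = -4 / 3 := by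
  obtain ⟨h1, h2, h3⟩ := P.of_spokes_two hd h
  have hn := deg_n_ne (M := M) (d := d) (by omega)
  rw [dot_of_deg_three h1, tri_sq h2 h3 hn (deg_n_ne hn)]
  norm_num

lemma IsPentagonal.dot_of_three_triangles (P : M.IsPentagonal) {d : D} (hd : M.k d = 5)
    (h : M.spokes d = [true, true, true]) : M.dot d = -14 / 9 :=
  IsTTT.dot_eq (P.of_spokes_three hd h)

lemma IsPentagonal.dot_of_low (P : M.IsPentagonal) {d : D} (hd : M.k d = 5)
    (h : M.spokes d ∈ Pentagon.low) : M.dot d ≤ -4 / 3 := by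
  simp only [Pentagon.low, List.mem_cons, List.not_mem_nil, or_false] at h
  rcases h with h | h | h | h
  · linarith [P.dot_of_wide hd (by simp [h, Pentagon.wide])]
  · linarith [P.dot_of_wide hd (by simp [h, Pentagon.wide])]
  · exact (P.dot_of_two_triangles hd h).le
  · rw [P.dot_of_three_triangles hd h]
    norm_num

lemma IsPentagonal.dot_of_nonneg (P : M.IsPentagonal) {d : D} (hd : M.k d = 5)
    (h : M.spokes d ∈ Pentagon.nonneg) : 0 ≤ M.dot d := by
  simp only [Pentagon.nonneg, List.mem_cons, List.not_mem_nil, or_false] at h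
  rcases h with h | h | h
  all_goals
    obtain ⟨h1, h2, h3, h4⟩ := P.of_spokes_three hd h
    rw [dot_of_deg_four h1]
    have hn := deg_n_ne (M := M) (d := d) (by omega)
    have hnn := deg_n_ne hn
    have hnnn := deg_n_ne hnn
  · have := re_tri_quad_quad h2 h3 h4 hn hnn hnnn
    rw [mul_assoc]
    linarith
  · have := re_tri_quad_quad h3 h2 h4 hnn hn hnnn
    rw [← mul_assoc, mul_comm (M.angle _) (M.angle (M.n d))] at this
    linarith
  · have := re_tri_quad_quad h4 h2 h3 hnnn hn hnn
    rw [mul_comm] at this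
    linarith

lemma IsPentagonal.dot_of_medium (P : M.IsPentagonal) {d : D} (hd : M.k d = 5)
    (h : M.spokes d ∈ Pentagon.medium) : -0.75 ≤ M.dot d := by
  simp only [Pentagon.medium, List.mem_cons, List.not_mem_nil, or_false] at h
  rcases h with h | h | h | h | h
  · obtain ⟨h1, h2⟩ := P.of_spokes_one hd h
    rw [dot_of_deg_two h1]
    linarith [le_dot_quad h2]
  iterate 3
    obtain ⟨h1, h2, h3, h4⟩ := P.of_spokes_three hd h
    rw [dot_of_deg_four h1]
    have hn := deg_n_ne (M := M) (d := d) (by omega)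
    have hnn := deg_n_ne hn
    have hnnn := deg_n_ne hnn
    first
    | have := re_tri_tri_quad h2 h3 h4 hn hnn hnnn
      linarith
    | have := re_tri_tri_quad h2 h4 h3 hn hnnn hnn
      rw [mul_right_comm] at this
      linarith
    | have := re_tri_tri_quad h3 h4 h2 hnn hnnn hn
      rw [mul_comm, ← mul_assoc] at this
      linarith
  · have := P.dot_of_nonneg hd (by simp [Pentagon.nonneg]; exact h)
    linarith

lemma IsPentagonal.dot_of_notWide (P : M.IsPentagonal) {d : D} (hd : M.k d = 5)
    (h : M.spokes d ∈ Pentagon.notWide) : -14 / 9 ≤ M.dot d := by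
  by_cases hm : M.spokes d ∈ Pentagon.medium
  · linarith [P.dot_of_medium hd hm]
  · have : M.spokes d = [true, true] ∨ M.spokes d = [true, true, true] := by
      simp only [Pentagon.notWide, Pentagon.medium, List.mem_cons, List.not_mem_nil,
        or_false] at h hm
      tauto
    rcases this with h | h
    · rw [P.dot_of_two_triangles hd h]
      norm_num
    · rw [P.dot_of_three_triangles hd h]

lemma IsPentagonal.dot_of_negative (P : M.IsPentagonal) {d : D} (hd : M.k d = 5)
    (h : M.spokes d ∈ Pentagon.negative) : M.dot d < 0 := by
  by_cases hl : M.spokes d ∈ Pentagon.low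
  · linarith [P.dot_of_low hd hl]
  · have : M.spokes d = [false, false] := by
      simp only [Pentagon.negative, Pentagon.low, List.mem_cons, List.not_mem_nil,
        or_false] at h hl
      tauto
    obtain ⟨h1, h2, h3⟩ := P.of_spokes_two hd this
    have hn := deg_n_ne (M := M) (d := d) (by omega)
    rw [dot_of_deg_three h1]
    linarith [(quad_quad h2 h3 hn (deg_n_ne hn)).1]

lemma IsPentagonal.spokes_mem (P : M.IsPentagonal) {d : D} (hd : M.k d = 5) :
    M.spokes d ∈ Pentagon.strings := by
  rcases P.spokes_cases hd with ⟨a, h1, -⟩ | ⟨a, b, h1, -⟩ | ⟨a, b, c, h1, h2, k1, k2, k3⟩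
  · rw [h1]
    cases a <;> decide
  · rw [h1]
    cases a <;> cases b <;> decide
  · by_cases hq : a = false ∧ b = false ∧ c = false
    · exfalso
      obtain ⟨rfl, rfl, rfl⟩ := hq
      have hn := deg_n_ne (M := M) (d := d) (by omega)
      have hnn := deg_n_ne hn
      have hnnn := deg_n_ne hnn
      have h3 := re_quad_quad_quad k1 k2 k3 hn hnn hnnn
      have h4 := P.dot_le hd (by simp [h1])
      rw [dot_of_deg_four h2, mul_assoc] at h4
      linarith
    · rw [h1]
      revert hq
      cases a <;> cases b <;> cases c <;> decide

end ContactMap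

namespace ContactMap

variable {D : Type} [Fintype D] {M : ContactMap D} {fc : ℕ → ℕ}

/-! ### The sequence of faces around a pentagon in a contact map -/

lemma IsPentagonal.opposite (P : M.IsPentagonal) {d : D} (hd : M.k d = 5) :
    Pentagon.opposite (M.spokes d) (M.spokes (M.f (M.f d))) (M.spokes (M.f (M.f (M.f d)))) := by
  have h := pent_chain hd
  have h' : chainDet (M.dot d) (M.dot (M.f (M.f (M.f d)))) (M.dot (M.f (M.f d))) = 0 := by
    rwa [chainDet_comm]
  have hy : M.k (M.f (M.f d)) = 5 := by rw [k_f, k_f, hd]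
  have hz : M.k (M.f (M.f (M.f d))) = 5 := by rw [k_f, hy]
  set y := M.f (M.f d)
  set z := M.f y
  have lx := neg_two_le_dot (M := M) d
  have ly := neg_two_le_dot (M := M) y
  have lz := neg_two_le_dot (M := M) z
  have hw : ∀ x, M.k x = 5 → M.spokes x ∈ Pentagon.medium → M.dot x ≤ 0.8248 := fun x hx hs =>
    P.dot_le hx fun h1 => by simp [h1, Pentagon.medium] at hs
  have hw' : ∀ x, M.k x = 5 → M.spokes x ∈ Pentagon.notWide → M.dot x ≤ 0.8248 := fun x hx hs =>
    P.dot_le hx fun h1 => by simp [h1, Pentagon.notWide] at hs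
  have hn : M.spokes d ∈ Pentagon.nonneg ∨ M.spokes d = [true] → 0 ≤ M.dot d := by
    rintro (hs | hs)
    · exact P.dot_of_nonneg hd hs
    · rw [P.dot_of_tri hd hs]
      norm_num
  simp only [Pentagon.opposite, Bool.and_eq_true, Bool.not_eq_true', Bool.and_eq_false_iff,
    List.contains_eq_mem, decide_eq_false_iff_not, Bool.or_eq_false_iff, beq_eq_false_iff_ne, ne_eq,
    Bool.not_eq_false', beq_iff_eq]
  refine ⟨⟨⟨⟨?_, ?_⟩, ?_⟩, ?_⟩, ?_⟩
  · by_contra! hc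
    exact chain_adjacent_false h lx ly (P.dot_of_wide hy hc.1) lz (P.dot_of_low hz hc.2)
  · by_contra! hc
    exact chain_adjacent_false h' lx lz (P.dot_of_wide hz hc.2) ly (P.dot_of_low hy hc.1)
  · by_cases hl : M.spokes d ∈ Pentagon.low
    · right
      have hx := P.dot_of_low hd hl
      constructor
      · by_contra! hc
        have := chain_opposite_lower h lx (P.dot_of_notWide hy hc.1) (hw' _ hy hc.1)
          (P.dot_of_medium hz hc.2) (hw _ hz hc.2)
        linarith
      · by_contra! hc
        have := chain_opposite_lower h' lx (P.dot_of_notWide hz hc.2) (hw' _ hz hc.2)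
          (P.dot_of_medium hy hc.1) (hw _ hy hc.1)
        linarith
    · exact Or.inl hl
  · by_cases hc : M.spokes d ∈ Pentagon.nonneg ∨ M.spokes d = [true]
    · right
      have hx := hn hc
      constructor
      · by_contra! hc
        have := chain_adjacent_neg h ly (P.dot_of_wide hy hc.1) lz (P.dot_le hz hc.2)
        linarith
      · by_contra! hc
        have := chain_adjacent_neg h' lz (P.dot_of_wide hz hc.1) ly (P.dot_le hy hc.2)
        linarith
    · left
      push Not at hc
      exact hc
  · by_contra! hc
    have := chain_opposite_pos h lx (P.dot_of_medium hy hc.1.2) (hw _ hy hc.1.2)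
      (P.dot_of_medium hz hc.2) (hw _ hz hc.2)
    linarith [P.dot_of_negative hd hc.1.1]

lemma IsPentagonal.dot_nonneg (P : M.IsPentagonal) {d : D} (hd : M.k d = 5)
    (h : Pentagon.isNonneg (M.spokes d) (M.spokes (M.f (M.f d)))
      (M.spokes (M.f (M.f (M.f d))))) : 0 ≤ M.dot d := by
  have hy : M.k (M.f (M.f d)) = 5 := by rw [k_f, k_f, hd]
  have hz : M.k (M.f (M.f (M.f d))) = 5 := by rw [k_f, hy]
  simp only [Pentagon.isNonneg, List.contains_eq_mem, Bool.or_eq_true, decide_eq_true_eq,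
    Bool.and_eq_true] at h
  have hw : ∀ x, M.k x = 5 → M.spokes x ∈ Pentagon.medium → M.dot x ≤ 0.8248 := fun x hx hs =>
    P.dot_le hx fun h1 => by simp [h1, Pentagon.medium] at hs
  rcases h with h | ⟨h1, h2⟩
  · exact P.dot_of_nonneg hd h
  · exact (chain_opposite_pos (pent_chain hd) (neg_two_le_dot d) (P.dot_of_medium hy h1)
      (hw _ hy h1) (P.dot_of_medium hz h2) (hw _ hz h2)).le

lemma IsPentagonal.fits (P : M.IsPentagonal) {d : D} (hd : M.k d = 5) :
    Pentagon.fits (M.spokes d) (M.spokes (M.f d)) (M.spokes (M.f (M.f d)))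
      (M.spokes (M.f (M.f (M.f d)))) (M.spokes (M.f (M.f (M.f (M.f d))))) := by
  have hy : M.k (M.f (M.f d)) = 5 := by rw [k_f, k_f, hd]
  have hz : M.k (M.f (M.f (M.f d))) = 5 := by rw [k_f, hy]
  have h5 := f5 hd
  by_contra hc
  simp only [Pentagon.fits, Bool.or_eq_true, Bool.not_eq_true', beq_iff_eq, not_or,
    Bool.not_eq_false, Bool.and_eq_true] at hc
  obtain ⟨⟨⟨c1, c2⟩, c3⟩, c4, c5⟩ := hc
  have n1 := P.dot_nonneg hy (by rw [h5]; exact c4)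
  have n2 := P.dot_nonneg hz (by rw [h5]; exact c5)
  have := chain_opposite_gt (pent_chain hd) (neg_two_le_dot d) n1 (P.dot_le hy c2) n2
    (P.dot_le hz c3)
  linarith [P.dot_le hd c1]

lemma IsPentagonal.sum_deg_five (P : M.IsPentagonal) {d : D} (hd : M.k d = 5) :
    18 ≤ M.deg d + M.deg (M.f d) + M.deg (M.f (M.f d)) + M.deg (M.f (M.f (M.f d))) +
      M.deg (M.f (M.f (M.f (M.f d)))) := by
  have := P.le_sum_deg hd
  simp only [Finset.sum_range_succ, Finset.sum_range_zero, zero_add, Function.iterate_succ_apply',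
    Function.iterate_zero_apply] at this
  exact this

lemma deg_le (d : D) : M.deg d ≤ 4 := M.deg_le_four d

/-- A point that touches two consecutive vertices of the pentagon is not a vertex itself. -/
lemma IsPentagonal.small_of_contacts (P : M.IsPentagonal) {d x : D} (hd : M.k d = 5)
    (h0 : M.deg d ≠ 2) (h1 : M.deg (M.f d) ≠ 2) (c0 : ⟪M.pos d, M.pos x⟫ = 2)
    (c1 : ⟪M.head d, M.pos x⟫ = 2) : M.Small x := by
  have key : ∀ y, M.k y = 5 → M.dot y = 2 → M.deg y = 2 := by
    intro y hy hy2
    by_cases hs : M.spokes y = [true]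
    · exact (P.of_spokes_one hy hs).1
    · linarith [P.dot_le hy hs]
  have h5 := f5 hd
  have k1 : M.k (M.f d) = 5 := by rw [k_f, hd]
  have k2 : M.k (M.f (M.f d)) = 5 := by rw [k_f, k1]
  have k3 : M.k (M.f (M.f (M.f d))) = 5 := by rw [k_f, k2]
  have k4 : M.k (M.f (M.f (M.f (M.f d)))) = 5 := by rw [k_f, k3]
  apply P.small
  intro y hy hy5
  rw [← hy] at c0 c1
  obtain ⟨i, hi, rfl⟩ := P.eq_iterate hd hy5
  interval_cases i
  · change ⟪M.pos d, M.pos d⟫ = 2 at c0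
    rw [M.norm] at c0
    norm_num at c0
  · change ⟪M.head d, M.pos (M.f d)⟫ = 2 at c1
    rw [pos_f, M.norm_head] at c1
    norm_num at c1
  · change ⟪M.pos d, M.pos (M.f (M.f d))⟫ = 2 at c0
    rw [pos_f, ← dot_eq_inner] at c0
    exact h1 (key _ k1 c0)
  · change ⟪M.pos d, M.pos (M.f (M.f (M.f d)))⟫ = 2 at c0
    change ⟪M.head d, M.pos (M.f (M.f (M.f d)))⟫ = 2 at c1
    have a2 := key _ k2 (by rw [dot_eq_inner, pos_f, ← M.pos_f (M.f (M.f d))]; exact c1)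
    have a4 := key _ k4 (by rw [dot_eq_inner, ← pos_f, h5, real_inner_comm]; exact c0)
    have := P.sum_deg_five hd
    have := M.deg_le d
    have := M.deg_le (M.f d)
    have := M.deg_le (M.f (M.f (M.f d)))
    omega
  · change ⟪M.head d, M.pos (M.f (M.f (M.f (M.f d))))⟫ = 2 at c1
    have e4 : M.f (M.f (M.f (M.f d))) = M.e (M.n d) := by
      apply M.f.injective
      rw [h5, f_e_n]
    rw [e4] at c1
    exact h0 (key _ hd c1)

/-- The apex of a triangle on an edge of the pentagon, seen from both ends. -/
lemma apex_eq_of_edge {d l : D} (hl : M.n l = d) (hk : M.k l = 3) :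
    M.f l = M.e (M.n (M.n (M.f d))) ∧ M.k (M.n (M.f d)) = 3 := by
  have h1 : M.f (M.e d) = l := by
    apply M.n.injective
    rw [f_e, hl]
  have h2 : M.k (M.e d) = 3 := by rw [← k_f, h1, hk]
  rw [n_f]
  refine ⟨?_, h2⟩
  rw [← h1, ff_tri h2]

/-- The apex of a triangle on an edge of the pentagon is away from the pentagon. -/
lemma IsPentagonal.small_apex (P : M.IsPentagonal) {d l : D} (hd : M.k d = 5)
    (h0 : M.deg d ≠ 2) (h1 : M.deg (M.f d) ≠ 2) (hl : M.n l = d) (hk : M.k l = 3) :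
    M.Small (M.f l) := by
  apply P.small_of_contacts hd h0 h1
  · rw [pos_f, ← hl, M.pos_n]
    exact M.inner_head l
  · rw [(apex_eq_of_edge hl hk).1, pos_e, ← pos_f]
    exact M.inner_head_nn _

/-- No point has three consecutive triangles. -/
lemma Small.not_three_triangles {x : D} (h : M.Small x) (h0 : M.k x = 3) (h1 : M.k (M.n x) = 3)
    (h2 : M.k (M.n (M.n x)) = 3) : False := by
  have := h.n.n.n.k_eq
  rcases h.cases with h | h <;> omega

lemma eq_f_e_of_n_eq {d l : D} (h : M.n l = d) : l = M.f (M.e d) := by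
  apply M.n.injective
  rw [f_e, h]

lemma decide_side (a : Bool) : decide (side a = 3) = a := by cases a <;> rfl

lemma IsPentagonal.head_spokes (P : M.IsPentagonal) {d : D} (hd : M.k d = 5) :
    (M.spokes d).head? = some (decide (M.k (M.n d) = 3)) := by
  rcases P.spokes_cases hd with ⟨a, h1, -, k1⟩ | ⟨a, b, h1, -, k1, -⟩ | ⟨a, b, c, h1, -, k1, -⟩
  all_goals
    rw [h1, k1, decide_side]
    rfl

lemma IsPentagonal.getLast_spokes (P : M.IsPentagonal) {d l : D} (hd : M.k d = 5)
    (hl : M.n l = d) : (M.spokes d).getLast? = some (decide (M.k l = 3)) := by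
  rw [eq_f_e_of_n_eq hl]
  rcases P.spokes_cases hd with ⟨a, h1, h2, k1⟩ | ⟨a, b, h1, h2, -, k2⟩ |
    ⟨a, b, c, h1, h2, -, -, k3⟩
  · rw [h1, ← eq_f_e_of_n_eq (n2 h2), k1, decide_side]
    rfl
  · rw [h1, ← eq_f_e_of_n_eq (n3 h2), k2, decide_side]
    rfl
  · rw [h1, ← eq_f_e_of_n_eq (n4 h2), k3, decide_side]
    rfl

/-- If a vertex of the pentagon has only a triangle besides the pentagon, the next one has a
triangle and two quadrilaterals. -/
lemma IsPentagonal.next_of_tri (P : M.IsPentagonal) {d : D} (hd : M.k d = 5)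
    (h : M.spokes d = [true]) : M.spokes (M.f d) = [true, false, false] := by
  obtain ⟨h1, h2⟩ := P.of_spokes_one hd h
  change M.k (M.n d) = 3 at h2
  have h5 := f5 hd
  have hs := P.sum_deg_five hd
  have k1 : M.k (M.f d) = 5 := by rw [k_f, hd]
  have k2 : M.k (M.f (M.f d)) = 5 := by rw [k_f, k1]
  have k3 : M.k (M.f (M.f (M.f d))) = 5 := by rw [k_f, k2]
  have l1 := M.deg_le (M.f d)
  have l2 := M.deg_le (M.f (M.f d))
  have l3 := M.deg_le (M.f (M.f (M.f d)))
  have l4 := M.deg_le (M.f (M.f (M.f (M.f d))))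
  have hle : ∀ y, M.k y = 5 → M.deg y = 4 → M.dot y ≤ 0.8248 := fun y hy h4 =>
    P.dot_le hy fun hs => by
      have := (P.of_spokes_one hy hs).1
      omega
  have d2 := hle _ k2 (by omega)
  have d3 := hle _ k3 (by omega)
  have e4 : M.f (M.f (M.f (M.f d))) = M.e (M.n d) := by
    apply M.f.injective
    rw [h5, f_e_n]
  obtain ⟨a1, a2⟩ := apex_eq_of_edge (n2 h1) h2
  -- the other four vertices of the pentagon form a rhombus
  have hr : (4 + M.dot (M.f (M.f d))) * (4 + M.dot (M.f (M.f (M.f d)))) = 16 := by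
    rw [dot_eq_inner, dot_eq_inner, ← pos_f (M := M) (M.f (M.f d)),
      ← pos_f (M := M) (M.f (M.f (M.f d)))]
    apply rhombus (M.norm _) (M.norm _) (M.norm _) (M.norm _)
    · rw [pos_f (M := M) (M.f d)]
      exact M.inner_head _
    · rw [pos_f (M := M) (M.f (M.f d))]
      exact M.inner_head _
    · rw [pos_f (M := M) (M.f (M.f (M.f d)))]
      exact M.inner_head _
    · rw [e4, pos_e, pos_f]
      exact P.dot_of_tri hd h
    · exact (pos_f_iterate_ne (i := 2) (by norm_num) (by omega)).symm
    · exact (pos_f_iterate_ne (d := M.f (M.f d)) (i := 2) (by norm_num) (by omega)).symm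
  have hx : -0.684 ≤ M.dot (M.f (M.f (M.f d))) := by
    have := neg_two_le_dot (M := M) (M.f (M.f (M.f d)))
    nlinarith
  rcases P.spokes_cases k1 with ⟨a, h3, h4, -⟩ | ⟨a, b, h3, h4, -⟩ | ⟨a, b, c, h3, h4, b1, b2, b3⟩
  · omega
  · omega
  have ha : a = true := by
    rw [a2] at b1
    cases a
    · simp [side] at b1
    · rfl
  set y := M.f d with hy
  have hre : M.dot (M.f (M.f y)) = 3 * (M.angle (M.n (M.n y)) *
      M.angle (M.n (M.n (M.n y)))).re + 1 := by
    rw [angle_mul, n4 h4, dot_eq_inner, ← pos_f (M := M) (M.f (M.f y)), e4, pos_e, pos_f]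
    have : M.head (M.n d) = M.head (M.n (M.n y)) := by
      rw [← pos_f, a1, pos_e]
    rw [this, real_inner_comm]
    simp only [corner]
    ring
  have hn := deg_n_ne (M := M) (d := y) (by omega)
  have hnn := deg_n_ne hn
  have hnnn := deg_n_ne hnn
  rw [h3, ha]
  rw [hre] at hx
  cases b <;> cases c
  · rfl
  · have := re_tri_quad b3 b2 hnnn hnn
    rw [mul_comm] at this
    linarith
  · have := re_tri_quad b2 b3 hnn hnnn
    linarith
  · rw [tri_sq b2 b3 hnn hnnn] at hx
    norm_num at hx

lemma spokes_mirror (d : D) : M.mirror.spokes (M.n d) = (M.spokes d).reverse := by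
  rw [spokes, spokes, mirror_deg, deg_n]
  rcases deg_cases (M := M) d with h | h | h
  · rw [h]
    change [decide (M.mirror.k (M.n⁻¹ (M.n d)) = 3)] = [decide (M.k (M.n d) = 3)]
    rw [n_inv_n, mirror_k]
    have : M.n⁻¹ d = M.n d := by
      apply M.n.injective
      rw [n_n_inv, n2 h]
    rw [this]
  · rw [h]
    change [decide (M.mirror.k (M.n⁻¹ (M.n d)) = 3), decide (M.mirror.k (M.n⁻¹ (M.n⁻¹ (M.n d))) = 3)]
      = [decide (M.k (M.n (M.n d)) = 3), decide (M.k (M.n d) = 3)]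
    rw [n_inv_n, mirror_k, mirror_k]
    have : M.n⁻¹ d = M.n (M.n d) := by
      apply M.n.injective
      rw [n_n_inv, n3 h]
    rw [this, n_inv_n]
  · rw [h]
    change [decide (M.mirror.k (M.n⁻¹ (M.n d)) = 3), decide (M.mirror.k (M.n⁻¹ (M.n⁻¹ (M.n d))) = 3),
      decide (M.mirror.k (M.n⁻¹ (M.n⁻¹ (M.n⁻¹ (M.n d)))) = 3)]
      = [decide (M.k (M.n (M.n (M.n d))) = 3), decide (M.k (M.n (M.n d)) = 3),
        decide (M.k (M.n d) = 3)]
    rw [n_inv_n, mirror_k, mirror_k, mirror_k]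
    have : M.n⁻¹ d = M.n (M.n (M.n d)) := by
      apply M.n.injective
      rw [n_n_inv, n4 h]
    rw [this, n_inv_n, n_inv_n]

lemma IsPentagonal.adjacent (P : M.IsPentagonal) {d : D} (hd : M.k d = 5) :
    Pentagon.adjacent (M.spokes d) (M.spokes (M.f d)) := by
  have k1 : M.k (M.f d) = 5 := by rw [k_f, hd]
  have hl := f_e M d
  set l := M.f (M.e d) with hld
  simp only [Pentagon.adjacent, Bool.and_eq_true, Bool.or_eq_true, Bool.not_eq_true', beq_iff_eq,
    beq_eq_false_iff_ne, ne_eq]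
  refine ⟨⟨⟨?_, ?_⟩, ?_⟩, ?_⟩
  · rw [P.head_spokes k1, P.getLast_spokes hd hl, n_f, hld, k_f]
  · by_contra hc
    simp only [Bool.and_eq_false_iff, beq_eq_false_iff_ne, ne_eq, not_or, not_not] at hc
    obtain ⟨⟨c1, c2⟩, c3⟩ := hc
    rw [P.getLast_spokes hd hl] at c1
    simp only [Option.some.injEq, decide_eq_true_eq] at c1
    have h1 : M.deg (M.f d) ≠ 2 ∧ M.k (M.n (M.n (M.f d))) = 3 := by
      rcases P.spokes_cases k1 with ⟨a, h3, h4, -⟩ | ⟨a, b, h3, h4, b1, b2⟩ |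
        ⟨a, b, c, h3, h4, b1, b2, b3⟩
      all_goals
        rw [h3] at c3
        simp at c3
      all_goals
        subst c3
        exact ⟨by omega, b2⟩
    have h2 : M.deg d ≠ 2 ∧ ∃ m, M.n m = l ∧ M.k m = 3 := by
      rcases P.spokes_cases hd with ⟨a, h3, h4, -⟩ | ⟨a, b, h3, h4, b1, b2⟩ |
        ⟨a, b, c, h3, h4, b1, b2, b3⟩
      all_goals
        rw [h3] at c2
        simp at c2
      all_goals subst c2
      · exact ⟨by omega, M.n d, eq_f_e_of_n_eq (n3 h4), b1⟩
      · exact ⟨by omega, M.n (M.n d), eq_f_e_of_n_eq (n4 h4), b2⟩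
    obtain ⟨h0, m, hm, hmk⟩ := h2
    obtain ⟨h1, h1k⟩ := h1
    have hs := P.small_apex hd h0 h1 hl c1
    have ha := (apex_eq_of_edge hl c1).1
    have hb : M.n (M.f (M.e (M.f l))) = M.f l := M.f_e _
    have hs' : M.Small (M.f (M.e (M.f l))) := hs.of_pos (by rw [← M.pos_n, hb])
    apply hs'.not_three_triangles
    · rw [k_f, ha, M.e_e, h1k]
    · rw [hb, k_f, c1]
    · rw [hb, n_f, ← hm, k_e_n, hmk]
  · by_cases h : M.spokes d = [true]
    · exact Or.inr (P.next_of_tri hd h)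
    · exact Or.inl h
  · by_cases h : M.spokes (M.f d) = [true]
    · right
      have := P.mirror.next_of_tri (d := M.n (M.f d)) (by rw [mirror_k_n, k1])
        (by rw [spokes_mirror, h]; rfl)
      rw [mirror_f_n_f, spokes_mirror] at this
      rw [← List.reverse_reverse (M.spokes d), this]
      rfl
    · exact Or.inl h

lemma load_pos (P : M.IsPentagonal) {d : D} (hd : M.k d = 5) :
    M.load (M.pos d) = (M.spokes d).length + 1 + (M.spokes d).count false := by
  rw [load, card_pos_eq, P.count_spokes hd, length_spokes]
  have := M.two_le_deg d
  unfold deg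
  omega

/-- The sequences of faces around the five vertices of the pentagon, starting at the vertex of `d`. -/
noncomputable def cycle (M : ContactMap D) (d : D) : List (List Bool) :=
  [M.spokes d, M.spokes (M.f d), M.spokes (M.f (M.f d)), M.spokes (M.f (M.f (M.f d))),
    M.spokes (M.f (M.f (M.f (M.f d))))]

lemma IsPentagonal.isSurvivor (P : M.IsPentagonal) {d : D} (hd : M.k d = 5) :
    Pentagon.isSurvivor (M.cycle d) := by
  have h5 := f5 hd
  have k1 : M.k (M.f d) = 5 := by rw [k_f, hd]
  have k2 : M.k (M.f (M.f d)) = 5 := by rw [k_f, k1]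
  have k3 : M.k (M.f (M.f (M.f d))) = 5 := by rw [k_f, k2]
  have k4 : M.k (M.f (M.f (M.f (M.f d)))) = 5 := by rw [k_f, k3]
  have a4 := P.adjacent k4
  have o1 := P.opposite k1
  have o2 := P.opposite k2
  have o3 := P.opposite k3
  have o4 := P.opposite k4
  have f0 := P.fits hd
  have f1 := P.fits k1
  have f2 := P.fits k2
  have f3 := P.fits k3
  have f4 := P.fits k4
  rw [h5] at a4 o2 o3 o4 f1 f2 f3 f4
  apply Pentagon.classification _ (P.spokes_mem hd) _ (P.spokes_mem k1) (P.adjacent hd) _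
    (P.spokes_mem k2) (P.adjacent k1) _ (P.spokes_mem k3) (P.adjacent k2) (P.opposite hd) _
    (P.spokes_mem k4) (P.adjacent k3) a4
  have hs := P.sum_deg_five hd
  have hl := P.sum_load_le hd
  simp only [Finset.sum_range_succ, Finset.sum_range_zero, zero_add, Function.iterate_succ_apply',
    Function.iterate_zero_apply] at hl
  rw [load_pos P hd, load_pos P k1, load_pos P k2, load_pos P k3, load_pos P k4] at hl
  have t := fun d => M.two_le_deg d
  simp only [Pentagon.consistent, o1, o2, o3, o4, f0, f1, f2, f3, f4, Bool.and_true,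
    Bool.and_eq_true, decide_eq_true_eq]
  refine ⟨?_, by omega⟩
  simp only [length_spokes]
  omega

lemma cycle_f {d : D} (hd : M.k d = 5) : M.cycle (M.f d) = (M.cycle d).rotate 1 := by
  simp [cycle, f5 hd]

lemma cycle_f_iterate {d : D} (hd : M.k d = 5) (i : ℕ) :
    M.cycle (M.f^[i] d) = (M.cycle d).rotate i := by
  induction i with
  | zero => simp
  | succ i ih => rw [Function.iterate_succ_apply', cycle_f (by rw [k_f_iterate, hd]), ih,
      List.rotate_rotate]

lemma cycle_mirror (d : D) : M.mirror.cycle (M.n (M.f (M.f (M.f (M.f d))))) =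
    (M.cycle d).reverse.map List.reverse := by
  simp [cycle, mirror_f_n_f, spokes_mirror]

/-- Up to rotation and reflection, the sequences around the pentagon follow one of the surviving
patterns. -/
lemma IsPentagonal.exists_survivor (P : M.IsPentagonal) :
    ∃ (N : ContactMap D) (x : D), N.IsPentagonal ∧ N.k x = 5 ∧
      N.cycle x ∈ Pentagon.survivors := by
  obtain ⟨d, hd⟩ : ∃ d, M.k d = 5 := by
    by_contra! hc
    have := P.card_five
    simp [hc] at this
  have h := P.isSurvivor hd
  simp only [Pentagon.isSurvivor, List.any_eq_true, Bool.or_eq_true, List.contains_iff_mem] at h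
  obtain ⟨i, -, h | h⟩ := h
  · exact ⟨M, M.f^[i] d, P, by rw [k_f_iterate, hd], by rwa [cycle_f_iterate hd]⟩
  · have hx : M.mirror.k (M.n (M.f (M.f (M.f (M.f d))))) = 5 := by
      rw [mirror_k_n, k_f, k_f, k_f, k_f, hd]
    refine ⟨M.mirror, M.mirror.f^[i] _, P.mirror, by rw [k_f_iterate, hx], ?_⟩
    rwa [cycle_f_iterate hx, cycle_mirror]

end ContactMap

namespace ContactMap

variable {D : Type} [Fintype D] {M : ContactMap D} {fc : ℕ → ℕ}

/-! ### Points beyond the neighbours of a pentagon -/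

/-- The point opposite to a vertex of the pentagon in a quadrilateral is not a vertex of the
pentagon. -/
lemma IsPentagonal.small_opposite (P : M.IsPentagonal) {d q : D} (hd : M.k d = 5)
    (h1 : M.deg (M.f d) ≠ 2) (h4 : M.deg (M.f (M.f (M.f (M.f d)))) ≠ 2) (hp : M.pos q = M.pos d)
    (hq : M.k q = 4) : M.Small (M.f (M.f q)) := by
  obtain ⟨c1, c2, c3⟩ := quad_inner hq
  have h5 := f5 hd
  have e4 : M.f (M.f (M.f (M.f d))) = M.e (M.n d) := by
    apply M.f.injective
    rw [h5, f_e_n]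
  have e5 : M.head (M.n d) = M.head (M.f (M.f (M.f d))) := by rw [← pos_e, ← e4, pos_f]
  have hne : q ≠ d := fun h => by
    rw [h] at hq
    omega
  have hdot : ⟪M.pos d, M.head (M.f q)⟫ ≠ 2 := by
    intro h
    rw [← hp, ← dot_eq_inner] at h
    have := dot_quad_le (d := M.f q) (by rw [k_f, hq])
    linarith
  apply P.small
  intro y hy hy5
  rw [pos_f] at hy
  obtain ⟨i, hi, rfl⟩ := P.eq_iterate hd hy5
  interval_cases i
  · exact c3 (hp.trans hy)
  · apply hdot
    rw [← hy]
    change ⟪M.pos d, M.pos (M.f d)⟫ = 2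
    rw [pos_f]
    exact M.inner_head d
  · change M.pos (M.f (M.f d)) = _ at hy
    have hh : M.head d = M.head q ∨ M.head d = M.head (M.n q) := by
      by_contra! hc
      refine head_n_ne q (common_contacts (M.norm d) (M.norm (M.f (M.f d))) (M.norm_head d)
        (M.norm_head q) (M.norm_head (M.n q)) (M.inner_head d) ?_ ?_ ?_ ?_ ?_ ?_ hc.1 hc.2).symm
      · rw [← hp]
        exact M.inner_head q
      · rw [← hp]
        exact M.inner_head_n q
      · rw [pos_f, ← pos_f M d]
        exact M.inner_head' _
      · rw [hy, real_inner_comm]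
        exact c1
      · rw [hy]
        exact c2
      · rw [hy, ← hp]
        exact c3
    rcases hh with hh | hh
    · exact hne (ext hp hh.symm)
    · have hn : M.n q = d := ext (by rw [M.pos_n, hp]) hh.symm
      have e1 : M.f (M.f (M.f q)) = M.e d := by rw [fff_quad hq, hn]
      have e2 : M.f (M.f q) = M.e (M.f d) := by
        apply ext
        · rw [pos_f, ← hy, pos_f, pos_e]
        · rw [head_e, ← pos_f, e1, pos_f, pos_e]
      rw [e2] at e1
      apply nn_ne h1
      rw [n_f, ← e1, f_e]
  · change M.pos (M.f (M.f (M.f d))) = _ at hy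
    have hh : M.head (M.n d) = M.head q ∨ M.head (M.n d) = M.head (M.n q) := by
      by_contra! hc
      refine head_n_ne q (common_contacts (M.norm d) (M.norm (M.f (M.f (M.f d))))
        (M.norm_head (M.n d)) (M.norm_head q) (M.norm_head (M.n q)) (M.inner_head_n d)
        ?_ ?_ ?_ ?_ ?_ ?_ hc.1 hc.2).symm
      · rw [← hp]
        exact M.inner_head q
      · rw [← hp]
        exact M.inner_head_n q
      · rw [e5]
        exact M.inner_head _
      · rw [hy, real_inner_comm]
        exact c1
      · rw [hy]
        exact c2
      · rw [hy, ← hp]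
        exact c3
    rcases hh with hh | hh
    · have hn : M.n d = q := ext (by rw [M.pos_n, hp]) hh
      have e1 : M.f q = M.e (M.f (M.f (M.f d))) := by
        apply ext
        · rw [pos_f, pos_e, ← hn, e5]
        · rw [head_e, hy]
      apply nn_ne h4
      rw [n_f, ← e1, n_f, ← hn, e4]
    · exact hne (M.n.injective (ext (by rw [M.pos_n, M.pos_n, hp]) hh.symm))
  · change M.pos (M.f (M.f (M.f (M.f d)))) = _ at hy
    apply hdot
    rw [← hy, e4, pos_e]
    exact M.inner_head_n d

/-- Four faces with one triangle and three quadrilaterals. -/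
lemma Small.load_eq_seven {x : D} (h : M.Small x) (hd : M.deg x = 4)
    (hk : M.k x + M.k (M.n x) + M.k (M.n (M.n x)) + M.k (M.n (M.n (M.n x))) = 15) :
    M.load (M.pos x) = 7 := by
  rw [load, card_pos_eq, hd, cnt_pos, card_pos_and_four hd]
  have h0 := h.k_eq
  have h1 := h.n.k_eq
  have h2 := h.n.n.k_eq
  have h3 := h.n.n.n.k_eq
  rcases h0 with h0 | h0 <;> rcases h1 with h1 | h1 <;> rcases h2 with h2 | h2 <;>
    rcases h3 with h3 | h3 <;> simp [h0, h1, h2, h3] at hk ⊢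

/-- The faces around the apex of the triangle of `l` on the edge of `d`: the triangle itself, between
the faces that follow it at the two ends of the edge. -/
lemma apex_faces {d l m : D} (hl : M.n l = d) (hm : M.n m = l) (hk : M.k l = 3) :
    M.n (M.f (M.n (M.n (M.f d)))) = M.f l ∧ M.k (M.f l) = 3 ∧ M.n (M.f l) = M.e l ∧
      M.k (M.n (M.f l)) = M.k m := by
  refine ⟨?_, by rw [k_f, hk], n_f M l, ?_⟩
  · rw [(apex_eq_of_edge hl hk).1, n_f]
  · rw [n_f, ← hm, k_e_n]

/-- Let the pentagon edge of `d` bear a triangle, followed by another triangle `m` at its initial point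
and by a quadrilateral at its end. At the apex of the first triangle, the fourth face is then a
quadrilateral, so that an edge from the apex runs between two quadrilaterals. By `squares_of_QQ` these
are squares, unless the other end of that edge has three quadrilaterals. -/
lemma IsPentagonal.square_or (P : M.IsPentagonal) {d l m : D} (hd : M.k d = 5)
    (h0 : M.deg d ≠ 2) (h1 : M.deg (M.f d) ≠ 2) (h2 : M.deg (M.f (M.f d)) ≠ 2) (hl : M.n l = d)
    (hm : M.n m = l) (hkl : M.k l = 3) (hkm : M.k m = 3) (hq : M.k (M.n (M.n (M.f d))) = 4) :
    M.k (M.n (M.n (M.f l))) = 4 ∧ M.n (M.n (M.n (M.f l))) = M.f (M.n (M.n (M.f d))) ∧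
    M.k (M.e (M.f (M.n (M.n (M.f d))))) = 4 ∧
    M.Small (M.e (M.f (M.n (M.n (M.f d))))) ∧
    (M.dot (M.n (M.n (M.f d))) = 0 ∨ M.deg (M.e (M.f (M.n (M.n (M.f d))))) = 3 ∨
      M.load (M.pos (M.e (M.f (M.n (M.n (M.f d)))))) = 7) := by
  obtain ⟨a1, a2, -, a3⟩ := apex_faces hl hm hkl
  have hs := P.small_apex hd h0 h1 hl hkl
  set q := M.n (M.n (M.f d)) with hqd
  set a := M.f l
  set b := M.f q with hb
  have kb : M.k b = 4 := by rw [hb, k_f, hq]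
  rw [hkm] at a3
  have hsb : M.Small b := hs.of_pos (by rw [← M.pos_n, a1])
  have ha : M.deg a = 4 ∧ M.k (M.n (M.n a)) = 4 := by
    rcases hs.cases with ⟨-, h, -⟩ | ⟨h, h'⟩
    · omega
    · have e := nnn_eq h a1
      rw [e] at h'
      have := hs.n.n.k_eq
      exact ⟨h, by omega⟩
  obtain ⟨ha4, ha2⟩ := ha
  have e := nnn_eq ha4 a1
  have hc : M.Small (M.e b) := by
    have k1 : M.k (M.f d) = 5 := by rw [k_f, hd]
    refine (P.small_opposite k1 h2 (by rw [f5 hd]; exact h0) ?_ hq).of_pos ?_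
    · rw [hqd, M.pos_n, M.pos_n]
    · rw [pos_e, ← pos_f]
  have hke : M.k (M.e b) = 4 := by rw [← e, k_e_n, ha2]
  refine ⟨ha2, e, hke, hc, ?_⟩
  have hl' : M.n (M.f b) = M.e b := n_f M b
  rcases hc.cases with ⟨h, -⟩ | ⟨h, h'⟩
  · exact Or.inr (Or.inl h)
  have e' := nnn_eq h hl'
  rcases h' with h' | h'
  · left
    rw [e', k_f, kb, hke] at h'
    have h3 := hc.n.k_eq
    have h4 := hc.n.n.k_eq
    have hb4 : M.deg b = 4 := by rw [← deg_n, a1, ha4]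
    have := squares_of_QQ (d := b)
      ⟨hb4, kb, by rw [a1, a2], by rw [a1, a3], by rw [a1, ha2]⟩
      ⟨h, hke, by omega, by omega, by rw [e', k_f, kb]⟩
    have hm := quad_mul hq
    rw [← hb, this.1] at hm
    linarith
  · exact Or.inr (Or.inr (hc.load_eq_seven h h'))

/-- If the sums over the pentagon are extreme, all other points have two triangles and two
quadrilaterals. -/
lemma IsPentagonal.not_exceptional (P : M.IsPentagonal) {d : D} (hd : M.k d = 5)
    (hdeg : ∑ i ∈ Finset.range 5, M.deg (M.f^[i] d) = 18)
    (hload : ∑ i ∈ Finset.range 5, M.load (M.pos (M.f^[i] d)) = 24) {x : D} (hx : M.Small x) :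
    M.deg x = 4 ∧ M.load (M.pos x) ≤ 6 := by
  have := P.load_le hd hx
  exact ⟨P.deg_eq_four hd hdeg hx, by omega⟩

lemma sine_square {x : D} (h : M.k x = 4) (hd : M.deg x ≠ 2) (h0 : M.dot x = 0) :
    M.cosine x = -1 / 3 ∧ M.sine x = 2 * √2 / 3 := by
  have hc : M.cosine x = -1 / 3 := by
    rw [cosine, h0]
    norm_num
  refine ⟨hc, ?_⟩
  have h1 := sq_add_sq (M := M) x
  rw [hc] at h1
  have h2 := sine_quad h hd
  have h3 : √2 ^ 2 = (2 : ℝ) := Real.sq_sqrt (by norm_num)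
  have h4 : (0 : ℝ) < √2 := by positivity
  have h5 : (M.sine x - 2 * √2 / 3) * (M.sine x + 2 * √2 / 3) = 0 := by nlinarith
  rcases mul_eq_zero.mp h5 with h6 | h6
  · linarith
  · nlinarith

/-- A square and a triangle besides the pentagon make a straight angle. -/
lemma IsPentagonal.dot_of_tri_square (P : M.IsPentagonal) {d : D} (hd : M.k d = 5)
    (h : M.spokes d = [true, false]) (h0 : M.dot (M.n (M.n d)) = 0) : M.dot d = -2 := by
  obtain ⟨h1, h2, h3⟩ := P.of_spokes_two hd h
  have hn := deg_n_ne (M := M) (d := d) (by omega)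
  have hnn := deg_n_ne hn
  obtain ⟨c, s⟩ := sine_square h3 hnn h0
  have h5 : √2 ^ 2 = (2 : ℝ) := Real.sq_sqrt (by norm_num)
  rw [dot_of_deg_three h1]
  simp only [angle, Complex.mul_re, cosine_tri h2, sine_tri h2 hn, c, s]
  linear_combination (-4 / 3 : ℝ) * h5

/-- A square between two triangles leaves an angle as large as that of the square. -/
lemma IsPentagonal.dot_of_tri_square_tri (P : M.IsPentagonal) {d : D} (hd : M.k d = 5)
    (h : M.spokes d = [true, false, true]) (h0 : M.dot (M.n (M.n d)) = 0) : M.dot d = 0 := by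
  obtain ⟨h1, h2, h3, h4⟩ := P.of_spokes_three hd h
  have hn := deg_n_ne (M := M) (d := d) (by omega)
  have hnn := deg_n_ne hn
  obtain ⟨c, s⟩ := sine_square h3 hnn h0
  have h5 : √2 ^ 2 = (2 : ℝ) := Real.sq_sqrt (by norm_num)
  rw [dot_of_deg_four h1, mul_right_comm, tri_sq h2 h4 hn (deg_n_ne hnn)]
  simp only [angle, Complex.mul_re, c, s]
  linear_combination (-8 / 9 : ℝ) * h5

lemma sum_five (d : D) (g : D → ℕ) : ∑ i ∈ Finset.range 5, g (M.f^[i] d) =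
    g d + g (M.f d) + g (M.f (M.f d)) + g (M.f (M.f (M.f d))) +
      g (M.f (M.f (M.f (M.f d)))) := by
  simp only [Finset.sum_range_succ, Finset.sum_range_zero, zero_add, Function.iterate_succ_apply',
    Function.iterate_zero_apply]

/-- The numbers of contacts and quadrilaterals at the vertices of the pentagon. -/
lemma IsPentagonal.sums_of_cycle (P : M.IsPentagonal) {d : D} (hd : M.k d = 5)
    {s₀ s₁ s₂ s₃ s₄ : List Bool} (h : M.cycle d = [s₀, s₁, s₂, s₃, s₄]) :
    ∑ i ∈ Finset.range 5, M.deg (M.f^[i] d) =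
        s₀.length + s₁.length + s₂.length + s₃.length + s₄.length + 5 ∧
      ∑ i ∈ Finset.range 5, M.load (M.pos (M.f^[i] d)) =
        s₀.length + s₁.length + s₂.length + s₃.length + s₄.length + 5 +
        (s₀.count false + s₁.count false + s₂.count false + s₃.count false + s₄.count false) := by
  have k1 : M.k (M.f d) = 5 := by rw [k_f, hd]
  have k2 : M.k (M.f (M.f d)) = 5 := by rw [k_f, k1]
  have k3 : M.k (M.f (M.f (M.f d))) = 5 := by rw [k_f, k2]
  have k4 : M.k (M.f (M.f (M.f (M.f d)))) = 5 := by rw [k_f, k3]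
  simp only [cycle, List.cons.injEq, and_true] at h
  obtain ⟨rfl, rfl, rfl, rfl, rfl⟩ := h
  have t : ∀ d, M.deg d = (M.spokes d).length + 1 := fun d => by
    have := M.two_le_deg d
    rw [length_spokes]
    unfold deg
    omega
  rw [sum_five d M.deg, sum_five d fun x => M.load (M.pos x), load_pos P hd, load_pos P k1,
    load_pos P k2, load_pos P k3, load_pos P k4, t d, t (M.f d), t (M.f (M.f d)),
    t (M.f (M.f (M.f d))), t (M.f (M.f (M.f (M.f d))))]
  constructor <;> ring

end ContactMap

namespace ContactMap

variable {D : Type} [Fintype D] {M : ContactMap D} {fc : ℕ → ℕ}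

/-! ### Exclusion of the remaining patterns around a pentagon -/

/-- `square_or` when the sums over the pentagon leave no exceptional points. -/
lemma IsPentagonal.square (P : M.IsPentagonal) {d x l m : D} (hd : M.k d = 5)
    (hdeg : ∑ i ∈ Finset.range 5, M.deg (M.f^[i] d) = 18)
    (hload : ∑ i ∈ Finset.range 5, M.load (M.pos (M.f^[i] d)) = 24) (hx : M.k x = 5)
    (h0 : M.deg x ≠ 2) (h1 : M.deg (M.f x) ≠ 2) (h2 : M.deg (M.f (M.f x)) ≠ 2) (hl : M.n l = x)
    (hm : M.n m = l) (hkl : M.k l = 3) (hkm : M.k m = 3) (hq : M.k (M.n (M.n (M.f x))) = 4) :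
    M.dot (M.n (M.n (M.f x))) = 0 := by
  obtain ⟨-, -, -, hc, h | h | h⟩ := P.square_or hx h0 h1 h2 hl hm hkl hkm hq
  · exact h
  · have := (P.not_exceptional hd hdeg hload hc).1
    omega
  · have := (P.not_exceptional hd hdeg hload hc).2
    omega

/-- The quadrilateral between two triangles at a vertex of the pentagon is not a square if one end of
the opposite edge has an almost straight angle: the angle of the pentagon would be that of a square. -/
lemma IsPentagonal.not_square_of_wide (P : M.IsPentagonal) {d : D} (hd : M.k d = 5)
    (h : M.spokes d = [true, false, true])
    (hw : M.spokes (M.f (M.f d)) ∈ Pentagon.wide ∧ M.spokes (M.f (M.f (M.f d))) ≠ [true] ∨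
      M.spokes (M.f (M.f (M.f d))) ∈ Pentagon.wide ∧ M.spokes (M.f (M.f d)) ≠ [true]) :
    M.dot (M.n (M.n d)) ≠ 0 := by
  intro h0
  have hx := P.dot_of_tri_square_tri hd h h0
  have hc := pent_chain hd
  have hy : M.k (M.f (M.f d)) = 5 := by rw [k_f, k_f, hd]
  have hz : M.k (M.f (M.f (M.f d))) = 5 := by rw [k_f, hy]
  rcases hw with ⟨h1, h2⟩ | ⟨h1, h2⟩
  · have := chain_adjacent_neg hc (neg_two_le_dot _) (P.dot_of_wide hy h1) (neg_two_le_dot _)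
      (P.dot_le hz h2)
    linarith
  · rw [chainDet_comm] at hc
    have := chain_adjacent_neg hc (neg_two_le_dot _) (P.dot_of_wide hz h1) (neg_two_le_dot _)
      (P.dot_le hy h2)
    linarith

/-- The quadrilateral at the fourth vertex is a square by `square_or`. The angle of the pentagon there
is then straight, which determines the fifth vertex from the third and fourth, and is incompatible
with the angles at the second and fifth vertices. -/
lemma IsPentagonal.not_straight_pattern (P : M.IsPentagonal) {d : D} (hd : M.k d = 5)
    (h : M.cycle d = [[false, true], [true, true, false], [false, true, true], [true, false],
      [false, true, false]]) : False := by
  obtain ⟨hdeg, hload⟩ := P.sums_of_cycle hd h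
  simp only [cycle, List.cons.injEq, and_true] at h
  obtain ⟨-, s1, s2, s3, s4⟩ := h
  have h5 := f5 hd
  have k1 : M.k (M.f d) = 5 := by rw [k_f, hd]
  have k2 : M.k (M.f (M.f d)) = 5 := by rw [k_f, k1]
  have k3 : M.k (M.f (M.f (M.f d))) = 5 := by rw [k_f, k2]
  have k4 : M.k (M.f (M.f (M.f (M.f d)))) = 5 := by rw [k_f, k3]
  obtain ⟨t2, -, a2, a3⟩ := P.of_spokes_three k2 s2
  obtain ⟨t3, -, b2⟩ := P.of_spokes_two k3 s3
  obtain ⟨t4, -⟩ := P.of_spokes_three k4 s4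
  have hsq := P.square hd hdeg hload k2 (by omega) (by omega) (by omega) (n4 t2) rfl a3 a2 b2
  have hx := P.dot_of_tri_square k3 s3 hsq
  have hy := P.dot_of_medium k1 (by rw [s1]; decide)
  have hz := P.dot_le k4 (by simp [s4])
  -- the neighbours of the vertex with the square are opposite
  have hv : M.head (M.f (M.f (M.f d))) + M.pos (M.f (M.f d)) = M.pos (M.f (M.f (M.f d))) := by
    rw [dot, n_f, head_e] at hx
    have c1 := M.inner_head (M.f (M.f (M.f d)))
    have c1' := M.inner_head' (M.f (M.f (M.f d)))
    have c2 := M.inner_head (M.f (M.f d))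
    have c2' := M.inner_head' (M.f (M.f d))
    rw [← pos_f] at c2 c2'
    have hx' := hx
    rw [real_inner_comm] at hx'
    rw [← sub_eq_zero, ← inner_self_eq_zero (𝕜 := ℝ)]
    simp only [inner_sub_left, inner_sub_right, inner_add_left, inner_add_right]
    rw [M.norm, M.norm, M.norm_head, c1, c1', c2, c2', hx, hx']
    norm_num
  have hw := congrArg (fun v => ⟪M.pos d, v⟫) hv
  simp only [inner_add_right] at hw
  rw [dot_eq_inner, ← pos_f, h5, real_inner_comm] at hz
  rw [dot_eq_inner, ← pos_f] at hy
  have c4 := M.inner_head' (M.f (M.f (M.f (M.f d))))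
  rw [← pos_f, h5, pos_f] at c4
  linarith

/-- The quadrilateral between the triangles at the fourth vertex is a square by `square_or`, which the
almost straight angle at the second vertex does not allow. -/
lemma IsPentagonal.not_square_pattern (P : M.IsPentagonal) {d : D} (hd : M.k d = 5)
    (h : M.cycle d = [[false, false, true], [true, false], [false, true, true],
      [true, false, true], [true, false]]) : False := by
  obtain ⟨hdeg, hload⟩ := P.sums_of_cycle hd h
  simp only [cycle, List.cons.injEq, and_true] at h
  obtain ⟨s0, s1, s2, s3, s4⟩ := h
  have h5 := f5 hd
  have k1 : M.k (M.f d) = 5 := by rw [k_f, hd]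
  have k2 : M.k (M.f (M.f d)) = 5 := by rw [k_f, k1]
  have k3 : M.k (M.f (M.f (M.f d))) = 5 := by rw [k_f, k2]
  have k4 : M.k (M.f (M.f (M.f (M.f d)))) = 5 := by rw [k_f, k3]
  obtain ⟨t2, -, a2, a3⟩ := P.of_spokes_three k2 s2
  obtain ⟨t3, -, b2, -⟩ := P.of_spokes_three k3 s3
  obtain ⟨t4, -⟩ := P.of_spokes_two k4 s4
  refine P.not_square_of_wide k3 s3 ?_
    (P.square hd hdeg hload k2 (by omega) (by omega) (by omega) (n4 t2) rfl a3 a2 b2)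
  rw [h5, s0, s1]
  decide

/-- The quadrilateral between the triangles at the fourth vertex is a square by `square_or`. The angles
at the third and fourth vertices are then known, and contradict the obtuse angle at the first one. -/
lemma IsPentagonal.not_two_triangles_pattern (P : M.IsPentagonal) {d : D} (hd : M.k d = 5)
    (h : M.cycle d = [[false, false], [false, false, true], [true, true], [true, false, true],
      [true, true, false]]) : False := by
  obtain ⟨hdeg, hload⟩ := P.sums_of_cycle hd h
  simp only [cycle, List.cons.injEq, and_true] at h
  obtain ⟨s0, -, s2, s3, s4⟩ := h
  have k1 : M.k (M.f d) = 5 := by rw [k_f, hd]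
  have k2 : M.k (M.f (M.f d)) = 5 := by rw [k_f, k1]
  have k3 : M.k (M.f (M.f (M.f d))) = 5 := by rw [k_f, k2]
  have k4 : M.k (M.f (M.f (M.f (M.f d)))) = 5 := by rw [k_f, k3]
  obtain ⟨t2, a2, a3⟩ := P.of_spokes_two k2 s2
  obtain ⟨t3, -, b2, -⟩ := P.of_spokes_three k3 s3
  obtain ⟨t4, -⟩ := P.of_spokes_three k4 s4
  have hsq := P.square hd hdeg hload k2 (by omega) (by omega) (by omega) (n3 t2) rfl a3 a2 b2
  have hc := pent_chain hd
  rw [P.dot_of_two_triangles k2 s2, P.dot_of_tri_square_tri k3 s3 hsq] at hc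
  have := chain_two_triangles_square hc (neg_two_le_dot d)
  linarith [P.dot_of_negative hd (by rw [s0]; decide)]

/-- The quadrilateral between the triangles at the fourth vertex is not a square, so that `square_or`
finds a point with three quadrilaterals beyond it. There is a second such point next to the third
vertex, and the total load is exceeded. -/
lemma IsPentagonal.not_heavy_pattern (P : M.IsPentagonal) {d : D} (hd : M.k d = 5)
    (h : M.cycle d = [[false, true, true], [true, false], [false, true, true],
      [true, false, true], [true, false]]) : False := by
  obtain ⟨hdeg, hload⟩ := P.sums_of_cycle hd h
  simp only [cycle, List.cons.injEq, and_true] at h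
  obtain ⟨s0, s1, s2, s3, s4⟩ := h
  have h5 := f5 hd
  have k1 : M.k (M.f d) = 5 := by rw [k_f, hd]
  have k2 : M.k (M.f (M.f d)) = 5 := by rw [k_f, k1]
  have k3 : M.k (M.f (M.f (M.f d))) = 5 := by rw [k_f, k2]
  have k4 : M.k (M.f (M.f (M.f (M.f d)))) = 5 := by rw [k_f, k3]
  obtain ⟨t0, -, z2, z3⟩ := P.of_spokes_three hd s0
  obtain ⟨t1, -, y2⟩ := P.of_spokes_two k1 s1
  obtain ⟨t2, a1, a2, a3⟩ := P.of_spokes_three k2 s2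
  obtain ⟨t3, -, b2, -⟩ := P.of_spokes_three k3 s3
  obtain ⟨t4, -⟩ := P.of_spokes_two k4 s4
  simp only [side, cond_true, cond_false] at z2 z3 y2 a1 a2 a3 b2
  obtain ⟨w2, w3, -, hc, hor⟩ :=
    P.square_or k2 (by omega) (by omega) (by omega) (n4 t2) rfl a3 a2 b2
  -- the point beyond the quadrilateral of the fourth vertex has three quadrilaterals
  have hc7 : M.load (M.pos (M.e (M.f (M.n (M.n (M.f (M.f (M.f d)))))))) = 7 := by
    rcases hor with h | h | h
    · exfalso
      refine P.not_square_of_wide k3 s3 ?_ h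
      rw [h5, s0, s1]
      decide
    · have := P.deg_eq_four hd hdeg hc
      omega
    · exact h
  -- a neighbour of the third vertex will turn out to have three quadrilaterals as well
  obtain ⟨-, -, u4, -, -⟩ :=
    P.square_or hd (by omega) (by omega) (by omega) (n4 t0) rfl z3 z2 y2
  set y := M.f (M.f d) with hy
  set a := M.f (M.n (M.n (M.n y))) with ha
  set q := M.n (M.n (M.f d)) with hq
  set g := M.e (M.n (M.n y)) with hg
  have fg : M.f (M.f g) = q := by
    have e1 : M.f g = M.n y := M.f_e_n _
    rw [e1, hy, n_f]
    exact (eq_f_e_of_n_eq (n3 t1)).symm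
  have fq : M.f (M.f q) = g := by
    apply M.f.injective
    apply M.f.injective
    rw [fg]
    exact f4 y2
  have hgs : M.Small g := by
    rw [← fq]
    apply P.small_opposite k1 (show M.deg y ≠ 2 by omega)
      (show M.deg (M.f (M.f (M.f y))) ≠ 2 by rw [h5]; omega) _ y2
    rw [hq, M.pos_n, M.pos_n]
  have kg : M.k g = 4 := by rw [hg, k_e_n, a1]
  have kng : M.k (M.n g) = 4 := by rw [← fq, n_f, u4]
  set x := M.f (M.e g) with hx
  have nx : M.n x = g := M.f_e g
  have ex : M.e x = M.n (M.n a) := by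
    have e1 : M.f x = M.n a := by
      rw [hx, hg, M.e_e, ff_tri a2, ha]
      exact (n_f M _).symm
    rw [← e1, n_f]
  have kx : M.k x = 3 := by rw [hx, k_f, hg, M.e_e, a2]
  have kx' : M.k (M.f (M.e x)) = 4 := by rw [k_f, ex, w2]
  have hg7 : M.load (M.pos g) = 7 := by
    rcases hgs.cases with ⟨h, e0, e1, e2⟩ | ⟨h, -⟩
    · rw [← n3 h] at nx
      rw [M.n.injective nx] at kx
      omega
    · have e3 := nnn_eq h nx
      have e2 : M.n (M.n g) = M.f (M.e x) := by
        apply M.n.injective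
        rw [e3, f_e]
      exact hgs.load_eq_seven h (by rw [e3, e2, kg, kng, kx, kx'])
  have hne : M.pos (M.e (M.f (M.n (M.n (M.f y))))) ≠ M.pos g := by
    rw [← w3, pos_e, ← nx, M.pos_n, ← M.e_e x, ex, pos_e]
    exact head_n_ne _
  have := P.load_add_load_le hd hc hgs hne
  rw [hload, hc7, hg7] at this
  simp at this

/-- Six positive numbers in cyclic order, multiplied with their neighbours: if alternate products are
equal to `16` and two of the others are at most `16`, the last one is at least `16`. -/
lemma six_cycle {a b c d e f : ℝ} (ha : 0 < a) (hc : 0 < c) (hd : 0 < d) (he : 0 < e)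
    (hf : 0 < f) (h1 : b * c = 16) (h2 : d * e = 16) (h3 : f * a = 16) (h4 : c * d ≤ 16)
    (h5 : e * f ≤ 16) : 16 ≤ a * b := by
  by_contra! hab
  have hp : (a * b) * ((c * d) * (e * f)) = 16 * 16 * 16 := by
    linear_combination (d * e * f * a) * h1 + 16 * (f * a) * h2 + 16 * 16 * h3
  have h6 : (c * d) * (e * f) ≤ 16 * 16 := mul_le_mul h4 h5 (by positivity) (by norm_num)
  have h7 : 0 < (c * d) * (e * f) := by positivity
  nlinarith

/-- All points away from the pentagon have two triangles and two quadrilaterals. Three quadrilaterals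
form a ring around a triangle, each meeting the next at a corner of the triangle. The products of the
angles are equal to `16` along the quadrilaterals and at most `16` at the corners, so that the
quadrilaterals are squares; but one of them lies between two triangles at a vertex of the pentagon. -/
lemma IsPentagonal.not_ring_pattern (P : M.IsPentagonal) {d : D} (hd : M.k d = 5)
    (h : M.cycle d = [[false, true], [true, false, true], [true, false, true], [true, false],
      [false, true, false]]) : False := by
  obtain ⟨hdeg, hload⟩ := P.sums_of_cycle hd h
  simp only [cycle, List.cons.injEq, and_true] at h
  obtain ⟨s0, s1, s2, s3, s4⟩ := h
  have h5 := f5 hd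
  have k1 : M.k (M.f d) = 5 := by rw [k_f, hd]
  have k2 : M.k (M.f (M.f d)) = 5 := by rw [k_f, k1]
  have k3 : M.k (M.f (M.f (M.f d))) = 5 := by rw [k_f, k2]
  have k4 : M.k (M.f (M.f (M.f (M.f d)))) = 5 := by rw [k_f, k3]
  obtain ⟨t0, -⟩ := P.of_spokes_two hd s0
  obtain ⟨t1, -, y2, y3⟩ := P.of_spokes_three k1 s1
  obtain ⟨t2, -, a2, a3⟩ := P.of_spokes_three k2 s2
  obtain ⟨t3, -, b2⟩ := P.of_spokes_two k3 s3
  obtain ⟨t4, -⟩ := P.of_spokes_three k4 s4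
  refine P.not_square_of_wide k2 s2 (by rw [h5, s4, s0]; decide) ?_
  simp only [side, cond_true, cond_false] at y2 y3 a2 a3 b2
  -- points away from the pentagon have two triangles and two quadrilaterals
  have key : ∀ x, M.Small x → M.deg x = 4 ∧
      M.k x + M.k (M.n x) + M.k (M.n (M.n x)) + M.k (M.n (M.n (M.n x))) = 14 := by
    intro x hx
    obtain ⟨h1, h2⟩ := P.not_exceptional hd hdeg hload hx
    rcases hx.cases with ⟨h, -⟩ | ⟨-, h | h⟩
    · omega
    · exact ⟨h1, h⟩
    · rw [hx.load_eq_seven h1 h] at h2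
      omega
  -- the apex of the triangle between the two vertices
  obtain ⟨p1, p2, p3, p4⟩ := apex_faces (n4 t1) rfl y3
  have hsa := P.small_apex k1 (by omega) (by omega) (n4 t1) y3
  obtain ⟨da, ka⟩ := key _ hsa
  -- the apex of the next triangle
  obtain ⟨r1, r2, r3, r4⟩ := apex_faces (n4 t2) rfl a3
  obtain ⟨da', ka'⟩ := key _ (P.small_apex k2 (by omega) (by omega) (n4 t2) a3)
  have sg := P.small_opposite (q := M.n (M.n (M.f (M.f d)))) k2 (by omega) (by rw [h5]; omega)
    (by rw [M.pos_n, M.pos_n]) a2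
  have sh := P.small_opposite (q := M.n (M.n (M.f d))) k1 (by omega) (by rw [h5]; omega)
    (by rw [M.pos_n, M.pos_n]) y2
  set q := M.n (M.n (M.f (M.f d))) with hq
  set m := M.n (M.n (M.f d)) with hm
  set a := M.f (M.n m) with ha
  set b := M.f q with hb
  set g := M.f b with hg
  set a' := M.f (M.n q) with ha'
  set h := M.f (M.f m) with hh
  have kb : M.k b = 4 := by rw [hb, k_f, a2]
  have ea := nnn_eq da p1
  have ea' := nnn_eq da' r1
  rw [ea] at ka
  rw [ea', M.k_f (M.n (M.n (M.f (M.f (M.f d)))))] at ka'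
  have kna : M.k (M.n a) = 4 := by rw [p4, y2]
  have kna' : M.k (M.n a') = 4 := by rw [r4, a2]
  have knna : M.k (M.n (M.n a)) = 3 := by omega
  have knna' : M.k (M.n (M.n a')) = 3 := by omega
  -- the vertex of the one quadrilateral opposite to the pentagon
  obtain ⟨dg, kg⟩ := key _ sg
  have g0 : M.k g = 4 := by rw [hg, k_f, kb]
  have eg : M.n g = M.e b := n_f M b
  have g1 : M.k (M.n g) = 3 := by rw [eg, ← ea, k_e_n, knna]
  have fg : M.f g = M.n a' := by
    apply M.f.injective
    rw [r3, f_e_n]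
    exact f4 a2
  have g3 : M.k (M.n (M.n (M.n g))) = 3 := by
    rw [nnn_eq dg (f_e M g), k_f, ← n_f, fg, knna']
  have g2 : M.k (M.n (M.n g)) = 4 := by omega
  -- the vertex of the other quadrilateral opposite to the pentagon
  obtain ⟨dh, kh⟩ := key _ sh
  have fh : M.f h = M.n a := by
    apply M.f.injective
    rw [p3, f_e_n]
    exact f4 y2
  have eh : M.e h = M.n (M.n a) := by rw [← n_f, fh]
  have h0 : M.k h = 4 := by rw [← k_f, fh, kna]
  have h3' := nnn_eq dh (f_e M h)
  have h3 : M.k (M.n (M.n (M.n h))) = 3 := by rw [h3', k_f, eh, knna]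
  have ffh : M.f (M.f (M.e h)) = M.n g := by
    rw [eh, ff_tri knna, ea, eg]
  have h2' : M.n (M.n h) = M.f (M.n (M.n g)) := by
    apply M.n.injective
    rw [h3', n_f, ← ffh, n_f, M.e_e]
  have h2 : M.k (M.n (M.n h)) = 4 := by rw [h2', k_f, g2]
  have h1 : M.k (M.n h) = 3 := by omega
  have ma := opposite_quads_mul_le (M := M) (d := M.n a) (by rw [deg_n, da]) kna knna
    (by rw [ea, kb]) (by rw [n4 da, p2])
  have mg := (opposite_quads_mul_le dg g0 g1 g2 g3).1
  have mh := (opposite_quads_mul_le dh h0 h1 h2 h3).1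
  rw [ea] at ma
  have q1 := quad_mul kb
  have q2 := quad_mul g2
  have q3 := quad_mul h0
  rw [← hg] at q1
  rw [← h2'] at q2
  rw [fh] at q3
  have pos : ∀ x, 0 < 4 + M.dot x := fun x => by linarith [neg_two_le_dot (M := M) x]
  have h16 := six_cycle (pos (M.n a)) (pos g) (pos _) (pos _) (pos h) q1 q2 q3 mg
    (by rw [mul_comm]; exact mh)
  have hb0 := (ma.2 h16).2
  have hm := quad_mul a2
  rw [← hb, hb0] at hm
  linarith

/-- There is no contact map with seven triangles, five quadrilaterals and one pentagon. -/
lemma not_isPentagonal : ¬ M.IsPentagonal := by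
  intro P
  obtain ⟨N, x, hN, hx, hc⟩ := P.exists_survivor
  simp only [Pentagon.survivors, List.mem_cons, List.not_mem_nil, or_false] at hc
  rcases hc with hc | hc | hc | hc | hc
  · exact hN.not_straight_pattern hx hc
  · exact hN.not_heavy_pattern hx hc
  · exact hN.not_square_pattern hx hc
  · exact hN.not_ring_pattern hx hc
  · exact hN.not_two_triangles_pattern hx hc

lemma IsTame.not_seven_five_one (h : M.IsTame fc) (hD : Fintype.card D = 46) (h4 : fc 4 = 5)
    (h5 : fc 5 = 1) (h6 : fc 6 = 0) (h7 : fc 7 = 0) (h8 : fc 8 = 0) : False := by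
  refine not_isPentagonal (M := M) ⟨fun d => ?_, by rw [h.card_k, h4], by rw [h.card_k, h5], hD,
    h.card_nodes⟩
  have h1 := M.three_le_k d
  have h2 := h.k_le d
  have key : ∀ m, fc m = 0 → M.k d ≠ m := by
    intro m hm hd
    have := h.card_k m
    rw [hm, mul_zero, Finset.card_eq_zero] at this
    have hmem : d ∈ Finset.univ.filter fun d => M.k d = m := by simp [hd]
    rw [this] at hmem
    simp at hmem
  have := key 6 h6
  have := key 7 h7
  have := key 8 h8
  omega

end ContactMap

end KissingTwelve

theorem mainTheorem5 (V : Set KissingTwelve.Space) (hV : KissingTwelve.IsConfig V)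
    (hT : (KissingTwelve.contactHypermap hV).HasTameContact) :
    Nonempty (KissingTwelve.Hypermap.Iso
        (KissingTwelve.contactHypermap hV) KissingTwelve.fccHypermap) ∨
      Nonempty (KissingTwelve.Hypermap.Iso
        (KissingTwelve.contactHypermap hV) KissingTwelve.hcpHypermap) := by
  have h := KissingTwelve.isTame_contactMapOf hT
  rcases h.cases with ⟨hD, -⟩ | ⟨hD, hfc⟩
  · exact KissingTwelve.iso_of_card_eq hT hD
  · simp only [List.mem_cons, Prod.mk.injEq, List.not_mem_nil, or_false] at hfc
    rcases hfc with ⟨-, h4, h5, h6, h7, h8⟩ | ⟨-, h4, h5, h6, h7, h8⟩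
    · exact (h.not_six_seven hD h4 h5 h6 h7 h8).elim
    · exact (h.not_seven_five_one hD h4 h5 h6 h7 h8).elim
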